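/- **Definitions.** Let $V$ be a finite-dimensional real vector space and let $\mathrm{AGr}^m(V)$ be the space of affine subspaces of codimension $m$ in $V$, with its usual topology. A *normal measure* on $\mathrm{AGr}^m(V)$ is a signed Borel measure $\mu$ that is translation invariant and finite on compact sets (that is, a difference of two positive Borel measures with these properties). It defines the function $$\chi_m(\mu)(\xi_1,\dots,\xi_m)=\mu\bigl(\{H\in\mathrm{AGr}^m(V): H\cap\Pi_\xi\neq\emptyset\}\bigr),$$ where $\Pi_\xi=\{\sum t_i\xi_i: 0\le t_i\le 1\}$. The functions $\chi_m(\mu)$ are the *normal $m$-densities* on $V$; they form the space $\mathfrak n_m(V)$. For normal measures $\mu,\nu$ on $\mathrm{AGr}^p(V)$ and $\mathrm{AGr}^q(V)$, the normal measure $\mu\cdot\nu$ on $\mathrm{AGr}^{p+q}(V)$ is $(\mu\cdot\nu)(D)=(\mu\times\nu)\{(G,H): \operatorname{codim}(G\cap H)=p+q,\ G\cap H\in D\}$. The product in the ring $\mathfrak n(V)=\bigoplus_m\mathfrak n_m(V)$ is $\chi_p(\mu)\cdot\chi_q(\nu)=\chi_{p+q}(\mu\cdot\nu)$. A *normal $m$-density*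 on a smooth manifold $X$ is a family $\delta=(\delta_x)_{x\in X}$, $\delta_x\in\mathfrak n_m(T_xX)$, depending continuously on $x$; such densities are multiplied pointwise, which gives the ring $\mathfrak n(X)$. The density $\delta$ *locally corresponds to a decomposable form* if every point of $X$ has a neighborhood $U$ in which $\delta=|a\,\varphi_1\wedge\dots\wedge\varphi_m|$ for a continuous function $a$ and continuous $1$-forms $\varphi_1,\dots,\varphi_m$ on $U$. For normal densities $\delta_1,\delta_2$ on $X_1,X_2$, the product $\delta_1\delta_2$ on $X_1\times X_2$ is the product in $\mathfrak n(X_1\times X_2)$ of the pull-backs of $\delta_1$ and $\delta_2$ under the two projections. Let $p:X\to Y$ be a smooth locally trivial fiber bundle with compact fiber of dimension $k\le m$. The *push-forward* of an $m$-density $\delta$ on $X$ is the $(m-k)$-density $p_*\delta$ on $Y$ given by $$(p_*\delta)_y(\eta_1,\dots,\eta_{m-k})=\int_{p^{-1}(y)}\delta(\xi_1,\dots,\xi_{m-k},\,\cdot\,,\dots,\,\cdot\,),$$ where $\xi_i\in T_xX$, $x\in p^{-1}(y)$, is any vector with $dp_x(\xi_i)=\eta_i$, and the integrand is a density of top order $k$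 on the fiber $p^{-1}(y)$. **Theorem.** Let $\delta_1\in\mathfrak n_{m_1}(X_1)$ and $\delta_2\in\mathfrak n_{m_2}(X_2)$ be normal densities on smooth manifolds $X_1,X_2$ which locally correspond to decomposable forms, and let $p_i:X_i\to Y_i$ $(i=1,2)$ be smooth locally trivial fiber bundles with compact fibers of dimensions $k_i\le m_i$. Then $\delta_1\delta_2$, $p_{1*}(\delta_1)$, $p_{2*}(\delta_2)$ and $(p_1\times p_2)_*(\delta_1\delta_2)$ are normal densities, and $$(p_1\times p_2)_*(\delta_1\delta_2)=p_{1*}(\delta_1)\,p_{2*}(\delta_2)$$ in the ring $\mathfrak n(Y_1\times Y_2)$. -/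

import Mathlib

open Set MeasureTheory Module
open scoped Manifold ContDiff Topology

noncomputable section

namespace NormalDensity

/-! ### Linear theory: affine Grassmannians, normal measures and normal densities

Here `V` stands for a finite-dimensional real vector space with its canonical topology
(in the application, a tangent space of a manifold). -/

section Linear

variable {V : Type*} [AddCommGroup V] [Module ℝ V]

/-- The affine Grassmannian `AGr^m(V)`: the affine subspaces of codimension `m` in `V`. -/
def AGr (V : Type*) [AddCommGroup V] [Module ℝ V] (m : ℕ) : Type _ :=
  {H : AffineSubspace ℝ V // (H : Set V).Nonempty ∧ finrank ℝ (V ⧸ H.direction) = m}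

/-- The affine subspace `v + ker φ`, where `φ : V → ℝ^m` is linear and onto. -/
def AGr.ofSurj [TopologicalSpace V] {m : ℕ}
    (z : {φ : V →L[ℝ] (Fin m → ℝ) // Function.Surjective φ} × V) : AGr V m :=
  ⟨AffineSubspace.mk' z.2 (LinearMap.ker (z.1.1 : V →ₗ[ℝ] (Fin m → ℝ))), by
    refine ⟨AffineSubspace.mk'_nonempty _ _, ?_⟩
    rw [AffineSubspace.direction_mk']
    rw [(LinearMap.quotKerEquivOfSurjective _ z.1.2).finrank_eq]
    simp⟩

/-- The usual topology of the affine Grassmannian: the quotient topology for the map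
`(φ, v) ↦ v + ker φ` from pairs (surjective linear map `V → ℝ^m`, vector of `V`). -/
instance [TopologicalSpace V] (m : ℕ) : TopologicalSpace (AGr V m) :=
  TopologicalSpace.coinduced AGr.ofSurj inferInstance

/-- The Borel σ-algebra of the affine Grassmannian. -/
instance [TopologicalSpace V] (m : ℕ) : MeasurableSpace (AGr V m) := borel _

instance [TopologicalSpace V] (m : ℕ) : BorelSpace (AGr V m) := ⟨rfl⟩

/-- A (positive) Borel measure on `AGr^m(V)` is normal if it is translation invariant and
finite on compact sets. The condition `∃ H ∈ S, G = H + v` says that `G` is in `S + v`. -/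
structure IsNormalMeasure [TopologicalSpace V] {m : ℕ} (μ : Measure (AGr V m)) : Prop where
  invariant : ∀ (v : V) (S : Set (AGr V m)), MeasurableSet S →
    μ {G | ∃ H ∈ S, (G.1 : Set V) = (fun x => x + v) '' (H.1 : Set V)} = μ S
  finite_of_isCompact : ∀ K : Set (AGr V m), IsCompact K → μ K < ⊤

/-- A signed Borel measure `pos - neg`, given by its positive and negative parts. It need not be
bounded, so it is not a `SignedMeasure`. -/
structure SignedBorel (α : Type*) [MeasurableSpace α] where
  pos : Measure α
  neg : Measure α

/-- Normal signed measures on `AGr^m(V)`. By uniqueness of the Jordan decomposition, a signed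
Borel measure that is translation invariant and finite on compact sets is the same as a difference
of two such positive measures. -/
def SignedBorel.IsNormal [TopologicalSpace V] {m : ℕ} (μ : SignedBorel (AGr V m)) : Prop :=
  IsNormalMeasure μ.pos ∧ IsNormalMeasure μ.neg

/-- The set of `H ∈ AGr^m(V)` that meet `D`. -/
def meeting (m : ℕ) (D : Set V) : Set (AGr V m) := {H | ((H.1 : Set V) ∩ D).Nonempty}

/-- The map `χ_m`: the value of the density `χ_m(μ)` on `ξ₁ ∧ … ∧ ξ_m` is the measure of the set
of affine subspaces of codimension `m` that meet the parallelotope generated by the `ξᵢ`. -/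
def chi [TopologicalSpace V] {m : ℕ} (μ : SignedBorel (AGr V m)) (ξ : Fin m → V) : ℝ :=
  μ.pos.real (meeting m (parallelepiped ξ)) - μ.neg.real (meeting m (parallelepiped ξ))

/-- The space `𝔫_m(V)` of normal `m`-densities on `V`, i.e. the image of the normal measures
under `χ_m`. A density is written as a function of the `m` vectors `ξ₁, …, ξ_m`
instead of the decomposable `m`-vector `ξ₁ ∧ … ∧ ξ_m`. -/
def IsNormalAt [TopologicalSpace V] {m : ℕ} (δ : (Fin m → V) → ℝ) : Prop :=
  ∃ μ : SignedBorel (AGr V m), μ.IsNormal ∧ chi μ = δ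

/-- The pairs `(G, H)` for which `G ∩ H` is an affine subspace of codimension `p + q`. -/
def transversal (V : Type*) [AddCommGroup V] [Module ℝ V] (p q : ℕ) : Set (AGr V p × AGr V q) :=
  {z | ((z.1.1 ⊓ z.2.1 : AffineSubspace ℝ V) : Set V).Nonempty ∧
    finrank ℝ (V ⧸ (z.1.1 ⊓ z.2.1).direction) = p + q}

/-- The intersection map `P_{p,q}`. -/
def inter {p q : ℕ} (z : transversal V p q) : AGr V (p + q) :=
  ⟨z.1.1.1 ⊓ z.1.2.1, z.2⟩

/-- The product `μ · ν`, `(μ · ν)(D) = (μ × ν)(P_{p,q}⁻¹(D))`, for positive measures. -/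
def mulMeasure [TopologicalSpace V] {p q : ℕ} (μ : Measure (AGr V p)) (ν : Measure (AGr V q)) :
    Measure (AGr V (p + q)) :=
  ((μ.prod ν).comap ((↑) : transversal V p q → AGr V p × AGr V q)).map inter

/-- The product `μ · ν` of signed measures, by bilinearity. -/
def SignedBorel.mul [TopologicalSpace V] {p q : ℕ} (μ : SignedBorel (AGr V p))
    (ν : SignedBorel (AGr V q)) : SignedBorel (AGr V (p + q)) where
  pos := mulMeasure μ.pos ν.pos + mulMeasure μ.neg ν.neg
  neg := mulMeasure μ.pos ν.neg + mulMeasure μ.neg ν.pos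

open scoped Classical in
/-- The product in the ring `𝔫(V)` of normal densities: `χ_p(μ) · χ_q(ν) = χ_{p+q}(μ · ν)`.
(The kernel of `χ` is an ideal, so the result does not depend on the choice of `μ` and `ν`.) -/
def mulAt [TopologicalSpace V] {p q : ℕ} (δ₁ : (Fin p → V) → ℝ) (δ₂ : (Fin q → V) → ℝ) :
    (Fin (p + q) → V) → ℝ :=
  if h : IsNormalAt δ₁ ∧ IsNormalAt δ₂ then chi (h.1.choose.mul h.2.choose) else 0

end Linear

/-! ### Densities on manifolds -/

section Manifold

variable {E : Type*} [NormedAddCommGroup E] [NormedSpace ℝ E]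
  {H : Type*} [TopologicalSpace H] (I : ModelWithCorners ℝ E H)
  {X : Type*} [TopologicalSpace X] [ChartedSpace H X]

/-- A family of real functions of `m` tangent vectors, one for every point of the manifold.
Densities and exterior forms are such families. -/
abbrev DensityField (X : Type*) [TopologicalSpace X] [ChartedSpace H X] (m : ℕ) : Type _ :=
  ∀ x : X, (Fin m → TangentSpace I x) → ℝ

variable {I}

/-- Continuity over the set `U`, expressed in the standard trivializations of the tangent bundle:
`δ_x(ξ₁, …, ξ_m)` is a continuous function of `x ∈ U` and of the coordinates of the `ξᵢ`. -/
def ContinuousFieldOn [IsManifold I 1 X] {m : ℕ} (δ : DensityField I X m) (U : Set X) : Prop :=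
  ∀ x₀ : X, ContinuousOn
    (fun z : X × (Fin m → E) =>
      δ z.1 (fun i => (trivializationAt E (TangentSpace I : X → Type _) x₀).symmL ℝ z.1 (z.2 i)))
    ((U ∩ (trivializationAt E (TangentSpace I : X → Type _) x₀).baseSet) ×ˢ univ)

/-- Normal `m`-densities on `X`, i.e. the elements of `𝔫_m(X)`: a normal density on each tangent
space, depending continuously on the point. -/
structure IsNormal [IsManifold I 1 X] {m : ℕ} (δ : DensityField I X m) : Prop where
  normalAt : ∀ x, IsNormalAt (δ x)
  continuous : ContinuousFieldOn δ univ

/-- The `m`-density `δ` locally corresponds to a decomposable form: near every point it is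
the absolute value of a form `a · φ₁ ∧ … ∧ φ_m` with a continuous function `a` and
continuous `1`-forms `φᵢ`. (For `m ≥ 1` the factor `a` is redundant; for `m = 0` it is the form.) -/
def IsLocallyDecomposable [IsManifold I 1 X] {m : ℕ} (δ : DensityField I X m) : Prop :=
  ∀ x₀ : X, ∃ U : Set X, IsOpen U ∧ x₀ ∈ U ∧
    ∃ (a : X → ℝ) (φ : Fin m → ∀ x : X, TangentSpace I x →L[ℝ] ℝ),
      ContinuousOn a U ∧
      (∀ i, ContinuousFieldOn (fun x (ξ : Fin 1 → TangentSpace I x) => φ i x (ξ 0)) U) ∧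
      ∀ x ∈ U, ∀ ξ : Fin m → TangentSpace I x,
        δ x ξ = |a x * Matrix.det (Matrix.of fun i j => φ i x (ξ j))|

/-- The product in the ring `𝔫(X)`, defined pointwise. -/
def mul {p q : ℕ} (δ₁ : DensityField I X p) (δ₂ : DensityField I X q) : DensityField I X (p + q) :=
  fun x => mulAt (δ₁ x) (δ₂ x)

variable {E' : Type*} [NormedAddCommGroup E'] [NormedSpace ℝ E']
  {H' : Type*} [TopologicalSpace H'] {I' : ModelWithCorners ℝ E' H'}
  {X' : Type*} [TopologicalSpace X'] [ChartedSpace H' X']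

/-- The pull-back of densities under a differentiable map. -/
def pullback (f : X → X') {m : ℕ} (δ : DensityField I' X' m) : DensityField I X m :=
  fun x ξ => δ (f x) (fun i => mfderiv I I' f x (ξ i))

/-- The product `δ₁ δ₂` on `X × X'` of normal densities `δ₁` on `X` and `δ₂` on `X'`: the product
in the ring `𝔫(X × X')` of their liftings (pull-backs under the projections). -/
def prodMul {p q : ℕ} (δ₁ : DensityField I X p) (δ₂ : DensityField I' X' q) :
    DensityField (I.prod I') (X × X') (p + q) :=
  mul (pullback (Prod.fst : X × X' → X) δ₁) (pullback (Prod.snd : X × X' → X') δ₂)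

end Manifold

/-! ### Integration of top-order densities over a compact manifold -/

section Integral

variable {E : Type*} [NormedAddCommGroup E] [NormedSpace ℝ E] [FiniteDimensional ℝ E]
  {H : Type*} [TopologicalSpace H]

theorem exists_chartPartition (H F : Type*) [TopologicalSpace H] [TopologicalSpace F]
    [ChartedSpace H F] [T2Space F] [CompactSpace F] :
    ∃ ρ : PartitionOfUnity F F univ, ρ.IsSubordinate fun c => (chartAt H c).source :=
  PartitionOfUnity.exists_isSubordinate isClosed_univ _ (fun c => (chartAt H c).open_source)
    (fun c _ => mem_iUnion.2 ⟨c, mem_chart_source H c⟩)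

/-- A partition of unity on a compact manifold, subordinate to its charts. -/
def chartPartition (H F : Type*) [TopologicalSpace H] [TopologicalSpace F]
    [ChartedSpace H F] [T2Space F] [CompactSpace F] : PartitionOfUnity F F univ :=
  (exists_chartPartition H F).choose

/-- The integral of a top-order density `β` over a compact manifold `F` (without boundary) of
dimension `k`: the sum over the charts `c` of
`∫ ρ_c · β(∂/∂t₁, …, ∂/∂t_k) dt₁ … dt_k`
in the coordinates `t ∈ ℝ^k` of the chart, where `ρ` is a partition of unity. -/
def densityIntegral (I : ModelWithCorners ℝ E H) {F : Type*} [TopologicalSpace F]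
    [ChartedSpace H F] [T2Space F] [CompactSpace F] (β : DensityField I F (finrank ℝ E)) : ℝ :=
  ∑ᶠ c : F, ∫ t in {t : Fin (finrank ℝ E) → ℝ |
      ∑ j, t j • finBasis ℝ E j ∈ (extChartAt I c).target},
    chartPartition H F c ((extChartAt I c).symm (∑ j, t j • finBasis ℝ E j)) *
      β ((extChartAt I c).symm (∑ j, t j • finBasis ℝ E j))
        (fun i => mfderiv 𝓘(ℝ, E) I (extChartAt I c).symm (∑ j, t j • finBasis ℝ E j)
          (finBasis ℝ E i))

end Integral

/-! ### Fiber bundles and the push-forward -/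

section Pushforward

variable {EX : Type*} [NormedAddCommGroup EX] [NormedSpace ℝ EX]
  {HX : Type*} [TopologicalSpace HX] (IX : ModelWithCorners ℝ EX HX)
  {X : Type*} [TopologicalSpace X] [ChartedSpace HX X]
  {EY : Type*} [NormedAddCommGroup EY] [NormedSpace ℝ EY]
  {HY : Type*} [TopologicalSpace HY] (IY : ModelWithCorners ℝ EY HY)
  {Y : Type*} [TopologicalSpace Y] [ChartedSpace HY Y]
  {EF : Type*} [NormedAddCommGroup EF] [NormedSpace ℝ EF] [FiniteDimensional ℝ EF]
  {HF : Type*} [TopologicalSpace HF] (IF : ModelWithCorners ℝ EF HF)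
  (F : Type*) [TopologicalSpace F] [ChartedSpace HF F]

/-- `e` is a smooth local trivialization of `p : X → Y` with fiber `F` near the point `y`:
a diffeomorphism of `p⁻¹(B)` onto `B × F` over an open set `B` that contains `y`. -/
def IsSmoothTrivializationNear {p : X → Y} (e : Bundle.Trivialization F p) (y : Y) : Prop :=
  y ∈ e.baseSet ∧ ContMDiffOn IX (IY.prod IF) ∞ e e.source ∧
    ContMDiffOn (IY.prod IF) IX ∞ e.toOpenPartialHomeomorph.symm e.target

/-- `p : X → Y` is a smooth locally trivial fiber bundle with fiber `F`. -/
def IsSmoothFiberBundle (p : X → Y) : Prop :=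
  ∀ y : Y, ∃ e : Bundle.Trivialization F p, IsSmoothTrivializationNear IX IY IF F e y

/-- A tangent vector `ξ` at `x` with `dp_x(ξ) = η`, chosen arbitrarily. -/
def lift (p : X → Y) (x : X) {y : Y} (η : TangentSpace IY y) : TangentSpace IX x :=
  Classical.epsilon fun ξ : TangentSpace IX x =>
    tangentMap IX IY p ⟨x, ξ⟩ = (⟨y, η⟩ : TangentBundle IY Y)

open scoped Classical in
/-- The push-forward `p_* δ` of an `m`-density `δ` under the projection `p : X → Y` of a
fiber bundle whose fiber `F` is compact of dimension `k = dim F ≤ m`. It is an `l`-density on `Y`,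
where `l = m - k`:
`(p_* δ)(η₁, …, η_l)` is the integral over the fiber `p⁻¹(y)` of the density
`(f₁, …, f_k) ↦ δ(ξ₁, …, ξ_l, f₁, …, f_k)`, where `ξᵢ` is a lift of `ηᵢ`. The fiber `p⁻¹(y)` is
identified with `F` by the diffeomorphism `z ↦ e⁻¹(y, z)` that a local trivialization `e` gives. -/
def pushforward [T2Space F] [CompactSpace F] (p : X → Y) {l m : ℕ} (h : l + finrank ℝ EF = m)
    (δ : DensityField IX X m) : DensityField IY Y l :=
  fun y η =>
    if hy : ∃ e : Bundle.Trivialization F p, IsSmoothTrivializationNear IX IY IF F e y then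
      densityIntegral IF fun (z : F) (f : Fin (finrank ℝ EF) → TangentSpace IF z) =>
        δ (hy.choose.toOpenPartialHomeomorph.symm (y, z))
          ((Fin.append
              (fun i => lift IX IY p (hy.choose.toOpenPartialHomeomorph.symm (y, z)) (η i))
              (fun j => mfderiv IF IX
                (fun z' : F => hy.choose.toOpenPartialHomeomorph.symm (y, z')) z (f j)))
            ∘ Fin.cast h.symm)
    else 0

end Pushforward

end NormalDensity

end

set_option linter.unusedSectionVars false
noncomputable section
namespace NormalDensity

section Grassmannian

variable {V : Type*} [NormedAddCommGroup V] [NormedSpace ℝ V] {m p q : ℕ}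

/-- Surjective continuous linear maps onto `ℝ^m`. -/
abbrev Surj (V : Type*) [NormedAddCommGroup V] [NormedSpace ℝ V] (m : ℕ) : Type _ :=
  {φ : V →L[ℝ] (Fin m → ℝ) // Function.Surjective φ}

/-- The affine subspace `{x | φ x = c}`. -/
def fiberAt (z : Surj V m × (Fin m → ℝ)) : AGr V m :=
  AGr.ofSurj (z.1, Function.surjInv z.1.2 z.2)

theorem AGr.ext_mem {G H : AGr V m} (h : ∀ x, x ∈ G.1 ↔ x ∈ H.1) : G = H :=
  Subtype.ext (AffineSubspace.ext h)

theorem AGr.mem_ofSurj (z : Surj V m × V) (x : V) :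
    x ∈ (AGr.ofSurj z).1 ↔ z.1.1 x = z.1.1 z.2 := by
  simp [AGr.ofSurj, AffineSubspace.mem_mk', sub_eq_zero]

@[simp] theorem mem_fiberAt (z : Surj V m × (Fin m → ℝ)) (x : V) :
    x ∈ (fiberAt z).1 ↔ z.1.1 x = z.2 := by
  rw [fiberAt, AGr.mem_ofSurj, Function.surjInv_eq z.1.2]

@[simp] theorem direction_fiberAt (z : Surj V m × (Fin m → ℝ)) :
    (fiberAt z).1.direction = LinearMap.ker (z.1.1 : V →ₗ[ℝ] (Fin m → ℝ)) := by
  simp [fiberAt, AGr.ofSurj]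

theorem AGr.ofSurj_eq_fiberAt (z : Surj V m × V) :
    AGr.ofSurj z = fiberAt (z.1, z.1.1 z.2) :=
  AGr.ext_mem fun x => by rw [AGr.mem_ofSurj, mem_fiberAt]

theorem fiberAt_comp (φ : Surj V m) (c : Fin m → ℝ)
    (A : (Fin m → ℝ) ≃L[ℝ] (Fin m → ℝ)) :
    fiberAt (⟨(A : (Fin m → ℝ) →L[ℝ] (Fin m → ℝ)).comp φ.1, A.surjective.comp φ.2⟩, A c) =
      fiberAt (φ, c) :=
  AGr.ext_mem fun x => by simp

theorem exists_comp_eq_of_ker_eq {φ ψ : Surj V m}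
    (h : LinearMap.ker (φ.1 : V →ₗ[ℝ] (Fin m → ℝ)) = LinearMap.ker (ψ.1 : V →ₗ[ℝ] (Fin m → ℝ))) :
    ∃ A : (Fin m → ℝ) ≃L[ℝ] (Fin m → ℝ), ∀ x, ψ.1 x = A (φ.1 x) := by
  obtain ⟨R, hR⟩ := (φ.1 : V →ₗ[ℝ] (Fin m → ℝ)).exists_rightInverse_of_surjective
    (LinearMap.range_eq_top.2 φ.2)
  have hR' : ∀ c, φ.1 (R c) = c := fun c => by simpa using LinearMap.congr_fun hR c
  have key : ∀ x, ψ.1 x = ψ.1 (R (φ.1 x)) := fun x => by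
    have : x - R (φ.1 x) ∈ LinearMap.ker (ψ.1 : V →ₗ[ℝ] (Fin m → ℝ)) := by
      rw [← h]; simp [hR']
    simpa [sub_eq_zero] using this
  have hs : Function.Surjective ((ψ.1 : V →ₗ[ℝ] (Fin m → ℝ)) ∘ₗ R) := fun c => by
    obtain ⟨x, rfl⟩ := ψ.2 c
    exact ⟨φ.1 x, by simp [← key]⟩
  refine ⟨(LinearEquiv.ofBijective _
    ⟨LinearMap.injective_iff_surjective.2 hs, hs⟩).toContinuousLinearEquiv, fun x => ?_⟩
  exact key x

theorem isOpenMap_fiberAt : IsOpenMap (fiberAt : Surj V m × (Fin m → ℝ) → AGr V m) := by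
  intro U hU
  rw [isOpen_coinduced]
  have : AGr.ofSurj ⁻¹' (fiberAt '' U) = ⋃ A : (Fin m → ℝ) ≃L[ℝ] (Fin m → ℝ),
      (fun z : Surj V m × V =>
        ((⟨(A : (Fin m → ℝ) →L[ℝ] (Fin m → ℝ)).comp z.1.1, A.surjective.comp z.1.2⟩ : Surj V m),
          A (z.1.1 z.2))) ⁻¹' U := by
    ext z
    simp only [mem_preimage, mem_image, mem_iUnion]
    constructor
    · rintro ⟨⟨φ, c⟩, hU, he⟩
      rw [AGr.ofSurj_eq_fiberAt] at he
      obtain ⟨A, hA⟩ := exists_comp_eq_of_ker_eq (φ := z.1) (ψ := φ) (by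
        have := congrArg (fun G : AGr V m => G.1.direction) he
        simpa using this.symm)
      refine ⟨A, ?_⟩
      convert hU using 1
      refine Prod.ext (Subtype.ext ?_) ?_
      · ext1 x; simp [hA]
      · have : z.2 ∈ (fiberAt (φ, c)).1 := by rw [he]; simp
        simpa [hA] using this
    · rintro ⟨A, hA⟩
      exact ⟨_, hA, by rw [AGr.ofSurj_eq_fiberAt, fiberAt_comp]⟩
  rw [this]
  refine isOpen_iUnion fun A => hU.preimage ?_
  refine Continuous.prodMk (Continuous.subtype_mk ?_ _) ?_
  · exact (continuous_const.clm_comp (continuous_subtype_val.comp continuous_fst))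
  · exact A.continuous.comp ((continuous_subtype_val.comp continuous_fst).clm_apply continuous_snd)

theorem isOpenMap_eval :
    IsOpenMap (fun z : Surj V m × V => (z.1, z.1.1 z.2)) := by
  refine IsOpenMap.of_sections fun z₀ => ?_
  obtain ⟨φ₀, v₀⟩ := z₀
  obtain ⟨R, hR⟩ := (φ₀.1 : V →ₗ[ℝ] (Fin m → ℝ)).exists_rightInverse_of_surjective
    (LinearMap.range_eq_top.2 φ₀.2)
  set R' : (Fin m → ℝ) →L[ℝ] V := LinearMap.toContinuousLinearMap R
  have hR' : φ₀.1 ∘L R' = 1 := by ext1 c; simpa [R'] using LinearMap.congr_fun hR c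
  have hc : Continuous fun z : Surj V m × (Fin m → ℝ) => z.1.1 ∘L R' :=
    (continuous_subtype_val.comp continuous_fst).clm_comp continuous_const
  have hinv : ContinuousAt (fun z : Surj V m × (Fin m → ℝ) => Ring.inverse (z.1.1 ∘L R'))
      (φ₀, φ₀.1 v₀) := by
    refine ContinuousAt.comp (g := Ring.inverse) (f := fun z : Surj V m × (Fin m → ℝ) => z.1.1 ∘L R') ?_
      hc.continuousAt
    simp only [hR']
    exact NormedRing.inverse_continuousAt 1
  have hu : ∀ᶠ z : Surj V m × (Fin m → ℝ) in 𝓝 (φ₀, φ₀.1 v₀), IsUnit (z.1.1 ∘L R') :=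
    (hc.isOpen_preimage _ Units.isOpen).mem_nhds
      (by simp only [mem_preimage, hR']; exact isUnit_one)
  classical
  refine ⟨fun z => (z.1, if IsUnit (z.1.1 ∘L R') then
    v₀ + R' (Ring.inverse (z.1.1 ∘L R') (z.2 - z.1.1 v₀)) else Function.surjInv z.1.2 z.2),
    continuousAt_fst.prodMk ?_, ?_, fun z => Prod.ext rfl ?_⟩
  · have hs : ContinuousAt (fun z : Surj V m × (Fin m → ℝ) =>
        v₀ + R' (Ring.inverse (z.1.1 ∘L R') (z.2 - z.1.1 v₀))) (φ₀, φ₀.1 v₀) :=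
      continuousAt_const.add (R'.continuous.continuousAt.comp (hinv.clm_apply
        (continuousAt_snd.sub
          ((continuous_subtype_val.comp continuous_fst).clm_apply
            continuous_const).continuousAt)))
    refine hs.congr ?_
    filter_upwards [hu] with z hz
    rw [if_pos hz]
  · simp [hR', isUnit_one]
  · by_cases hz : IsUnit (z.1.1 ∘L R')
    · have := congrArg (fun f : (Fin m → ℝ) →L[ℝ] (Fin m → ℝ) => f (z.2 - z.1.1 v₀))
        (Ring.mul_inverse_cancel _ hz)
      simp only [if_pos hz, map_add]
      simp only [mul_apply_eq_comp, ContinuousLinearMap.comp_apply,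
        one_apply_eq_self] at this
      rw [this]; abel
    · simp only [if_neg hz, Function.surjInv_eq z.1.2]

theorem continuous_fiberAt : Continuous (fiberAt : Surj V m × (Fin m → ℝ) → AGr V m) := by
  refine continuous_def.2 fun W hW => ?_
  rw [isOpen_coinduced] at hW
  convert isOpenMap_eval _ hW using 1
  ext ⟨φ, c⟩
  constructor
  · intro h
    exact ⟨(φ, Function.surjInv φ.2 c), h, by simp [Function.surjInv_eq φ.2]⟩
  · rintro ⟨z, hz, he⟩
    rw [mem_preimage, AGr.ofSurj_eq_fiberAt] at hz
    exact he ▸ hz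

variable [FiniteDimensional ℝ V]

theorem fiberAt_surjective : Function.Surjective (fiberAt : _ → AGr V m) := by
  rintro ⟨G, ⟨x, hx⟩, hG⟩
  have e : (V ⧸ G.direction) ≃ₗ[ℝ] (Fin m → ℝ) :=
    LinearEquiv.ofFinrankEq _ _ (by simp [hG])
  refine ⟨(⟨LinearMap.toContinuousLinearMap (e.toLinearMap ∘ₗ G.direction.mkQ),
    e.surjective.comp (Submodule.mkQ_surjective _)⟩, e (G.direction.mkQ x)), ?_⟩
  refine AGr.ext_mem fun y => ?_
  simp only [mem_fiberAt]
  change e _ = e _ ↔ y ∈ G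
  rw [e.injective.eq_iff]
  change Submodule.Quotient.mk y = Submodule.Quotient.mk x ↔ _
  rw [Submodule.Quotient.eq]
  exact AffineSubspace.vsub_right_mem_direction_iff_mem hx y

theorem isOpenQuotientMap_fiberAt : IsOpenQuotientMap (fiberAt : _ → AGr V m) :=
  ⟨fiberAt_surjective, continuous_fiberAt, isOpenMap_fiberAt⟩

instance : SecondCountableTopology (V →L[ℝ] (Fin m → ℝ)) := by
  have : ProperSpace (V →L[ℝ] (Fin m → ℝ)) := FiniteDimensional.proper ℝ _
  infer_instance

instance : SecondCountableTopology (AGr V m) := by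
  have h := isOpenQuotientMap_fiberAt (V := V) (m := m)
  exact ((TopologicalSpace.isBasis_countableBasis _).isQuotientMap h.isQuotientMap
    h.isOpenMap).secondCountableTopology
      ((TopologicalSpace.countable_countableBasis _).image _)

theorem isOpenQuotientMap_fiberAt_prod : IsOpenQuotientMap
    (Prod.map fiberAt fiberAt : _ → AGr V p × AGr V q) :=
  isOpenQuotientMap_fiberAt.prodMap isOpenQuotientMap_fiberAt

theorem isClosed_exists_mem_compact {P W : Type*} [TopologicalSpace P] [TopologicalSpace W]
    {D : Set W} (hD : IsCompact D) {R : Set (P × W)} (hR : IsClosed R) :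
    IsClosed {z | ∃ d ∈ D, (z, d) ∈ R} := by
  have : CompactSpace D := isCompact_iff_compactSpace.1 hD
  have h := isClosedMap_fst_of_compactSpace (X := P) (Y := D) _
    (hR.preimage (f := fun z : P × D => (z.1, (z.2 : W))) (by fun_prop))
  convert h using 1
  ext z
  simp

theorem isClosed_meeting {D : Set V} (hD : IsCompact D) : IsClosed (meeting m D) := by
  rw [← isOpenQuotientMap_fiberAt.isQuotientMap.isClosed_preimage]
  convert isClosed_exists_mem_compact hD
    (R := {z : (Surj V m × (Fin m → ℝ)) × V | z.1.1.1 z.2 = z.1.2})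
    (isClosed_eq ((continuous_subtype_val.comp (by fun_prop)).clm_apply (by fun_prop))
      (by fun_prop)) using 1
  ext z
  simp [meeting, Set.Nonempty, and_comm]

theorem measurableSet_meeting {D : Set V} (hD : IsCompact D) :
    MeasurableSet (meeting m D : Set (AGr V m)) := (isClosed_meeting hD).measurableSet

theorem AGr.isOpen_iff {U : Set (AGr V m)} : IsOpen U ↔ IsOpen (fiberAt ⁻¹' U) :=
  isOpenQuotientMap_fiberAt.isQuotientMap.isOpen_preimage.symm

theorem AGr.isClosed_iff {U : Set (AGr V m)} : IsClosed U ↔ IsClosed (fiberAt ⁻¹' U) :=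
  isOpenQuotientMap_fiberAt.isQuotientMap.isClosed_preimage.symm

theorem isOpen_meeting {D : Set V} (hD : IsOpen D) : IsOpen (meeting m D) := by
  rw [AGr.isOpen_iff]
  convert isOpenMap_eval _ (isOpen_univ.prod hD) using 1
  ext ⟨φ, c⟩
  simp only [mem_preimage, meeting, Set.Nonempty, mem_inter_iff, SetLike.mem_coe,
    Set.mem_ofPred_eq, mem_fiberAt, mem_image, mem_prod, mem_univ, true_and, Prod.mk.injEq,
    Prod.exists]
  constructor
  · rintro ⟨x, h, hx⟩
    exact ⟨φ, x, hx, rfl, h⟩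
  · rintro ⟨_, x, hx, rfl, h⟩
    exact ⟨x, h, hx⟩

end Grassmannian

section Vdet

variable {V W : Type*} [NormedAddCommGroup V] [NormedSpace ℝ V] {m n p q : ℕ}
  [NormedAddCommGroup W] [NormedSpace ℝ W]

/-- The value of the decomposable form `φ₁ ∧ … ∧ φ_m` on `ξ₁, …, ξ_m`. -/
def vdet (φ : V →L[ℝ] (Fin m → ℝ)) (ξ : Fin m → V) : ℝ :=
  Matrix.det (Matrix.of fun j => φ (ξ j))

/-- The decomposable form `φ₁ ∧ … ∧ φ_m` as an alternating map. -/
def vdetAlt (φ : V →L[ℝ] (Fin m → ℝ)) : V [⋀^Fin m]→ₗ[ℝ] ℝ :=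
  (Matrix.detRowAlternating (R := ℝ) (n := Fin m)).compLinearMap (φ : V →ₗ[ℝ] (Fin m → ℝ))

theorem vdetAlt_apply (φ : V →L[ℝ] (Fin m → ℝ)) (ξ : Fin m → V) :
    vdetAlt φ ξ = vdet φ ξ := rfl

theorem vdet_comp (φ : W →L[ℝ] (Fin m → ℝ)) (f : V →L[ℝ] W) (ξ : Fin m → V) :
    vdet (φ ∘L f) ξ = vdet φ (fun j => f (ξ j)) := rfl

theorem vdet_eq_zero_of_forall_basis (b : Basis (Fin n) ℝ V) (φ : V →L[ℝ] (Fin m → ℝ))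
    (h : ∀ I : Fin m → Fin n, vdet φ (b ∘ I) = 0) (ξ : Fin m → V) : vdet φ ξ = 0 := by
  have : (vdetAlt φ).toMultilinearMap = 0 :=
    Basis.ext_multilinear (fun _ => b) fun I => h I
  exact congrArg (fun f : MultilinearMap ℝ (fun _ : Fin m => V) ℝ => f ξ) this

theorem exists_vdet_ne_zero (b : Basis (Fin n) ℝ V) {φ : V →L[ℝ] (Fin m → ℝ)}
    (hφ : Function.Surjective φ) : ∃ I : Fin m → Fin n, vdet φ (b ∘ I) ≠ 0 := by
  by_contra! h
  have h1 := vdet_eq_zero_of_forall_basis b φ h (fun j => Function.surjInv hφ (Pi.single j 1))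
  have h2 : vdet φ (fun j => Function.surjInv hφ (Pi.single j 1)) = 1 := by
    rw [vdet, ← Matrix.det_one (n := Fin m)]
    congr 1
    ext i j
    simp [Function.surjInv_eq hφ, Matrix.one_apply, Pi.single_apply, eq_comm]
  exact one_ne_zero (h2.symm.trans h1)

/-- The linear functionals of `φ`, normalized to be dual to the vectors `e`. -/
def normalize [FiniteDimensional ℝ V] (φ : V →L[ℝ] (Fin m → ℝ)) (e : Fin m → V) :
    V →L[ℝ] (Fin m → ℝ) :=
  LinearMap.toContinuousLinearMap
    (LinearMap.pi fun j => (vdet φ e)⁻¹ • (vdetAlt φ).toMultilinearMap.toLinearMap e j)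

section
variable [FiniteDimensional ℝ V]

theorem normalize_apply (φ : V →L[ℝ] (Fin m → ℝ)) (e : Fin m → V) (v : V) (j : Fin m) :
    normalize φ e v j = (vdet φ e)⁻¹ * vdet φ (Function.update e j v) := rfl

theorem sum_normalize {φ : V →L[ℝ] (Fin m → ℝ)} {e : Fin m → V} (he : vdet φ e ≠ 0) (v : V) :
    φ v = ∑ j, normalize φ e v j • φ (e j) := by
  set T : Matrix (Fin m) (Fin m) ℝ := Matrix.of fun j => φ (e j) with hT
  have h := Matrix.mulVec_cramer T.transpose (φ v)
  have hd : T.transpose.det = vdet φ e := by rw [Matrix.det_transpose]; rfl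
  rw [hd] at h
  have h2 : φ v = (vdet φ e)⁻¹ • (T.transpose.mulVec (T.transpose.cramer (φ v))) := by
    rw [h, smul_smul, inv_mul_cancel₀ he, one_smul]
  rw [h2, ← Matrix.mulVec_smul]
  ext i
  simp only [Matrix.mulVec, dotProduct, Finset.sum_apply, Pi.smul_apply, Matrix.transpose_apply,
    Matrix.cramer_transpose_apply, normalize_apply, smul_eq_mul]
  refine Finset.sum_congr rfl fun j _ => ?_
  have : (T.updateRow j (φ v)).det = vdet φ (Function.update e j v) := by
    unfold vdet; congr 1
    ext a b
    by_cases hab : a = j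
    · subst hab; simp
    · simp [hab, T]
  rw [this, hT, Matrix.of_apply]; ring

theorem vdet_normalize {φ : V →L[ℝ] (Fin m → ℝ)} {e : Fin m → V} (he : vdet φ e ≠ 0)
    (ξ : Fin m → V) : vdet φ ξ = vdet (normalize φ e) ξ * vdet φ e := by
  unfold vdet
  rw [← Matrix.det_mul]
  congr 1
  ext i k
  rw [Matrix.of_apply, sum_normalize he]
  simp [Matrix.mul_apply]

theorem normalize_self {φ : V →L[ℝ] (Fin m → ℝ)} {e : Fin m → V} (he : vdet φ e ≠ 0)
    (j : Fin m) : normalize φ e (e j) = Pi.single j 1 := by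
  ext i
  rw [normalize_apply]
  by_cases h : i = j
  · subst h; simp [inv_mul_cancel₀ he]
  · have : vdet φ (Function.update e i (e j)) = 0 :=
      (vdetAlt φ).map_eq_zero_of_eq _ (i := i) (j := j) (by simp [Function.update_of_ne (Ne.symm h)]) h
    simp [this, h]

theorem normalize_surjective {φ : V →L[ℝ] (Fin m → ℝ)} {e : Fin m → V} (he : vdet φ e ≠ 0) :
    Function.Surjective (normalize φ e) := fun c => by
  refine ⟨∑ j, c j • e j, ?_⟩
  rw [map_sum]
  ext i
  simp [normalize_self he, Pi.single_apply]

theorem surjective_of_vdet_ne_zero {φ : V →L[ℝ] (Fin m → ℝ)} {e : Fin m → V}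
    (he : vdet φ e ≠ 0) : Function.Surjective φ := by
  have h : IsUnit (Matrix.of fun j => φ (e j)).transpose := by
    rw [Matrix.isUnit_iff_isUnit_det, Matrix.det_transpose]
    exact he.isUnit
  intro c
  obtain ⟨t, ht⟩ := Matrix.mulVec_surjective_iff_isUnit.2 h c
  refine ⟨∑ j, t j • e j, ?_⟩
  rw [← ht]
  ext i
  simp [Matrix.mulVec, dotProduct, mul_comm]

theorem ker_normalize {φ : V →L[ℝ] (Fin m → ℝ)} {e : Fin m → V} (he : vdet φ e ≠ 0) (v : V) :
    normalize φ e v = 0 ↔ φ v = 0 := by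
  constructor
  · intro h; rw [sum_normalize he, h]; simp
  · intro h
    ext j
    rw [normalize_apply]
    have : vdet φ (Function.update e j v) = 0 :=
      Matrix.det_eq_zero_of_row_eq_zero j fun i => by simp [h]
    simp [this]

theorem isOpen_setOf_surjective :
    IsOpen {φ : V →L[ℝ] (Fin m → ℝ) | Function.Surjective φ} := by
  have h : {φ : V →L[ℝ] (Fin m → ℝ) | Function.Surjective φ} =
      ⋃ I : Fin m → Fin (finrank ℝ V), {φ | vdet φ (finBasis ℝ V ∘ I) ≠ 0} := by
    ext φ
    simp only [Set.mem_ofPred_eq, mem_iUnion]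
    exact ⟨fun h => exists_vdet_ne_zero _ h, fun ⟨I, hI⟩ => surjective_of_vdet_ne_zero hI⟩
  rw [h]
  refine isOpen_iUnion fun I => isOpen_ne_fun ?_ continuous_const
  unfold vdet
  refine Continuous.matrix_det (continuous_matrix fun i j => ?_)
  exact (continuous_apply j).comp (continuous_id.clm_apply continuous_const)

end
end Vdet

section Compact

variable {V : Type*} [NormedAddCommGroup V] [NormedSpace ℝ V] [FiniteDimensional ℝ V] {m p q : ℕ}

theorem isCompact_meeting {D : Set V} (hD : IsCompact D) :
    IsCompact (meeting m D : Set (AGr V m)) := by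
  set b := finBasis ℝ V
  let C : (Fin m → Fin (finrank ℝ V)) → Set (V →L[ℝ] (Fin m → ℝ)) := fun I =>
    {ψ | (∀ j, ψ (b (I j)) = Pi.single j 1) ∧ ∀ i, ‖ψ (b i)‖ ≤ 1}
  have hC : ∀ I, IsCompact (C I) := fun I => by
    have : ProperSpace (V →L[ℝ] (Fin m → ℝ)) := FiniteDimensional.proper ℝ _
    refine Metric.isCompact_of_isClosed_isBounded ?_ ?_
    · have hc : ∀ v : V, Continuous fun ψ : V →L[ℝ] (Fin m → ℝ) => ψ v :=
        fun v => continuous_id.clm_apply continuous_const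
      simp only [C, Set.ofPred_and, Set.ofPred_forall]
      exact (isClosed_iInter fun j => isClosed_eq (hc _) continuous_const).inter
        (isClosed_iInter fun i => isClosed_le (hc _).norm continuous_const)
    · refine (Metric.isBounded_closedBall (x := (0 : V →L[ℝ] (Fin m → ℝ)))
        (r := Fintype.card (Fin (finrank ℝ V)) • ‖b.equivFunL.toContinuousLinearMap‖ * 1)).subset
        fun ψ hψ => ?_
      rw [mem_closedBall_zero_iff]
      exact b.opNorm_le zero_le_one hψ.2
  have hS : ∀ I, C I ⊆ {ψ | Function.Surjective ψ} := fun I ψ hψ c => by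
    refine ⟨∑ j, c j • b (I j), ?_⟩
    rw [map_sum]
    ext i
    simp [hψ.1, Pi.single_apply]
  let C' : (Fin m → Fin (finrank ℝ V)) → Set (Surj V m) := fun I => {ψ | ψ.1 ∈ C I}
  have hC' : ∀ I, IsCompact (C' I) := fun I => by
    rw [Subtype.isCompact_iff]
    convert hC I using 1
    ext ψ
    exact ⟨fun ⟨x, hx, h⟩ => h ▸ hx, fun h => ⟨⟨ψ, hS I h⟩, h, rfl⟩⟩
  have hK : IsCompact (⋃ I, (AGr.ofSurj '' (C' I ×ˢ D) : Set (AGr V m))) :=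
    isCompact_iUnion fun I => ((hC' I).prod hD).image continuous_coinduced_rng
  refine hK.of_isClosed_subset (isClosed_meeting hD) ?_
  rintro G ⟨d, hdG, hdD⟩
  obtain ⟨⟨φ, c⟩, rfl⟩ := fiberAt_surjective G
  have hc : φ.1 d = c := by simpa using hdG
  obtain ⟨I₀, hI₀⟩ := exists_vdet_ne_zero b φ.2
  have : Nonempty (Fin m → Fin (finrank ℝ V)) := ⟨I₀⟩
  obtain ⟨I, hI⟩ := Finite.exists_max fun I => |vdet φ.1 (b ∘ I)|
  have hI0 : vdet φ.1 (b ∘ I) ≠ 0 := abs_pos.1 ((abs_pos.2 hI₀).trans_le (hI I₀))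
  have hu : ∀ j i, Function.update (b ∘ I) j (b i) = b ∘ Function.update I j i := fun j i => by
    rw [Function.comp_update]
  refine mem_iUnion.2 ⟨I, ⟨(⟨normalize φ.1 (b ∘ I), normalize_surjective hI0⟩, d), ⟨⟨?_, ?_⟩, hdD⟩, ?_⟩⟩
  · exact fun j => normalize_self hI0 j
  · intro i
    refine (pi_norm_le_iff_of_nonneg zero_le_one).2 fun j => ?_
    rw [normalize_apply, hu, Real.norm_eq_abs, abs_mul, abs_inv]
    exact (inv_mul_le_one₀ (abs_pos.2 hI0)).2 (hI _)
  · refine AGr.ext_mem fun x => ?_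
    rw [AGr.mem_ofSurj, mem_fiberAt, ← sub_eq_zero, ← map_sub, ker_normalize hI0, map_sub,
      sub_eq_zero, hc]

theorem meeting_mono {D D' : Set V} (h : D ⊆ D') : (meeting m D : Set (AGr V m)) ⊆ meeting m D' :=
  fun _ hG => hG.mono (inter_subset_inter_right _ h)

theorem IsNormalMeasure.meeting_lt_top {μ : Measure (AGr V m)} (hμ : IsNormalMeasure μ)
    {D : Set V} (hD : IsCompact D) : μ (meeting m D) < ⊤ :=
  hμ.finite_of_isCompact _ (isCompact_meeting hD)

theorem iUnion_meeting_closedBall :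
    ⋃ n : ℕ, (meeting m (Metric.closedBall (0 : V) n) : Set (AGr V m)) = univ := by
  refine eq_univ_of_forall fun G => mem_iUnion.2 ?_
  obtain ⟨x, hx⟩ := G.2.1
  obtain ⟨n, hn⟩ := exists_nat_ge ‖x‖
  exact ⟨n, x, hx, by simpa using hn⟩

theorem IsNormalMeasure.sigmaFinite {μ : Measure (AGr V m)} (hμ : IsNormalMeasure μ) :
    SigmaFinite μ :=
  have : ProperSpace V := FiniteDimensional.proper ℝ V
  ⟨⟨⟨fun n : ℕ => meeting m (Metric.closedBall (0 : V) n), fun _ => trivial,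
    fun _ => hμ.meeting_lt_top (isCompact_closedBall _ _), iUnion_meeting_closedBall⟩⟩⟩

/-- If the sets `meeting m (closedBall 0 n)` have finite measure, so do compact sets. -/
theorem lt_top_of_isCompact {μ : Measure (AGr V m)}
    (h : ∀ R : ℝ, μ (meeting m (Metric.closedBall (0 : V) R)) < ⊤) {K : Set (AGr V m)}
    (hK : IsCompact K) : μ K < ⊤ := by
  obtain ⟨t, ht⟩ := hK.elim_finite_subcover
    (fun n : ℕ => (meeting m (Metric.ball (0 : V) n) : Set (AGr V m)))
    (fun n => isOpen_meeting Metric.isOpen_ball) (fun G _ => by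
      obtain ⟨x, hx⟩ := G.2.1
      obtain ⟨n, hn⟩ := exists_nat_gt ‖x‖
      exact mem_iUnion.2 ⟨n, x, hx, by simpa using hn⟩)
  refine (measure_mono ht).trans_lt ((measure_biUnion_finset_le t _).trans_lt ?_)
  exact ENNReal.sum_lt_top.2 fun n _ =>
    (measure_mono (meeting_mono Metric.ball_subset_closedBall)).trans_lt (h n)

/-- Translation of affine subspaces by the vector `v`. -/
def AGr.translate (v : V) (G : AGr V m) : AGr V m :=
  ⟨G.1.map (AffineEquiv.constVAdd ℝ V v).toAffineMap, by
    refine ⟨?_, ?_⟩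
    · rw [AffineSubspace.coe_map]; exact G.2.1.image _
    · have : G.1.direction.map ((AffineEquiv.constVAdd ℝ V v).toAffineMap.linear) =
          G.1.direction := Submodule.map_id _
      rw [AffineSubspace.map_direction, this, G.2.2]⟩

@[simp] theorem AGr.mem_translate (v : V) (G : AGr V m) (x : V) :
    x ∈ (AGr.translate v G).1 ↔ x - v ∈ G.1 := by
  simp only [AGr.translate, AffineSubspace.mem_map]
  constructor
  · rintro ⟨y, hy, rfl⟩; simpa using hy
  · intro h; exact ⟨_, h, by simp⟩

@[simp] theorem AGr.direction_translate (v : V) (G : AGr V m) :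
    (AGr.translate v G).1.direction = G.1.direction := by
  simp only [AGr.translate, AffineSubspace.map_direction]
  exact Submodule.map_id _

theorem AGr.translate_fiberAt (v : V) (z : Surj V m × (Fin m → ℝ)) :
    AGr.translate v (fiberAt z) = fiberAt (z.1, z.2 + z.1.1 v) :=
  AGr.ext_mem fun x => by simp [sub_eq_iff_eq_add]

theorem AGr.continuous_translate (v : V) : Continuous (AGr.translate v : AGr V m → AGr V m) := by
  rw [← isOpenQuotientMap_fiberAt.continuous_comp_iff]
  simp only [Function.comp_def, AGr.translate_fiberAt]
  exact continuous_fiberAt.comp (continuous_fst.prodMk (continuous_snd.add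
    ((continuous_subtype_val.comp continuous_fst).clm_apply continuous_const)))

theorem AGr.setOf_translate (v : V) (S : Set (AGr V m)) :
    {G : AGr V m | ∃ H ∈ S, (G.1 : Set V) = (fun x => x + v) '' (H.1 : Set V)} =
      AGr.translate (-v) ⁻¹' S := by
  ext G
  simp only [Set.mem_ofPred_eq, mem_preimage]
  constructor
  · rintro ⟨H, hH, he⟩
    convert hH
    refine AGr.ext_mem fun x => ?_
    rw [AGr.mem_translate, ← SetLike.mem_coe, he]
    simp
  · intro h
    refine ⟨_, h, ?_⟩
    ext x
    simp

theorem IsNormalMeasure.measure_preimage_translate {μ : Measure (AGr V m)}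
    (hμ : IsNormalMeasure μ) (v : V) {S : Set (AGr V m)} (hS : MeasurableSet S) :
    μ (AGr.translate v ⁻¹' S) = μ S := by
  have := hμ.invariant (-v) S hS
  rwa [AGr.setOf_translate, neg_neg] at this

theorem mem_transversal_iff (z : AGr V p × AGr V q) :
    z ∈ transversal V p q ↔ z.1.1.direction ⊔ z.2.1.direction = ⊤ := by
  have h1 := Submodule.finrank_quotient_add_finrank z.1.1.direction
  have h2 := Submodule.finrank_quotient_add_finrank z.2.1.direction
  have h3 := Submodule.finrank_quotient_add_finrank (z.1.1.direction ⊓ z.2.1.direction)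
  have h4 := Submodule.finrank_sup_add_finrank_inf_eq z.1.1.direction z.2.1.direction
  rw [z.1.2.2] at h1
  rw [z.2.2.2] at h2
  constructor
  · rintro ⟨⟨x, hx⟩, h⟩
    rw [AffineSubspace.direction_inf_of_mem hx.1 hx.2] at h
    exact Submodule.eq_top_of_finrank_eq (by omega)
  · intro h
    obtain ⟨x, hx⟩ := AffineSubspace.inter_nonempty_of_nonempty_of_sup_direction_eq_top
      z.1.2.1 z.2.2.1 h
    refine ⟨⟨x, hx⟩, ?_⟩
    rw [AffineSubspace.direction_inf_of_mem hx.1 hx.2]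
    rw [h, finrank_top] at h4
    omega

/-- The linear map `(φ, ψ)`. -/
def joint (φ : V →L[ℝ] (Fin p → ℝ)) (ψ : V →L[ℝ] (Fin q → ℝ)) : V →L[ℝ] (Fin (p + q) → ℝ) :=
  ContinuousLinearMap.pi (Fin.append (fun i => (ContinuousLinearMap.proj i).comp φ)
    (fun i => (ContinuousLinearMap.proj i).comp ψ))

theorem joint_apply (φ : V →L[ℝ] (Fin p → ℝ)) (ψ : V →L[ℝ] (Fin q → ℝ)) (v : V) :
    joint φ ψ v = Fin.append (φ v) (ψ v) := by
  ext i
  refine Fin.addCases (fun i => ?_) (fun i => ?_) i <;> simp [joint]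

theorem append_eq_append_iff {α : Type*} {a a' : Fin p → α} {b b' : Fin q → α} :
    Fin.append a b = Fin.append a' b' ↔ a = a' ∧ b = b' := by
  constructor
  · intro h
    exact ⟨funext fun i => by simpa using congrFun h (Fin.castAdd q i),
      funext fun i => by simpa using congrFun h (Fin.natAdd p i)⟩
  · rintro ⟨rfl, rfl⟩; rfl

theorem surjective_joint_iff {φ : V →L[ℝ] (Fin p → ℝ)} {ψ : V →L[ℝ] (Fin q → ℝ)}
    (hφ : Function.Surjective φ) (hψ : Function.Surjective ψ) :
    Function.Surjective (joint φ ψ) ↔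
      LinearMap.ker (φ : V →ₗ[ℝ] (Fin p → ℝ)) ⊔ LinearMap.ker (ψ : V →ₗ[ℝ] (Fin q → ℝ)) = ⊤ := by
  constructor
  · intro h
    refine eq_top_iff.2 fun v _ => ?_
    obtain ⟨x, hx⟩ := h (Fin.append 0 (ψ v))
    rw [joint_apply, append_eq_append_iff] at hx
    have : v = x + (v - x) := by abel
    rw [this]
    exact Submodule.add_mem_sup (by simp [hx.1]) (by simp [hx.2])
  · intro h c
    obtain ⟨x, hx⟩ := hφ (fun i => c (Fin.castAdd q i))
    obtain ⟨y, hy⟩ := hψ (fun i => c (Fin.natAdd p i))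
    have h0 : x - y ∈ LinearMap.ker (φ : V →ₗ[ℝ] (Fin p → ℝ)) ⊔
        LinearMap.ker (ψ : V →ₗ[ℝ] (Fin q → ℝ)) := h ▸ trivial
    obtain ⟨u, hu, w, hw, huw⟩ := Submodule.mem_sup.1 h0
    have hu' : φ u = 0 := hu
    have hw' : ψ w = 0 := hw
    refine ⟨x - u, ?_⟩
    have e2 : x - u = y + w := by rw [sub_eq_iff_eq_add, add_assoc, add_comm w u, huw]; abel
    rw [joint_apply, map_sub, hu', hx, sub_zero, e2, map_add, hw', hy, add_zero]
    ext i
    refine Fin.addCases (fun i => ?_) (fun i => ?_) i <;> simp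

theorem continuous_joint : Continuous fun z : (V →L[ℝ] (Fin p → ℝ)) × (V →L[ℝ] (Fin q → ℝ)) =>
    joint z.1 z.2 := by
  let L : ((V →L[ℝ] (Fin p → ℝ)) × (V →L[ℝ] (Fin q → ℝ))) →ₗ[ℝ] (V →L[ℝ] (Fin (p + q) → ℝ)) :=
    { toFun := fun z => joint z.1 z.2
      map_add' := fun x y => by
        ext1 v; ext i
        refine Fin.addCases (fun i => ?_) (fun i => ?_) i <;> simp [joint]
      map_smul' := fun c x => by
        ext1 v; ext i
        refine Fin.addCases (fun i => ?_) (fun i => ?_) i <;> simp [joint] }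
  exact L.continuous_of_finiteDimensional

theorem isOpen_transversal : IsOpen (transversal V p q) := by
  rw [← isOpenQuotientMap_fiberAt_prod.isQuotientMap.isOpen_preimage]
  convert isOpen_setOf_surjective.preimage (continuous_joint.comp
    (f := fun z : (Surj V p × (Fin p → ℝ)) × (Surj V q × (Fin q → ℝ)) => (z.1.1.1, z.2.1.1))
    (by fun_prop)) using 1
  ext z
  simp [mem_transversal_iff, ← surjective_joint_iff z.1.1.2 z.2.1.2]

theorem fiberAt_joint {φ : Surj V p} {ψ : Surj V q} {c : Fin p → ℝ} {d : Fin q → ℝ}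
    (h : (fiberAt (φ, c), fiberAt (ψ, d)) ∈ transversal V p q)
    (hs : Function.Surjective (joint φ.1 ψ.1)) :
    inter ⟨_, h⟩ = fiberAt (⟨joint φ.1 ψ.1, hs⟩, Fin.append c d) :=
  AGr.ext_mem fun x => by
    rw [mem_fiberAt, joint_apply, append_eq_append_iff]
    change x ∈ (fiberAt (φ, c)).1 ⊓ (fiberAt (ψ, d)).1 ↔ _
    rw [AffineSubspace.mem_inf_iff]
    simp

theorem continuous_append : Continuous fun z : (Fin p → ℝ) × (Fin q → ℝ) => Fin.append z.1 z.2 := by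
  refine continuous_pi fun i => ?_
  refine Fin.addCases (fun i => ?_) (fun i => ?_) i <;> simp <;> fun_prop

theorem continuous_inter : Continuous (inter : transversal V p q → AGr V (p + q)) := by
  refine continuous_def.2 fun U hU => ?_
  rw [isOpen_induced_iff]
  refine ⟨Subtype.val '' ((inter : transversal V p q → AGr V (p + q)) ⁻¹' U), ?_,
    preimage_image_eq _ Subtype.val_injective⟩
  rw [← isOpenQuotientMap_fiberAt_prod.isQuotientMap.isOpen_preimage]
  let Q : Set ((Surj V p × (Fin p → ℝ)) × (Surj V q × (Fin q → ℝ))) :=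
    {z | Function.Surjective (joint z.1.1.1 z.2.1.1)}
  have hQ : IsOpen Q := isOpen_setOf_surjective.preimage (continuous_joint.comp
    (f := fun z : (Surj V p × (Fin p → ℝ)) × (Surj V q × (Fin q → ℝ)) => (z.1.1.1, z.2.1.1))
    (by fun_prop))
  let f : Q → AGr V (p + q) := fun z =>
    fiberAt (⟨joint z.1.1.1.1 z.1.2.1.1, z.2⟩, Fin.append z.1.1.2 z.1.2.2)
  have hf : Continuous f := continuous_fiberAt.comp
    ((Continuous.subtype_mk (continuous_joint.comp
      (f := fun z : Q => (z.1.1.1.1, z.1.2.1.1)) (by fun_prop)) _).prodMk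
      (continuous_append.comp (f := fun z : Q => (z.1.1.2, z.1.2.2)) (by fun_prop)))
  convert hQ.isOpenMap_subtype_val _ (hU.preimage hf) using 1
  ext ⟨⟨φ, c⟩, ⟨ψ, d⟩⟩
  constructor
  · rintro ⟨⟨w, hw⟩, hU', rfl⟩
    have hs : Function.Surjective (joint φ.1 ψ.1) := by
      rw [surjective_joint_iff φ.2 ψ.2]
      simpa using (mem_transversal_iff _).1 hw
    refine ⟨⟨_, hs⟩, ?_, rfl⟩
    have h : f ⟨((φ, c), (ψ, d)), hs⟩ = inter ⟨_, hw⟩ := (fiberAt_joint hw hs).symm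
    rwa [mem_preimage, h]
  · rintro ⟨⟨w, hw⟩, hU', rfl⟩
    have ht : (fiberAt (φ, c), fiberAt (ψ, d)) ∈ transversal V p q := by
      rw [mem_transversal_iff]
      simpa using (surjective_joint_iff φ.2 ψ.2).1 hw
    refine ⟨⟨_, ht⟩, ?_, rfl⟩
    have h := fiberAt_joint ht hw
    rw [mem_preimage] at hU' ⊢
    exact h ▸ hU'

/-- The transversal pairs `(G, H)` for which `G ∩ H` meets `D`. -/
def hits (p q : ℕ) (D : Set V) : Set (AGr V p × AGr V q) :=
  {z | z ∈ transversal V p q ∧ ∃ x ∈ D, x ∈ z.1.1 ∧ x ∈ z.2.1}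

theorem measurableSet_hits {D : Set V} (hD : IsCompact D) : MeasurableSet (hits p q D) := by
  refine isOpen_transversal.measurableSet.inter
    (s₂ := {z | ∃ x ∈ D, x ∈ z.1.1 ∧ x ∈ z.2.1}) (IsClosed.measurableSet ?_)
  rw [← isOpenQuotientMap_fiberAt_prod.isQuotientMap.isClosed_preimage]
  convert isClosed_exists_mem_compact hD
    (R := {z : ((Surj V p × (Fin p → ℝ)) × (Surj V q × (Fin q → ℝ))) × V |
      z.1.1.1.1 z.2 = z.1.1.2 ∧ z.1.2.1.1 z.2 = z.1.2.2})
    ((isClosed_eq ((continuous_subtype_val.comp (by fun_prop)).clm_apply (by fun_prop))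
      (by fun_prop)).inter (isClosed_eq ((continuous_subtype_val.comp (by fun_prop)).clm_apply
        (by fun_prop)) (by fun_prop))) using 1
  ext z
  simp

theorem mulMeasure_meeting (μ : Measure (AGr V p)) (ν : Measure (AGr V q)) {D : Set V}
    (hD : IsCompact D) : mulMeasure μ ν (meeting (p + q) D) = (μ.prod ν) (hits p q D) := by
  rw [mulMeasure, Measure.map_apply continuous_inter.measurable (measurableSet_meeting hD),
    (MeasurableEmbedding.subtype_coe isOpen_transversal.measurableSet).comap_apply]
  congr 1
  ext z
  constructor
  · rintro ⟨⟨w, hw⟩, ⟨x, hx, hxD⟩, rfl⟩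
    exact ⟨hw, x, hxD, hx⟩
  · rintro ⟨hw, x, hxD, hx⟩
    exact ⟨⟨z, hw⟩, ⟨x, hx, hxD⟩, rfl⟩

end Compact

section WellDefined

variable {V : Type*} [NormedAddCommGroup V] [NormedSpace ℝ V] [FiniteDimensional ℝ V] {m p q : ℕ}

theorem isCompact_parallelepiped {ι : Type*} [Fintype ι] (ξ : ι → V) :
    IsCompact (parallelepiped ξ) := by
  unfold parallelepiped
  exact isCompact_Icc.image (by fun_prop)

theorem measurableSet_mem_direction_sup (K : Submodule ℝ V) (e : V) :
    MeasurableSet {G : AGr V m | e ∈ G.1.direction ⊔ K} := by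
  have h : {G : AGr V m | e ∈ G.1.direction ⊔ K} =
      ⋃ n : ℕ, {G | ∃ k ∈ (K : Set V) ∩ Metric.closedBall 0 n, e - k ∈ G.1.direction} := by
    ext G
    simp only [Set.mem_ofPred_eq, mem_iUnion, Submodule.mem_sup]
    constructor
    · rintro ⟨y, hy, k, hk, rfl⟩
      obtain ⟨n, hn⟩ := exists_nat_ge ‖k‖
      exact ⟨n, k, ⟨hk, by simpa using hn⟩, by simpa using hy⟩
    · rintro ⟨n, k, hk, h⟩
      exact ⟨_, h, k, hk.1, by simp⟩
  rw [h]
  refine MeasurableSet.iUnion fun n => IsClosed.measurableSet ?_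
  have : ProperSpace V := FiniteDimensional.proper ℝ V
  rw [AGr.isClosed_iff]
  convert isClosed_exists_mem_compact
    ((isCompact_closedBall (0 : V) n).inter_left K.closed_of_finiteDimensional)
    (R := {z : (Surj V m × (Fin m → ℝ)) × V | z.1.1.1 (e - z.2) = 0})
    (isClosed_eq ((continuous_subtype_val.comp (by fun_prop)).clm_apply (by fun_prop))
      (by fun_prop)) using 1
  ext z
  simp

theorem IsNormalMeasure.meeting_notMem_direction_sup {μ : Measure (AGr V m)}
    (hμ : IsNormalMeasure μ) (K : Submodule ℝ V) {D : Set V} (hD : IsCompact D)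
    (hK : ∀ x ∈ D, ∀ y ∈ D, x - y ∈ K) (e : V) :
    μ {G | G ∈ meeting m D ∧ e ∉ G.1.direction ⊔ K} = 0 := by
  set N : Set (AGr V m) := {G | G ∈ meeting m D ∧ e ∉ G.1.direction ⊔ K}
  have hN : MeasurableSet N :=
    (measurableSet_meeting hD).inter (measurableSet_mem_direction_sup K e).compl
  let t : ℕ → ℝ := fun n => 1 / (n + 1)
  let T : ℕ → Set (AGr V m) := fun n => AGr.translate (-(t n • e)) ⁻¹' N
  have hT : ∀ n, μ (T n) = μ N := fun n => hμ.measure_preimage_translate _ hN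
  have hTm : ∀ n, MeasurableSet (T n) := fun n => (AGr.continuous_translate _).measurable hN
  let D' : Set V := (fun z : ℝ × V => z.2 + z.1 • e) '' (Icc 0 1 ×ˢ D)
  have hD' : IsCompact D' := (isCompact_Icc.prod hD).image (by fun_prop)
  have hsub : ⋃ n, T n ⊆ meeting m D' := by
    refine iUnion_subset fun n G hG => ?_
    obtain ⟨⟨x, hx, hxD⟩, -⟩ := hG
    have hx' : x + t n • e ∈ G.1 := by simpa using hx
    exact ⟨_, hx', (t n, x), ⟨⟨by positivity, Nat.one_div_le_one_div (Nat.zero_le n) |>.trans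
      (by simp)⟩, hxD⟩, rfl⟩
  have hdisj : Pairwise (Function.onFun Disjoint T) := by
    intro i j hij
    refine Set.disjoint_left.2 fun G hi hj => ?_
    obtain ⟨⟨x, hx, hxD⟩, he⟩ := hi
    obtain ⟨⟨y, hy, hyD⟩, -⟩ := hj
    have hx' : x + t i • e ∈ G.1 := by simpa using hx
    have hy' : y + t j • e ∈ G.1 := by simpa using hy
    refine he ?_
    rw [AGr.direction_translate]
    have htij : t j - t i ≠ 0 := by
      refine sub_ne_zero.2 fun h => hij ?_
      have h' : ((j : ℝ) + 1)⁻¹ = ((i : ℝ) + 1)⁻¹ := by simpa [t] using h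
      have : (i : ℝ) = j := by linarith [inv_injective h']
      exact_mod_cast this
    have h1 : (y + t j • e) - (x + t i • e) ∈ G.1.direction :=
      AffineSubspace.vsub_mem_direction hy' hx'
    have h2 : (t j - t i) • e = ((y + t j • e) - (x + t i • e)) + (x - y) := by
      rw [sub_smul]; abel
    have h3 : (t j - t i) • e ∈ G.1.direction ⊔ K := by
      rw [h2]; exact Submodule.add_mem_sup h1 (hK x hxD y hyD)
    exact (Submodule.smul_mem_iff _ htij).1 h3
  by_contra hne
  have h1 := measure_iUnion (μ := μ) hdisj hTm
  simp only [hT] at h1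
  rw [ENNReal.tsum_const_eq_top_of_ne_zero hne] at h1
  exact absurd h1 ((measure_mono hsub).trans_lt (hμ.meeting_lt_top hD')).ne

/-- Almost all affine subspaces that meet a compact piece of an affine subspace meet it
transversally. -/
theorem IsNormalMeasure.meeting_not_transversal {μ : Measure (AGr V m)}
    (hμ : IsNormalMeasure μ) (K : Submodule ℝ V) {D : Set V} (hD : IsCompact D)
    (hK : ∀ x ∈ D, ∀ y ∈ D, x - y ∈ K) :
    μ {G | G ∈ meeting m D ∧ G.1.direction ⊔ K ≠ ⊤} = 0 := by
  refine measure_mono_null (t := ⋃ i, {G | G ∈ meeting m D ∧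
    finBasis ℝ V i ∉ G.1.direction ⊔ K}) ?_
    (measure_iUnion_null fun i => hμ.meeting_notMem_direction_sup K hD hK _)
  rintro G ⟨hG, h⟩
  by_contra hcon
  simp only [mem_iUnion, Set.mem_ofPred_eq, not_exists, not_and, not_not] at hcon
  refine h (eq_top_iff.2 ?_)
  rw [← (finBasis ℝ V).span_eq, Submodule.span_le]
  rintro _ ⟨i, rfl⟩
  exact hcon i hG

/-- The affine map `t ↦ h + ∑ tᵢ kᵢ`. -/
def spread (h : V) (k : Fin p → V) (t : Fin p → ℝ) : V := h + ∑ i, t i • k i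

theorem continuous_spread (h : V) (k : Fin p → V) : Continuous (spread h k) := by
  unfold spread; fun_prop

/-- The affine subspaces that meet `h + span k` in one point, with unique coordinates. -/
def onePoint (h : V) (k : Fin p → V) : Set (AGr V p) :=
  {G | ∃! t : Fin p → ℝ, spread h k t ∈ G.1}

open scoped Classical in
/-- The coordinates of the intersection point. -/
def pointCoord (h : V) (k : Fin p → V) (G : AGr V p) : Fin p → ℝ :=
  if hG : ∃! t : Fin p → ℝ, spread h k t ∈ G.1 then hG.choose else 0

theorem pointCoord_spec {h : V} {k : Fin p → V} {G : AGr V p} (hG : G ∈ onePoint h k)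
    (t : Fin p → ℝ) : spread h k t ∈ G.1 ↔ t = pointCoord h k G := by
  have hG' : ∃! t : Fin p → ℝ, spread h k t ∈ G.1 := hG
  rw [pointCoord, dif_pos hG']
  exact ⟨fun ht => hG'.choose_spec.2 t ht, fun ht => ht ▸ hG'.choose_spec.1⟩

theorem fiberAt_mem_onePoint (h : V) (k : Fin p → V) (z : Surj V p × (Fin p → ℝ)) :
    fiberAt z ∈ onePoint h k ↔ vdet z.1.1 k ≠ 0 := by
  have e : ∀ t, spread h k t ∈ (fiberAt z).1 ↔
      (Matrix.of fun j => z.1.1 (k j)).transpose.mulVec t = z.2 - z.1.1 h := fun t => by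
    rw [mem_fiberAt, spread, map_add, map_sum, eq_sub_iff_add_eq, add_comm]
    have : ∑ i, z.1.1 (t i • k i) = (Matrix.of fun j => z.1.1 (k j)).transpose.mulVec t := by
      ext i; simp [Matrix.mulVec, dotProduct, mul_comm]
    rw [this]
  have e1 : fiberAt z ∈ onePoint h k ↔ ∃! t : Fin p → ℝ, spread h k t ∈ (fiberAt z).1 := Iff.rfl
  rw [e1]
  simp only [e]
  set A := (Matrix.of fun j => z.1.1 (k j)).transpose with hA
  have hdet : vdet z.1.1 k = A.det := by rw [hA, Matrix.det_transpose]; rfl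
  rw [hdet]
  constructor
  · rintro ⟨t, ht, hu⟩ h0
    obtain ⟨w, hw, hw0⟩ := Matrix.exists_mulVec_eq_zero_iff.2 h0
    have := hu (t + w) (by simp only [Matrix.mulVec_add, hw0, add_zero, ht])
    exact hw (by simpa using this)
  · intro h0
    have hb : IsUnit A := (Matrix.isUnit_iff_isUnit_det _).2 h0.isUnit
    obtain ⟨t, ht⟩ := Matrix.mulVec_surjective_iff_isUnit.2 hb (z.2 - z.1.1 h)
    exact ⟨t, ht, fun s hs => Matrix.mulVec_injective_iff_isUnit.2 hb (hs.trans ht.symm)⟩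

theorem isOpen_onePoint (h : V) (k : Fin p → V) : IsOpen (onePoint h k) := by
  rw [AGr.isOpen_iff]
  have : fiberAt ⁻¹' onePoint h k = {z | vdet z.1.1 k ≠ 0} :=
    Set.ext fun z => fiberAt_mem_onePoint h k z
  rw [this]
  refine isOpen_ne_fun ?_ continuous_const
  unfold vdet
  refine Continuous.matrix_det (continuous_matrix fun i j => ?_)
  exact (continuous_apply j).comp
    ((continuous_subtype_val.comp continuous_fst).clm_apply continuous_const)

theorem mem_onePoint_iff_direction (h : V) (k : Fin p → V) (G : AGr V p) :
    G ∈ onePoint h k ↔ G.1.direction ⊔ Submodule.span ℝ (range k) = ⊤ := by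
  obtain ⟨z, rfl⟩ := fiberAt_surjective G
  rw [fiberAt_mem_onePoint, direction_fiberAt]
  constructor
  · intro h0
    refine eq_top_iff.2 fun v _ => ?_
    have h1 := sum_normalize h0 v
    have : v = (v - ∑ j, normalize z.1.1 k v j • k j) + ∑ j, normalize z.1.1 k v j • k j := by abel
    rw [this]
    refine Submodule.add_mem_sup ?_ ?_
    · rw [LinearMap.mem_ker]
      simp only [ContinuousLinearMap.coe_coe, map_sub, map_sum, map_smul]
      rw [← h1, sub_self]
    · exact Submodule.sum_mem _ fun j _ => Submodule.smul_mem _ _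
        (Submodule.subset_span (mem_range_self j))
  · intro htop h0
    have hs : ∀ c : Fin p → ℝ, ∃ t : Fin p → ℝ,
        (Matrix.of fun j => z.1.1 (k j)).transpose.mulVec t = c := fun c => by
      obtain ⟨v, rfl⟩ := z.1.2 c
      obtain ⟨u, hu, w, hw, rfl⟩ := Submodule.mem_sup.1 (htop ▸ Submodule.mem_top (x := v))
      obtain ⟨t, rfl⟩ := (Submodule.mem_span_range_iff_exists_fun ℝ).1 hw
      refine ⟨t, ?_⟩
      have hu' : z.1.1 u = 0 := hu
      rw [map_add, hu', zero_add, map_sum]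
      ext i; simp [Matrix.mulVec, dotProduct, mul_comm]
    have := (Matrix.isUnit_iff_isUnit_det _).1 (Matrix.mulVec_surjective_iff_isUnit.1 hs)
    rw [Matrix.det_transpose] at this
    exact this.ne_zero h0

theorem measurable_pointCoord (h : V) (k : Fin p → V) : Measurable (pointCoord h k) := by
  refine measurable_of_isClosed fun C hC => ?_
  have hO := (isOpen_onePoint h k).measurableSet
  have hM : MeasurableSet (⋃ n : ℕ, (meeting p (spread h k '' (C ∩ Metric.closedBall 0 n)) :
      Set (AGr V p))) := MeasurableSet.iUnion fun n => measurableSet_meeting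
    (((isCompact_closedBall _ _).inter_left hC).image (continuous_spread h k))
  have key : pointCoord h k ⁻¹' C =
      (onePoint h k ∩ ⋃ n : ℕ, meeting p (spread h k '' (C ∩ Metric.closedBall 0 n))) ∪
      ((onePoint h k)ᶜ ∩ {_G | (0 : Fin p → ℝ) ∈ C}) := by
    ext G
    by_cases hG : G ∈ onePoint h k
    · simp only [mem_preimage, mem_union, mem_inter_iff, hG, true_and, mem_compl_iff,
        not_true_eq_false, false_and, or_false, mem_iUnion]
      constructor
      · intro hc
        obtain ⟨n, hn⟩ := exists_nat_ge ‖pointCoord h k G‖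
        exact ⟨n, _, (pointCoord_spec hG _).2 rfl, _, ⟨hc, by simpa using hn⟩, rfl⟩
      · rintro ⟨n, _, hx, t, ⟨ht, -⟩, rfl⟩
        rwa [← (pointCoord_spec hG t).1 hx]
    · have h0 : pointCoord h k G = 0 := dif_neg hG
      simp [hG, h0]
  rw [key]
  exact (hO.inter hM).union (hO.compl.inter (MeasurableSet.const _))

theorem meeting_spread_image_iff {h : V} {k : Fin p → V} {G : AGr V p} (hG : G ∈ onePoint h k)
    (C : Set (Fin p → ℝ)) : G ∈ meeting p (spread h k '' C) ↔ pointCoord h k G ∈ C := by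
  constructor
  · rintro ⟨_, hx, t, ht, rfl⟩
    rwa [← (pointCoord_spec hG t).1 hx]
  · intro hC
    exact ⟨_, (pointCoord_spec hG _).2 rfl, _, hC, rfl⟩

theorem spread_Icc (h : V) (k : Fin p → V) :
    spread h k '' Icc 0 1 = (fun x => h + x) '' parallelepiped k := by
  rw [parallelepiped, image_image]; rfl

theorem translate_mem_onePoint {h : V} {k : Fin p → V} {v : V} {G : AGr V p} :
    AGr.translate v G ∈ onePoint h k ↔ G ∈ onePoint h k := by
  rw [mem_onePoint_iff_direction, mem_onePoint_iff_direction, AGr.direction_translate]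

theorem IsNormalMeasure.map_pointCoord {μ : Measure (AGr V p)} (hμ : IsNormalMeasure μ)
    (h : V) (k : Fin p → V) :
    (μ.restrict (onePoint h k)).map (pointCoord h k) =
      μ (meeting p (parallelepiped k)) • volume := by
  set β := (μ.restrict (onePoint h k)).map (pointCoord h k) with hβ
  have hm := measurable_pointCoord h k
  have hO := (isOpen_onePoint h k).measurableSet
  have happ : ∀ C, MeasurableSet C → β C = μ (pointCoord h k ⁻¹' C ∩ onePoint h k) := fun C hC => by
    rw [hβ, Measure.map_apply hm hC, Measure.restrict_apply (hm hC)]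
  have hfin : ∀ C : Set (Fin p → ℝ), IsCompact C → β C < ⊤ := fun C hC => by
    rw [happ C hC.measurableSet]
    refine (measure_mono fun G hG => ?_).trans_lt
      (hμ.meeting_lt_top (hC.image (continuous_spread h k)))
    exact (meeting_spread_image_iff hG.2 C).2 hG.1
  have : IsFiniteMeasureOnCompacts β := ⟨fun {C} hC => hfin C hC⟩
  have : β.IsAddLeftInvariant := ⟨fun s => by
    refine Measure.ext fun C hC => ?_
    rw [Measure.map_apply (measurable_const_add s) hC, happ _ ((measurable_const_add s) hC),
      happ C hC]
    rw [← hμ.measure_preimage_translate (∑ i, s i • k i) ((hm hC).inter hO)]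
    congr 1
    ext G
    simp only [mem_inter_iff, mem_preimage]
    rw [translate_mem_onePoint]
    refine and_congr_left fun hG => ?_
    have hG' : AGr.translate (∑ i, s i • k i) G ∈ onePoint h k := translate_mem_onePoint.2 hG
    have : s + pointCoord h k G = pointCoord h k (AGr.translate (∑ i, s i • k i) G) := by
      rw [← pointCoord_spec hG', AGr.mem_translate]
      have : spread h k (s + pointCoord h k G) - ∑ i, s i • k i =
          spread h k (pointCoord h k G) := by
        simp only [spread, Pi.add_apply, add_smul, Finset.sum_add_distrib]; abel
      rw [this, pointCoord_spec hG]
    rw [this]⟩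
  have hscal := Measure.isAddLeftInvariant_eq_smul β (volume : Measure (Fin p → ℝ))
  have h1 : β (Icc 0 1) = μ (meeting p (parallelepiped k)) := by
    rw [happ _ measurableSet_Icc]
    have e1 : pointCoord h k ⁻¹' Icc 0 1 ∩ onePoint h k =
        meeting p ((fun x => h + x) '' parallelepiped k) ∩ onePoint h k := by
      ext G
      simp only [mem_inter_iff, mem_preimage]
      refine and_congr_left fun hG => ?_
      rw [← spread_Icc, meeting_spread_image_iff hG]
    have hc : IsCompact ((fun x => h + x) '' parallelepiped k) :=
      (isCompact_parallelepiped k).image (by fun_prop)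
    have e2 : μ (meeting p ((fun x => h + x) '' parallelepiped k) ∩ (onePoint h k)ᶜ) = 0 := by
      refine measure_mono_null ?_ (hμ.meeting_not_transversal (Submodule.span ℝ (range k)) hc ?_)
      · rintro G ⟨hG, hG'⟩
        exact ⟨hG, fun h' => hG' ((mem_onePoint_iff_direction h k G).2 h')⟩
      · rw [← spread_Icc]
        rintro _ ⟨s, -, rfl⟩ _ ⟨t, -, rfl⟩
        have : spread h k s - spread h k t = ∑ i, (s i - t i) • k i := by
          simp only [spread, sub_smul, Finset.sum_sub_distrib]; abel
        rw [this]
        exact Submodule.sum_mem _ fun j _ => Submodule.smul_mem _ _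
          (Submodule.subset_span (mem_range_self j))
    have e3 := measure_inter_add_sdiff (μ := μ)
      (meeting p ((fun x => h + x) '' parallelepiped k)) hO
    rw [sdiff_eq, e2, add_zero] at e3
    rw [e1, e3, ← hμ.measure_preimage_translate h (measurableSet_meeting hc)]
    congr 1
    ext G
    simp only [mem_preimage, meeting, Set.Nonempty, mem_inter_iff, SetLike.mem_coe,
      Set.mem_ofPred_eq, AGr.mem_translate]
    constructor
    · rintro ⟨_, hx, y, hy, rfl⟩; exact ⟨y, by simpa using hx, hy⟩
    · rintro ⟨y, hx, hy⟩; exact ⟨h + y, by simpa using hx, y, hy, rfl⟩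
  rw [hscal]
  have h2 : β (Icc 0 1) = (β.addHaarScalarFactor volume : ENNReal) := by
    conv_lhs => rw [hscal]
    rw [Measure.smul_apply, Real.volume_Icc_pi]
    simp [ENNReal.smul_def]
  rw [← h1, h2]
  rfl

theorem exists_span_range_eq (K : Submodule ℝ V) (hK : finrank ℝ K ≤ p) :
    ∃ k : Fin p → V, Submodule.span ℝ (range k) = K := by
  let b := finBasis ℝ K
  refine ⟨fun i => if h : (i : ℕ) < finrank ℝ K then b ⟨i, h⟩ else 0, ?_⟩
  apply le_antisymm
  · rw [Submodule.span_le]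
    rintro _ ⟨i, rfl⟩
    dsimp only
    split_ifs
    · exact (b _).2
    · exact K.zero_mem
  · have h1 : Submodule.span ℝ (range fun i => (b i : V)) = K := by
      have := congrArg (Submodule.map K.subtype) b.span_eq
      rw [Submodule.map_span, Submodule.map_top, Submodule.range_subtype, ← range_comp] at this
      exact this
    conv_lhs => rw [← h1]
    refine Submodule.span_mono ?_
    rintro _ ⟨i, rfl⟩
    exact ⟨⟨i, i.2.trans_le hK⟩, by simp⟩

/-- The measure of the `G` that meet `H ∩ D` transversally depends on the normal measure only
through the density that it defines. -/
theorem measure_hits_slice_congr {ι : Type*} [Fintype ι] (hι : Fintype.card ι = p + q)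
    {μ μ' : Measure (AGr V p)} (hμ : IsNormalMeasure μ) (hμ' : IsNormalMeasure μ')
    (heq : ∀ k : Fin p → V, μ (meeting p (parallelepiped k)) = μ' (meeting p (parallelepiped k)))
    (ξ : ι → V) (H : AGr V q) (hH : H.1.direction ⊔ Submodule.span ℝ (range ξ) = ⊤) :
    μ {G | (G, H) ∈ hits p q (parallelepiped ξ)} =
      μ' {G | (G, H) ∈ hits p q (parallelepiped ξ)} := by
  set W := Submodule.span ℝ (range ξ)
  set D := parallelepiped ξ
  by_cases hne : ∃ h ∈ D, h ∈ H.1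
  swap
  · have : {G | (G, H) ∈ hits p q D} = ∅ := by
      refine eq_empty_of_forall_notMem fun G hG => ?_
      obtain ⟨-, x, hx, -, hx'⟩ := hG
      exact hne ⟨x, hx, hx'⟩
    rw [this, measure_empty, measure_empty]
  obtain ⟨h, hhD, hhH⟩ := hne
  have hDW : ∀ x ∈ D, x ∈ W := by
    intro x hx
    obtain ⟨t, -, rfl⟩ := (mem_parallelepiped_iff ξ x).1 hx
    exact Submodule.sum_mem _ fun j _ => Submodule.smul_mem _ _
      (Submodule.subset_span (mem_range_self j))
  set K := H.1.direction ⊓ W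
  have hKdim : finrank ℝ K ≤ p := by
    have h1 := Submodule.finrank_sup_add_finrank_inf_eq H.1.direction W
    have h2 := Submodule.finrank_quotient_add_finrank H.1.direction
    have h3 : finrank ℝ W ≤ Fintype.card ι := finrank_range_le_card ξ
    rw [H.2.2] at h2
    rw [hH, finrank_top] at h1
    change finrank ℝ ↥(H.1.direction ⊓ W) ≤ p
    omega
  obtain ⟨k, hk⟩ := exists_span_range_eq K hKdim
  have hkK : ∀ i, k i ∈ K := fun i => hk ▸ Submodule.subset_span (mem_range_self i)
  have hspreadH : ∀ t, spread h k t ∈ H.1 := fun t => by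
    rw [spread, add_comm]
    exact AffineSubspace.vadd_mem_of_mem_direction
      (Submodule.sum_mem _ fun j _ => Submodule.smul_mem _ _ (hkK j).1) hhH
  have hspread : ∀ x ∈ D, x ∈ H.1 → ∃ t, x = spread h k t := fun x hx hxH => by
    have hxk : x - h ∈ Submodule.span ℝ (range k) := by
      rw [hk]
      exact ⟨AffineSubspace.vsub_mem_direction hxH hhH, W.sub_mem (hDW x hx) (hDW h hhD)⟩
    obtain ⟨t, ht⟩ := (Submodule.mem_span_range_iff_exists_fun ℝ).1 hxk
    exact ⟨t, by rw [spread, ht]; abel⟩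
  set C : Set (Fin p → ℝ) := spread h k ⁻¹' D
  have hDc : IsCompact D := isCompact_parallelepiped ξ
  have hC : MeasurableSet C := (hDc.isClosed.preimage (continuous_spread h k)).measurableSet
  have htrans : ∀ G ∈ onePoint h k, (G, H) ∈ transversal V p q := fun G hG => by
    rw [mem_transversal_iff]
    rw [mem_onePoint_iff_direction, hk] at hG
    exact eq_top_iff.2 (hG ▸ sup_le_sup_left inf_le_left _)
  have hHcl : IsClosed (H.1 : Set V) := H.1.closed_of_finiteDimensional
  have key : ∀ ν : Measure (AGr V p), IsNormalMeasure ν →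
      ν {G | (G, H) ∈ hits p q D} = ν (meeting p (parallelepiped k)) * volume C := by
    intro ν hν
    have e0 := hν.map_pointCoord h k
    have e1 := congrArg (fun β : Measure (Fin p → ℝ) => β C) e0
    rw [Measure.map_apply (measurable_pointCoord h k) hC,
      Measure.restrict_apply ((measurable_pointCoord h k) hC), Measure.smul_apply,
      smul_eq_mul] at e1
    rw [← e1]
    have hnull : ν {G | G ∈ meeting p (D ∩ H.1) ∧ G.1.direction ⊔ K ≠ ⊤} = 0 := by
      refine hν.meeting_not_transversal K (hDc.inter_right hHcl) fun x hx y hy => ?_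
      exact ⟨AffineSubspace.vsub_mem_direction hx.2 hy.2, W.sub_mem (hDW x hx.1) (hDW y hy.1)⟩
    apply le_antisymm
    · rw [← add_zero (ν (_ ∩ _)), ← hnull]
      refine (measure_mono ?_).trans (measure_union_le _ _)
      rintro G ⟨htr, x, hxD, hxG, hxH⟩
      by_cases hG : G.1.direction ⊔ K = ⊤
      · left
        have hGo : G ∈ onePoint h k := by rw [mem_onePoint_iff_direction, hk, hG]
        obtain ⟨t, rfl⟩ := hspread x hxD hxH
        refine ⟨?_, hGo⟩
        rw [mem_preimage, ← (pointCoord_spec hGo t).1 hxG]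
        exact hxD
      · exact Or.inr ⟨⟨x, hxG, hxD, hxH⟩, hG⟩
    · refine measure_mono ?_
      rintro G ⟨hGC, hGo⟩
      exact ⟨htrans G hGo, _, hGC, (pointCoord_spec hGo _).2 rfl, hspreadH _⟩
  rw [key μ hμ, key μ' hμ', heq]

theorem prod_hits_congr_left {ι : Type*} [Fintype ι] (hι : Fintype.card ι = p + q)
    {μ μ' : Measure (AGr V p)} (hμ : IsNormalMeasure μ) (hμ' : IsNormalMeasure μ')
    {ν : Measure (AGr V q)} (hν : IsNormalMeasure ν)
    (heq : ∀ k : Fin p → V, μ (meeting p (parallelepiped k)) = μ' (meeting p (parallelepiped k)))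
    (ξ : ι → V) :
    (μ.prod ν) (hits p q (parallelepiped ξ)) = (μ'.prod ν) (hits p q (parallelepiped ξ)) := by
  have := hμ.sigmaFinite
  have := hμ'.sigmaFinite
  have := hν.sigmaFinite
  have hD := isCompact_parallelepiped ξ
  rw [Measure.prod_apply_symm (measurableSet_hits hD), Measure.prod_apply_symm
    (measurableSet_hits hD)]
  refine lintegral_congr_ae ?_
  have hnull := hν.meeting_not_transversal (Submodule.span ℝ (range ξ)) hD fun x hx y hy => by
    obtain ⟨s, -, rfl⟩ := (mem_parallelepiped_iff ξ x).1 hx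
    obtain ⟨t, -, rfl⟩ := (mem_parallelepiped_iff ξ y).1 hy
    refine Submodule.sub_mem _ ?_ ?_ <;>
    exact Submodule.sum_mem _ fun j _ => Submodule.smul_mem _ _
      (Submodule.subset_span (mem_range_self j))
  filter_upwards [measure_eq_zero_iff_ae_notMem.1 hnull] with H hH
  by_cases htop : H.1.direction ⊔ Submodule.span ℝ (range ξ) = ⊤
  · exact measure_hits_slice_congr hι hμ hμ' heq ξ H htop
  · have : (fun G => (G, H)) ⁻¹' hits p q (parallelepiped ξ) = ∅ := by
      refine eq_empty_of_forall_notMem fun G hG => hH ⟨?_, htop⟩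
      obtain ⟨-, x, hx, -, hx'⟩ := hG
      exact ⟨x, hx', hx⟩
    rw [this, measure_empty, measure_empty]

theorem prod_hits_swap (μ : Measure (AGr V p)) (ν : Measure (AGr V q)) [SFinite μ] [SFinite ν]
    {D : Set V} (hD : IsCompact D) :
    (μ.prod ν) (hits p q D) = (ν.prod μ) (hits q p D) := by
  rw [← Measure.prod_swap, Measure.map_apply measurable_swap (measurableSet_hits hD)]
  congr 1
  ext z
  simp only [hits, mem_preimage, Set.mem_ofPred_eq, mem_transversal_iff, Prod.fst_swap,
    Prod.snd_swap]
  rw [sup_comm]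
  exact and_congr_right fun _ => exists_congr fun x => and_congr_right fun _ => and_comm

theorem prod_hits_congr_right {ι : Type*} [Fintype ι] (hι : Fintype.card ι = p + q)
    {μ : Measure (AGr V p)} (hμ : IsNormalMeasure μ)
    {ν ν' : Measure (AGr V q)} (hν : IsNormalMeasure ν) (hν' : IsNormalMeasure ν')
    (heq : ∀ k : Fin q → V, ν (meeting q (parallelepiped k)) = ν' (meeting q (parallelepiped k)))
    (ξ : ι → V) :
    (μ.prod ν) (hits p q (parallelepiped ξ)) = (μ.prod ν') (hits p q (parallelepiped ξ)) := by
  have := hμ.sigmaFinite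
  have := hν.sigmaFinite
  have := hν'.sigmaFinite
  have hD := isCompact_parallelepiped ξ
  rw [prod_hits_swap μ ν hD, prod_hits_swap μ ν' hD]
  exact prod_hits_congr_left (by omega) hν hν' hμ heq ξ

theorem IsNormalMeasure.add {μ ν : Measure (AGr V m)} (hμ : IsNormalMeasure μ)
    (hν : IsNormalMeasure ν) : IsNormalMeasure (μ + ν) where
  invariant v S hS := by
    rw [Measure.add_apply, Measure.add_apply, hμ.invariant v S hS, hν.invariant v S hS]
  finite_of_isCompact K hK := by
    rw [Measure.add_apply]
    exact ENNReal.add_lt_top.2 ⟨hμ.finite_of_isCompact K hK, hν.finite_of_isCompact K hK⟩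

theorem prod_hits_lt_top {μ : Measure (AGr V p)} (hμ : IsNormalMeasure μ)
    {ν : Measure (AGr V q)} (hν : IsNormalMeasure ν) {D : Set V} (hD : IsCompact D) :
    (μ.prod ν) (hits p q D) < ⊤ := by
  have := hν.sigmaFinite
  refine (measure_mono (t := meeting p D ×ˢ meeting q D) ?_).trans_lt ?_
  · rintro ⟨G, H⟩ ⟨-, x, hx, hG, hH⟩
    exact ⟨⟨x, hG, hx⟩, ⟨x, hH, hx⟩⟩
  · rw [Measure.prod_prod]
    exact ENNReal.mul_lt_top (hμ.meeting_lt_top hD) (hν.meeting_lt_top hD)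

/-- The value of `χ(μ · ν)` in terms of the pairing of positive measures. -/
theorem chi_mul (μ : SignedBorel (AGr V p)) (ν : SignedBorel (AGr V q)) (hμ : μ.IsNormal)
    (hν : ν.IsNormal) (ξ : Fin (p + q) → V) :
    chi (μ.mul ν) ξ =
      (μ.pos.prod ν.pos).real (hits p q (parallelepiped ξ)) +
      (μ.neg.prod ν.neg).real (hits p q (parallelepiped ξ)) -
      ((μ.pos.prod ν.neg).real (hits p q (parallelepiped ξ)) +
      (μ.neg.prod ν.pos).real (hits p q (parallelepiped ξ))) := by
  have hD := isCompact_parallelepiped ξ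
  simp only [chi, SignedBorel.mul, measureReal_def, Measure.add_apply, mulMeasure_meeting _ _ hD]
  rw [ENNReal.toReal_add (prod_hits_lt_top hμ.1 hν.1 hD).ne (prod_hits_lt_top hμ.2 hν.2 hD).ne,
    ENNReal.toReal_add (prod_hits_lt_top hμ.1 hν.2 hD).ne (prod_hits_lt_top hμ.2 hν.1 hD).ne]

theorem chi_mul_congr {μ μ' : SignedBorel (AGr V p)} {ν ν' : SignedBorel (AGr V q)}
    (hμ : μ.IsNormal) (hμ' : μ'.IsNormal) (hν : ν.IsNormal) (hν' : ν'.IsNormal)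
    (h : chi μ = chi μ') (h' : chi ν = chi ν') : chi (μ.mul ν) = chi (μ'.mul ν') := by
  have cross : ∀ {m : ℕ} {a b : SignedBorel (AGr V m)}, a.IsNormal → b.IsNormal →
      chi a = chi b → ∀ k : Fin m → V,
      (a.pos + b.neg) (meeting m (parallelepiped k)) =
        (b.pos + a.neg) (meeting m (parallelepiped k)) := by
    intro m a b ha hb hab k
    have hD := isCompact_parallelepiped k
    have h1 := congrFun hab k
    simp only [chi, measureReal_def] at h1
    rw [Measure.add_apply, Measure.add_apply]
    rw [← ENNReal.toReal_eq_toReal_iff' (ENNReal.add_lt_top.2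
      ⟨ha.1.meeting_lt_top hD, hb.2.meeting_lt_top hD⟩).ne (ENNReal.add_lt_top.2
      ⟨hb.1.meeting_lt_top hD, ha.2.meeting_lt_top hD⟩).ne,
      ENNReal.toReal_add (ha.1.meeting_lt_top hD).ne (hb.2.meeting_lt_top hD).ne,
      ENNReal.toReal_add (hb.1.meeting_lt_top hD).ne (ha.2.meeting_lt_top hD).ne]
    linarith
  have real_add : ∀ {p q : ℕ} {a b : Measure (AGr V p)} {c : Measure (AGr V q)}
      (_ : IsNormalMeasure a) (_ : IsNormalMeasure b) (_ : IsNormalMeasure c) {D : Set V}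
      (_ : IsCompact D), ((a + b).prod c).real (hits p q D) =
        (a.prod c).real (hits p q D) + (b.prod c).real (hits p q D) := by
    intro p q a b c ha hb hc D hD
    have := ha.sigmaFinite
    have := hb.sigmaFinite
    have := hc.sigmaFinite
    rw [Measure.add_prod, measureReal_def, Measure.add_apply, ENNReal.toReal_add
      (prod_hits_lt_top ha hc hD).ne (prod_hits_lt_top hb hc hD).ne]
    rfl
  have real_add' : ∀ {p q : ℕ} {a b : Measure (AGr V q)} {c : Measure (AGr V p)}
      (_ : IsNormalMeasure a) (_ : IsNormalMeasure b) (_ : IsNormalMeasure c) {D : Set V}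
      (_ : IsCompact D), (c.prod (a + b)).real (hits p q D) =
        (c.prod a).real (hits p q D) + (c.prod b).real (hits p q D) := by
    intro p q a b c ha hb hc D hD
    have := ha.sigmaFinite
    have := hb.sigmaFinite
    have := hc.sigmaFinite
    rw [Measure.prod_add, measureReal_def, Measure.add_apply, ENNReal.toReal_add
      (prod_hits_lt_top hc ha hD).ne (prod_hits_lt_top hc hb hD).ne]
    rfl
  ext ξ
  have hD := isCompact_parallelepiped ξ
  have hcard : Fintype.card (Fin (p + q)) = p + q := Fintype.card_fin _
  rw [chi_mul μ ν hμ hν, chi_mul μ' ν' hμ' hν']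
  have a1 := congrArg ENNReal.toReal (prod_hits_congr_left hcard (hμ.1.add hμ'.2) (hμ'.1.add hμ.2)
    hν.1 (cross hμ hμ' h) ξ)
  have a2 := congrArg ENNReal.toReal (prod_hits_congr_left hcard (hμ.1.add hμ'.2) (hμ'.1.add hμ.2)
    hν.2 (cross hμ hμ' h) ξ)
  have a3 := congrArg ENNReal.toReal (prod_hits_congr_right hcard hμ'.1 (hν.1.add hν'.2)
    (hν'.1.add hν.2) (cross hν hν' h') ξ)
  have a4 := congrArg ENNReal.toReal (prod_hits_congr_right hcard hμ'.2 (hν.1.add hν'.2)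
    (hν'.1.add hν.2) (cross hν hν' h') ξ)
  simp only [← measureReal_def] at a1 a2 a3 a4
  rw [real_add hμ.1 hμ'.2 hν.1 hD, real_add hμ'.1 hμ.2 hν.1 hD] at a1
  rw [real_add hμ.1 hμ'.2 hν.2 hD, real_add hμ'.1 hμ.2 hν.2 hD] at a2
  rw [real_add' hν.1 hν'.2 hμ'.1 hD, real_add' hν'.1 hν.2 hμ'.1 hD] at a3
  rw [real_add' hν.1 hν'.2 hμ'.2 hD, real_add' hν'.1 hν.2 hμ'.2 hD] at a4
  linarith

theorem mulAt_eq_chi {δ₁ : (Fin p → V) → ℝ} {δ₂ : (Fin q → V) → ℝ}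
    {μ : SignedBorel (AGr V p)} {ν : SignedBorel (AGr V q)} (hμ : μ.IsNormal) (hν : ν.IsNormal)
    (h₁ : chi μ = δ₁) (h₂ : chi ν = δ₂) : mulAt δ₁ δ₂ = chi (μ.mul ν) := by
  have h : IsNormalAt δ₁ ∧ IsNormalAt δ₂ := ⟨⟨μ, hμ, h₁⟩, ⟨ν, hν, h₂⟩⟩
  rw [mulAt, dif_pos h]
  exact chi_mul_congr h.1.choose_spec.1 hμ h.2.choose_spec.1 hν
    (h.1.choose_spec.2.trans h₁.symm) (h.2.choose_spec.2.trans h₂.symm)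

end WellDefined

section Crofton

variable {V : Type*} [NormedAddCommGroup V] [NormedSpace ℝ V] [FiniteDimensional ℝ V] {m p q : ℕ}

theorem volume_parallelepiped_pi (M : Fin m → Fin m → ℝ) :
    volume (parallelepiped M) = ENNReal.ofReal |Matrix.det (Matrix.of M)| := by
  have h : parallelepiped M = Matrix.toLin' (Matrix.of M).transpose '' Icc 0 1 := by
    rw [parallelepiped]
    refine image_congr fun t _ => ?_
    ext i
    simp [Matrix.mulVec, dotProduct, mul_comm]
  rw [h, Measure.addHaar_image_linearMap, LinearMap.det_toLin', Matrix.det_transpose,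
    Real.volume_Icc_pi]
  simp

theorem volume_image_parallelepiped (φ : V →L[ℝ] (Fin m → ℝ)) (ξ : Fin m → V) :
    volume (φ '' parallelepiped ξ) = ENNReal.ofReal |vdet φ ξ| := by
  have := image_parallelepiped (φ : V →ₗ[ℝ] (Fin m → ℝ)) ξ
  rw [ContinuousLinearMap.coe_coe] at this
  rw [this]
  exact volume_parallelepiped_pi _

theorem continuous_vdet (ξ : Fin m → V) :
    Continuous fun φ : V →L[ℝ] (Fin m → ℝ) => vdet φ ξ := by
  unfold vdet
  refine Continuous.matrix_det (continuous_matrix fun i j => ?_)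
  exact (continuous_apply j).comp (continuous_id.clm_apply continuous_const)

/-- The measure on `AGr^m(V)` that a measure on the space of linear maps `V → ℝ^m` defines. -/
def crofton (ρ : Measure (V →L[ℝ] (Fin m → ℝ))) : Measure (AGr V m) :=
  ((ρ.comap Subtype.val : Measure (Surj V m)).prod volume).map fiberAt

theorem measurableSet_surjective :
    MeasurableSet {φ : V →L[ℝ] (Fin m → ℝ) | Function.Surjective φ} :=
  isOpen_setOf_surjective.measurableSet

theorem lintegral_surj (ρ : Measure (V →L[ℝ] (Fin m → ℝ))) (f : (V →L[ℝ] (Fin m → ℝ)) → ENNReal)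
    (hf : ∀ φ : V →L[ℝ] (Fin m → ℝ), ¬ Function.Surjective φ → f φ = 0) :
    ∫⁻ φ : Surj V m, f φ.1 ∂(ρ.comap Subtype.val) = ∫⁻ φ, f φ ∂ρ := by
  have h := lintegral_subtype_comap (μ := ρ) measurableSet_surjective f
  refine h.trans ?_
  rw [← lintegral_indicator measurableSet_surjective]
  refine lintegral_congr fun φ => ?_
  by_cases hφ : φ ∈ {φ : V →L[ℝ] (Fin m → ℝ) | Function.Surjective φ}
  · rw [indicator_of_mem hφ]
  · rw [indicator_of_notMem hφ, hf φ hφ]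

theorem crofton_apply (ρ : Measure (V →L[ℝ] (Fin m → ℝ))) {S : Set (AGr V m)}
    (hS : MeasurableSet S) :
    crofton ρ S = ∫⁻ φ : Surj V m, volume {c | fiberAt (φ, c) ∈ S} ∂(ρ.comap Subtype.val) := by
  rw [crofton, Measure.map_apply continuous_fiberAt.measurable hS,
    Measure.prod_apply (continuous_fiberAt.measurable hS)]
  rfl

theorem crofton_meeting (ρ : Measure (V →L[ℝ] (Fin m → ℝ))) {D : Set V} (hD : IsCompact D) :
    crofton ρ (meeting m D) =
      ∫⁻ φ : Surj V m, volume (φ.1 '' D) ∂(ρ.comap Subtype.val) := by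
  rw [crofton_apply ρ (measurableSet_meeting hD)]
  refine lintegral_congr fun φ => ?_
  congr 1
  ext c
  simp [meeting, Set.Nonempty, and_comm]

theorem crofton_meeting_parallelepiped (ρ : Measure (V →L[ℝ] (Fin m → ℝ))) (ξ : Fin m → V) :
    crofton ρ (meeting m (parallelepiped ξ)) = ∫⁻ φ, ENNReal.ofReal |vdet φ ξ| ∂ρ := by
  rw [crofton_meeting ρ (isCompact_parallelepiped ξ)]
  simp only [volume_image_parallelepiped]
  refine lintegral_surj ρ (fun φ => ENNReal.ofReal |vdet φ ξ|) fun φ hφ => ?_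
  by_contra h
  refine hφ (surjective_of_vdet_ne_zero (e := ξ) fun h0 => h ?_)
  simp [h0]

theorem isNormalMeasure_crofton (ρ : Measure (V →L[ℝ] (Fin m → ℝ))) [IsFiniteMeasure ρ] {C : ℝ}
    (hρ : ∀ᵐ φ ∂ρ, ‖φ‖ ≤ C) : IsNormalMeasure (crofton ρ) where
  invariant v S hS := by
    rw [AGr.setOf_translate, crofton_apply ρ ((AGr.continuous_translate _).measurable hS),
      crofton_apply ρ hS]
    refine lintegral_congr fun φ => ?_
    simp only [mem_preimage, AGr.translate_fiberAt]
    exact measure_preimage_add_right volume (φ.1 (-v)) {c | fiberAt (φ, c) ∈ S}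
  finite_of_isCompact K hK := by
    have : ProperSpace V := FiniteDimensional.proper ℝ V
    refine lt_top_of_isCompact (fun R => ?_) hK
    rw [crofton_meeting ρ (isCompact_closedBall _ _)]
    have h := lintegral_subtype_comap (μ := ρ) measurableSet_surjective
      fun φ : V →L[ℝ] (Fin m → ℝ) => volume (φ '' Metric.closedBall 0 R)
    refine (h.trans_le ((setLIntegral_le_lintegral _ _).trans
      (lintegral_mono_ae (g := fun _ => ENNReal.ofReal ((2 * (|C| * |R|)) ^ m)) ?_))).trans_lt ?_
    · filter_upwards [hρ] with φ hφ
      refine (measure_mono (t := Metric.closedBall (0 : Fin m → ℝ) (|C| * |R|)) ?_).trans_eq ?_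
      · rintro _ ⟨x, hx, rfl⟩
        rw [mem_closedBall_zero_iff] at hx ⊢
        refine (φ.le_opNorm x).trans (mul_le_mul (hφ.trans (le_abs_self C))
          (hx.trans (le_abs_self R)) (norm_nonneg _) (abs_nonneg _))
      · rw [Real.volume_pi_closedBall _ (by positivity)]
        simp
    · rw [lintegral_const]
      exact ENNReal.mul_lt_top ENNReal.ofReal_lt_top (measure_lt_top _ _)

theorem measurePreserving_append : MeasurePreserving
    (fun z : (Fin p → ℝ) × (Fin q → ℝ) => Fin.append z.1 z.2) := by
  have h1 := volume_measurePreserving_sumPiEquivProdPi_symm (fun _ : Fin p ⊕ Fin q => ℝ)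
  have h2 := volume_measurePreserving_piCongrLeft (fun _ : Fin (p + q) => ℝ) finSumFinEquiv
  suffices h : (fun z : (Fin p → ℝ) × (Fin q → ℝ) => Fin.append z.1 z.2) =
      MeasurableEquiv.piCongrLeft (fun _ => ℝ) finSumFinEquiv ∘
        (MeasurableEquiv.sumPiEquivProdPi fun _ => ℝ).symm by
    rw [h]; exact h2.comp h1
  funext z i
  refine Fin.addCases (fun i => ?_) (fun i => ?_) i
  · have : Fin.castAdd q i = finSumFinEquiv (Sum.inl i) := by simp
    simp only [Fin.append_left, Function.comp_apply]
    rw [this, MeasurableEquiv.piCongrLeft, MeasurableEquiv.coe_mk, Equiv.piCongrLeft_apply_apply]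
    simp [MeasurableEquiv.coe_sumPiEquivProdPi_symm]
  · have : Fin.natAdd p i = finSumFinEquiv (Sum.inr i) := by simp
    simp only [Fin.append_right, Function.comp_apply]
    rw [this, MeasurableEquiv.piCongrLeft, MeasurableEquiv.coe_mk, Equiv.piCongrLeft_apply_apply]
    simp [MeasurableEquiv.coe_sumPiEquivProdPi_symm]

theorem volume_hits_slice (φ : Surj V p) (ψ : Surj V q) (ξ : Fin (p + q) → V) :
    volume {z : (Fin p → ℝ) × (Fin q → ℝ) |
      (fiberAt (φ, z.1), fiberAt (ψ, z.2)) ∈ hits p q (parallelepiped ξ)} =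
      ENNReal.ofReal |vdet (joint φ.1 ψ.1) ξ| := by
  by_cases hs : Function.Surjective (joint φ.1 ψ.1)
  · rw [← volume_image_parallelepiped]
    have hD := ((isCompact_parallelepiped ξ).image (joint φ.1 ψ.1).continuous).measurableSet
    rw [← (measurePreserving_append (p := p) (q := q)).measure_preimage hD.nullMeasurableSet]
    congr 1
    ext z
    have ht : (fiberAt (φ, z.1), fiberAt (ψ, z.2)) ∈ transversal V p q := by
      rw [mem_transversal_iff]
      simpa using (surjective_joint_iff φ.2 ψ.2).1 hs
    simp only [hits, ht, true_and, Set.mem_ofPred_eq, mem_fiberAt, mem_preimage, mem_image,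
      joint_apply, append_eq_append_iff]
  · have h0 : vdet (joint φ.1 ψ.1) ξ = 0 := by
      by_contra h0
      exact hs (surjective_of_vdet_ne_zero h0)
    have he : {z : (Fin p → ℝ) × (Fin q → ℝ) |
        (fiberAt (φ, z.1), fiberAt (ψ, z.2)) ∈ hits p q (parallelepiped ξ)} = ∅ := by
      refine eq_empty_of_forall_notMem fun z hz => hs ?_
      rw [surjective_joint_iff φ.2 ψ.2]
      simpa using (mem_transversal_iff _).1 hz.1
    rw [he, h0]; simp

theorem prod_crofton_hits (ρ : Measure (V →L[ℝ] (Fin p → ℝ))) (σ : Measure (V →L[ℝ] (Fin q → ℝ)))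
    [IsFiniteMeasure ρ] [IsFiniteMeasure σ] (ξ : Fin (p + q) → V) :
    ((crofton ρ).prod (crofton σ)) (hits p q (parallelepiped ξ)) =
      ∫⁻ φ, ∫⁻ ψ, ENNReal.ofReal |vdet (joint φ ψ) ξ| ∂σ ∂ρ := by
  set ρ' : Measure (Surj V p) := ρ.comap Subtype.val
  set σ' : Measure (Surj V q) := σ.comap Subtype.val
  have : SFinite ρ' := inferInstanceAs (SFinite (ρ.comap _))
  have : SFinite σ' := inferInstanceAs (SFinite (σ.comap _))
  have hm := measurableSet_hits (p := p) (q := q) (isCompact_parallelepiped ξ)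
  have hf := continuous_fiberAt (V := V) (m := p) |>.measurable
  have hg := continuous_fiberAt (V := V) (m := q) |>.measurable
  have hS : MeasurableSet (Prod.map fiberAt fiberAt ⁻¹' hits p q (parallelepiped ξ) :
      Set ((Surj V p × (Fin p → ℝ)) × (Surj V q × (Fin q → ℝ)))) := (hf.prodMap hg) hm
  rw [crofton, crofton, Measure.map_prod_map _ _ hf hg, Measure.map_apply (hf.prodMap hg) hm,
    Measure.prod_apply hS, lintegral_prod _ (measurable_measure_prodMk_left hS).aemeasurable]
  have key : ∀ φ : Surj V p, ∫⁻ c : Fin p → ℝ, (σ'.prod volume)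
      (Prod.mk (φ, c) ⁻¹' (Prod.map fiberAt fiberAt ⁻¹' hits p q (parallelepiped ξ))) =
      ∫⁻ ψ : Surj V q, ENNReal.ofReal |vdet (joint φ.1 ψ.1) ξ| ∂σ' := by
    intro φ
    have h1 : ∀ c : Fin p → ℝ, (σ'.prod volume)
        (Prod.mk (φ, c) ⁻¹' (Prod.map fiberAt fiberAt ⁻¹' hits p q (parallelepiped ξ))) =
        ∫⁻ ψ : Surj V q, volume {d : Fin q → ℝ |
          (fiberAt (φ, c), fiberAt (ψ, d)) ∈ hits p q (parallelepiped ξ)} ∂σ' := fun c => by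
      rw [Measure.prod_apply (measurable_prodMk_left hS)]
      rfl
    simp only [h1]
    have hS2 : MeasurableSet {z : ((Fin p → ℝ) × Surj V q) × (Fin q → ℝ) |
        (fiberAt (φ, z.1.1), fiberAt (z.1.2, z.2)) ∈ hits p q (parallelepiped ξ)} := by
      have : Measurable fun z : ((Fin p → ℝ) × Surj V q) × (Fin q → ℝ) =>
        (((φ, z.1.1), (z.1.2, z.2)) : (Surj V p × (Fin p → ℝ)) × (Surj V q × (Fin q → ℝ))) := by
          fun_prop
      exact this hS
    rw [lintegral_lintegral_swap (measurable_measure_prodMk_left hS2).aemeasurable]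
    refine lintegral_congr fun ψ => ?_
    rw [← volume_hits_slice φ ψ ξ]
    have hS3 : MeasurableSet {z : (Fin p → ℝ) × (Fin q → ℝ) |
        (fiberAt (φ, z.1), fiberAt (ψ, z.2)) ∈ hits p q (parallelepiped ξ)} := by
      have : Measurable fun z : (Fin p → ℝ) × (Fin q → ℝ) =>
        (((φ, z.1), (ψ, z.2)) : (Surj V p × (Fin p → ℝ)) × (Surj V q × (Fin q → ℝ))) := by
          fun_prop
      exact this hS
    rw [Measure.volume_eq_prod, Measure.prod_apply hS3]
    rfl
  rw [lintegral_congr key]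
  have h0 : ∀ (φ : V →L[ℝ] (Fin p → ℝ)) (ψ : V →L[ℝ] (Fin q → ℝ)),
      (¬ Function.Surjective φ ∨ ¬ Function.Surjective ψ) → vdet (joint φ ψ) ξ = 0 := by
    intro φ ψ h
    by_contra hne
    have hs := surjective_of_vdet_ne_zero hne
    rcases h with h | h
    · refine h fun c => ?_
      obtain ⟨x, hx⟩ := hs (Fin.append c 0)
      rw [joint_apply, append_eq_append_iff] at hx
      exact ⟨x, hx.1⟩
    · refine h fun c => ?_
      obtain ⟨x, hx⟩ := hs (Fin.append 0 c)
      rw [joint_apply, append_eq_append_iff] at hx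
      exact ⟨x, hx.2⟩
  have h1 : ∀ φ : V →L[ℝ] (Fin p → ℝ),
      ∫⁻ ψ : Surj V q, ENNReal.ofReal |vdet (joint φ ψ.1) ξ| ∂σ' =
      ∫⁻ ψ, ENNReal.ofReal |vdet (joint φ ψ) ξ| ∂σ := fun φ =>
    lintegral_surj σ (fun ψ => ENNReal.ofReal |vdet (joint φ ψ) ξ|) fun ψ hψ => by
      simp [h0 φ ψ (Or.inr hψ)]
  simp only [h1]
  refine lintegral_surj ρ (fun φ => ∫⁻ ψ, ENNReal.ofReal |vdet (joint φ ψ) ξ| ∂σ) fun φ hφ => ?_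
  simp [h0 φ _ (Or.inl hφ)]

/-- The signed measure with positive part `crofton ρ` and zero negative part. -/
def croftonSigned (ρ : Measure (V →L[ℝ] (Fin m → ℝ))) : SignedBorel (AGr V m) := ⟨crofton ρ, 0⟩

theorem isNormalMeasure_zero : IsNormalMeasure (0 : Measure (AGr V m)) :=
  ⟨fun _ _ _ => by simp, fun _ _ => by simp⟩

theorem croftonSigned_isNormal (ρ : Measure (V →L[ℝ] (Fin m → ℝ))) [IsFiniteMeasure ρ] {C : ℝ}
    (hρ : ∀ᵐ φ ∂ρ, ‖φ‖ ≤ C) : (croftonSigned ρ).IsNormal :=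
  ⟨isNormalMeasure_crofton ρ hρ, isNormalMeasure_zero⟩

theorem chi_croftonSigned (ρ : Measure (V →L[ℝ] (Fin m → ℝ))) (ξ : Fin m → V) :
    chi (croftonSigned ρ) ξ = (∫⁻ φ, ENNReal.ofReal |vdet φ ξ| ∂ρ).toReal := by
  simp [chi, croftonSigned, measureReal_def, crofton_meeting_parallelepiped]

theorem chi_croftonSigned_mul (ρ : Measure (V →L[ℝ] (Fin p → ℝ))) [IsFiniteMeasure ρ] {C : ℝ}
    (hρ : ∀ᵐ φ ∂ρ, ‖φ‖ ≤ C) (σ : Measure (V →L[ℝ] (Fin q → ℝ))) [IsFiniteMeasure σ] {C' : ℝ}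
    (hσ : ∀ᵐ φ ∂σ, ‖φ‖ ≤ C') (ξ : Fin (p + q) → V) :
    chi ((croftonSigned ρ).mul (croftonSigned σ)) ξ =
      (∫⁻ φ, ∫⁻ ψ, ENNReal.ofReal |vdet (joint φ ψ) ξ| ∂σ ∂ρ).toReal := by
  rw [chi_mul _ _ (croftonSigned_isNormal ρ hρ) (croftonSigned_isNormal σ hσ),
    ← prod_crofton_hits]
  simp [croftonSigned, measureReal_def]

end Crofton

section Decomposable

variable {V W : Type*} [NormedAddCommGroup V] [NormedSpace ℝ V] {m n p q : ℕ}
  [NormedAddCommGroup W] [NormedSpace ℝ W]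

/-- The density `δ` is the absolute value of a decomposable form. -/
def IsDec (δ : (Fin m → V) → ℝ) : Prop :=
  ∃ (a : ℝ) (φ : V →L[ℝ] (Fin m → ℝ)), ∀ ξ, δ ξ = |a * vdet φ ξ|

theorem IsDec.nonneg {δ : (Fin m → V) → ℝ} (h : IsDec δ) (ξ : Fin m → V) : 0 ≤ δ ξ := by
  obtain ⟨a, φ, h⟩ := h
  rw [h]; exact abs_nonneg _

theorem IsDec.comp {δ : (Fin m → W) → ℝ} (h : IsDec δ) (f : V →L[ℝ] W) :
    IsDec fun ξ : Fin m → V => δ fun i => f (ξ i) := by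
  obtain ⟨a, φ, h⟩ := h
  exact ⟨a, φ ∘L f, fun ξ => h _⟩

theorem IsDec.const_mul {δ : (Fin m → V) → ℝ} (h : IsDec δ) {c : ℝ} (hc : 0 ≤ c) :
    IsDec fun ξ => c * δ ξ := by
  obtain ⟨a, φ, h⟩ := h
  exact ⟨c * a, φ, fun ξ => by
    change c * δ ξ = _
    rw [h, mul_assoc, abs_mul c, abs_of_nonneg hc]⟩

/-- The coefficient of `v` at `eⱼ`, recovered from the density alone. -/
def recoverCoeff (δ : (Fin m → V) → ℝ) (e : Fin m → V) (v : V) (j : Fin m) : ℝ :=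
  ((δ (Function.update e j (v + e j)) / δ e) ^ 2 - (δ (Function.update e j v) / δ e) ^ 2 - 1) / 2

theorem recoverCoeff_eq [FiniteDimensional ℝ V] {a : ℝ} {φ : V →L[ℝ] (Fin m → ℝ)} {e : Fin m → V}
    (he : vdet φ e ≠ 0) (ha : a ≠ 0) (v : V) (j : Fin m) :
    recoverCoeff (fun ξ => |a * vdet φ ξ|) e v j = normalize φ e v j := by
  have h1 : vdet φ (Function.update e j (v + e j)) =
      vdet φ (Function.update e j v) + vdet φ e := by
    have := (vdetAlt φ).map_update_add e j v (e j)
    rw [Function.update_eq_self] at this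
    exact this
  rw [recoverCoeff, normalize_apply, ← abs_div, ← abs_div, sq_abs, sq_abs, h1]
  field_simp
  ring

variable [FiniteDimensional ℝ V]

/-- The linear functionals recovered from a decomposable density. -/
def recover (b : Basis (Fin n) ℝ V) (δ : (Fin m → V) → ℝ) (I : Fin m → Fin n) :
    V →L[ℝ] (Fin m → ℝ) :=
  LinearMap.toContinuousLinearMap
    (b.constr ℝ fun i => fun j => recoverCoeff δ (b ∘ I) (b i) j)

theorem recover_eq_normalize (b : Basis (Fin n) ℝ V) {a : ℝ} {φ : V →L[ℝ] (Fin m → ℝ)}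
    {I : Fin m → Fin n} (he : vdet φ (b ∘ I) ≠ 0) (ha : a ≠ 0) :
    recover b (fun ξ => |a * vdet φ ξ|) I = normalize φ (b ∘ I) := by
  apply ContinuousLinearMap.coe_injective
  refine b.ext fun i => ?_
  simp only [recover, ContinuousLinearMap.coe_coe, LinearMap.coe_toContinuousLinearMap',
    Basis.constr_basis]
  funext j
  exact recoverCoeff_eq he ha _ _

theorem IsDec.eq_mul_recover {δ : (Fin m → V) → ℝ} (hδ : IsDec δ) (b : Basis (Fin n) ℝ V)
    {I : Fin m → Fin n} (hI : δ (b ∘ I) ≠ 0) (ξ : Fin m → V) :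
    δ ξ = δ (b ∘ I) * |vdet (recover b δ I) ξ| := by
  obtain ⟨a, φ, h⟩ := hδ
  obtain rfl : δ = fun ξ => |a * vdet φ ξ| := funext h
  simp only [ne_eq, abs_eq_zero, mul_eq_zero, not_or] at hI
  simp only
  rw [recover_eq_normalize b hI.2 hI.1, vdet_normalize hI.2 ξ, ← abs_mul]
  congr 1; ring

theorem IsDec.abs_recoverCoeff_le {δ : (Fin m → V) → ℝ} (hδ : IsDec δ) (b : Basis (Fin n) ℝ V)
    {I : Fin m → Fin n} (hI : ∀ J, δ (b ∘ J) ≤ δ (b ∘ I)) (i : Fin n) (j : Fin m) :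
    |recoverCoeff δ (b ∘ I) (b i) j| ≤ 1 := by
  by_cases h0 : δ (b ∘ I) = 0
  · simp only [recoverCoeff, h0, div_zero]
    norm_num [abs_le]
  obtain ⟨a, φ, h⟩ := hδ
  obtain rfl : δ = fun ξ => |a * vdet φ ξ| := funext h
  simp only [abs_eq_zero, mul_eq_zero, not_or] at h0
  rw [recoverCoeff_eq h0.2 h0.1, normalize_apply, abs_mul, abs_inv]
  refine (inv_mul_le_one₀ (abs_pos.2 h0.2)).2 ?_
  have := hI (Function.update I j i)
  rw [← Function.comp_update]
  simp only [abs_mul] at this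
  exact le_of_mul_le_mul_left this (abs_pos.2 h0.1)

theorem exists_measurable_argmax {Z ι : Type*} [MeasurableSpace Z] [Finite ι] [Nonempty ι]
    [MeasurableSpace ι] [DiscreteMeasurableSpace ι]
    {f : ι → Z → ℝ} (hf : ∀ i, Measurable (f i)) :
    ∃ I : Z → ι, Measurable I ∧ ∀ z j, f j z ≤ f (I z) z := by
  classical
  have := Fintype.ofFinite ι
  suffices h : ∀ s : Finset ι, ∃ I : Z → ι, Measurable I ∧ ∀ z, ∀ j ∈ s, f j z ≤ f (I z) z by
    obtain ⟨I, hI, h⟩ := h Finset.univ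
    exact ⟨I, hI, fun z j => h z j (Finset.mem_univ j)⟩
  intro s
  induction s using Finset.induction_on with
  | empty => exact ⟨fun _ => Classical.arbitrary ι, measurable_const, by simp⟩
  | insert i s _ ih =>
    obtain ⟨I, hI, h⟩ := ih
    have hs : MeasurableSet {z | f (I z) z < f i z} := by
      have : {z | f (I z) z < f i z} = ⋃ j, (I ⁻¹' {j} ∩ {z | f j z < f i z}) := by
        ext z; simp
      rw [this]
      exact MeasurableSet.iUnion fun j => (hI (measurableSet_singleton j)).inter
        (measurableSet_lt (hf j) (hf i))
    refine ⟨fun z => if f (I z) z < f i z then i else I z, Measurable.ite hs measurable_const hI,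
      fun z j hj => ?_⟩
    dsimp only
    rcases Finset.mem_insert.1 hj with rfl | hj
    · split_ifs with hlt
      · exact le_rfl
      · exact not_lt.1 hlt
    · split_ifs with hlt
      · exact (h z j hj).trans hlt.le
      · exact h z j hj

theorem IsDec.eq_zero_of_basis {δ : (Fin m → V) → ℝ} (hδ : IsDec δ) (b : Basis (Fin n) ℝ V)
    (h : ∀ I : Fin m → Fin n, δ (b ∘ I) = 0) (ξ : Fin m → V) : δ ξ = 0 := by
  obtain ⟨a, φ, hφ⟩ := hδ
  rw [hφ]
  by_cases ha : a = 0
  · simp [ha]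
  rw [vdet_eq_zero_of_forall_basis b φ (fun I => ?_) ξ]
  · simp
  · have := h I
    rw [hφ] at this
    simpa [ha] using this

theorem _root_.Measurable.comp_discrete {Z ι Y : Type*} [MeasurableSpace Z] [MeasurableSpace ι]
    [MeasurableSpace Y] [Countable ι] [MeasurableSingletonClass ι] {I : Z → ι} (hI : Measurable I)
    {g : ι → Z → Y} (hg : ∀ i, Measurable (g i)) : Measurable fun z => g (I z) z :=
  (measurable_from_prod_countable_right (f := fun x : ι × Z => g x.1 x.2) hg).comp
    (hI.prodMk measurable_id)

/-- A measurable family of decomposable densities is given by measurable functionals. -/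
theorem exists_measurable_functionals {Z : Type*} [MeasurableSpace Z] {τ : Measure Z}
    {D : Z → (Fin m → V) → ℝ} (hdec : ∀ z, IsDec (D z))
    (hmeas : ∀ ξ, Measurable fun z => D z ξ) (hint : ∀ ξ, Integrable (fun z => D z ξ) τ) :
    ∃ (a : Z → ℝ) (ψ : Z → V →L[ℝ] (Fin m → ℝ)), Measurable a ∧ Measurable ψ ∧
      (∃ C, ∀ z, ‖ψ z‖ ≤ C) ∧ (∀ z, 0 ≤ a z) ∧ Integrable a τ ∧
      ∀ z ξ, D z ξ = a z * |vdet (ψ z) ξ| := by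
  set b := finBasis ℝ V
  rcases isEmpty_or_nonempty (Fin m → Fin (finrank ℝ V)) with hemp | hne
  · refine ⟨0, 0, measurable_const, measurable_const, ⟨0, by simp⟩, fun _ => le_rfl,
      integrable_zero _ _ _, fun z ξ => ?_⟩
    rw [(hdec z).eq_zero_of_basis b (fun I => hemp.elim I)]
    simp
  obtain ⟨I, hI, hmax⟩ := exists_measurable_argmax (Z := Z)
    (f := fun (I : Fin m → Fin (finrank ℝ V)) z => D z (b ∘ I)) fun I => hmeas _
  refine ⟨fun z => D z (b ∘ I z), fun z => recover b (D z) (I z), ?_, ?_, ?_,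
    fun z => (hdec z).nonneg _, ?_, fun z ξ => ?_⟩
  · exact hI.comp_discrete (g := fun J z => D z (b ∘ J)) fun J => hmeas _
  · refine hI.comp_discrete (g := fun J z => recover b (D z) J) fun J => ?_
    let L : (Fin (finrank ℝ V) → Fin m → ℝ) →ₗ[ℝ] (V →L[ℝ] (Fin m → ℝ)) :=
      (LinearMap.toContinuousLinearMap (𝕜 := ℝ) (E := V) (F' := Fin m → ℝ)).toLinearMap ∘ₗ
        (b.constr ℝ).toLinearMap
    have hL : Continuous L := L.continuous_of_finiteDimensional
    refine hL.measurable.comp (g := L) (f := fun z => fun i j => recoverCoeff (D z) (b ∘ J) (b i) j)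
      (measurable_pi_lambda _ fun i => measurable_pi_lambda _ fun j => ?_)
    unfold recoverCoeff
    exact ((((hmeas _).div (hmeas _)).pow_const 2).sub
      (((hmeas _).div (hmeas _)).pow_const 2) |>.sub_const 1).div_const 2
  · refine ⟨Fintype.card (Fin (finrank ℝ V)) • ‖b.equivFunL.toContinuousLinearMap‖ * 1,
      fun z => b.opNorm_le zero_le_one fun i => ?_⟩
    refine (pi_norm_le_iff_of_nonneg zero_le_one).2 fun j => ?_
    simp only [recover, LinearMap.coe_toContinuousLinearMap', Basis.constr_basis]
    exact (hdec z).abs_recoverCoeff_le b (hmax z) i j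
  · refine Integrable.mono' (g := fun z => ∑ J, D z (b ∘ J))
      (integrable_finsetSum _ fun J _ => hint _)
      (hI.comp_discrete (g := fun J z => D z (b ∘ J)) fun J => hmeas _).aestronglyMeasurable
      (Filter.Eventually.of_forall fun z => ?_)
    rw [Real.norm_of_nonneg ((hdec z).nonneg _)]
    exact Finset.single_le_sum (f := fun J => D z (b ∘ J)) (fun J _ => (hdec z).nonneg _)
      (Finset.mem_univ _)
  · dsimp only
    by_cases h0 : D z (b ∘ I z) = 0
    · rw [h0, zero_mul]
      exact (hdec z).eq_zero_of_basis b (fun J => le_antisymm ((hmax z J).trans_eq h0)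
        ((hdec z).nonneg _)) ξ
    · exact (hdec z).eq_mul_recover b h0 ξ

/-- The measure on the space of linear maps that a weighted family defines. -/
def familyMeasure {Z : Type*} [MeasurableSpace Z] (τ : Measure Z) (a : Z → ℝ)
    (ψ : Z → V →L[ℝ] (Fin m → ℝ)) : Measure (V →L[ℝ] (Fin m → ℝ)) :=
  (τ.withDensity fun z => ENNReal.ofReal (a z)).map ψ

theorem isFiniteMeasure_familyMeasure {Z : Type*} [MeasurableSpace Z] {τ : Measure Z} {a : Z → ℝ}
    (ha : Integrable a τ) (ψ : Z → V →L[ℝ] (Fin m → ℝ)) :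
    IsFiniteMeasure (familyMeasure τ a ψ) := by
  have := isFiniteMeasure_withDensity_ofReal ha.2
  unfold familyMeasure
  infer_instance

theorem lintegral_familyMeasure {Z : Type*} [MeasurableSpace Z] {τ : Measure Z} {a : Z → ℝ}
    (ha : Measurable a) {ψ : Z → V →L[ℝ] (Fin m → ℝ)} (hψ : Measurable ψ)
    {f : (V →L[ℝ] (Fin m → ℝ)) → ENNReal} (hf : Measurable f) :
    ∫⁻ φ, f φ ∂familyMeasure τ a ψ = ∫⁻ z, ENNReal.ofReal (a z) * f (ψ z) ∂τ := by
  rw [familyMeasure, lintegral_map hf hψ]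
  exact lintegral_withDensity_eq_lintegral_mul _ ha.ennreal_ofReal (hf.comp hψ)

theorem ae_familyMeasure {Z : Type*} [MeasurableSpace Z] {τ : Measure Z} {a : Z → ℝ}
    {ψ : Z → V →L[ℝ] (Fin m → ℝ)} (hψ : Measurable ψ) {C : ℝ} (hC : ∀ z, ‖ψ z‖ ≤ C) :
    ∀ᵐ φ ∂familyMeasure τ a ψ, ‖φ‖ ≤ C := by
  refine (ae_map_iff hψ.aemeasurable ?_).2 (Filter.Eventually.of_forall hC)
  exact (isClosed_le continuous_norm continuous_const).measurableSet

theorem chi_familyMeasure {Z : Type*} [MeasurableSpace Z] {τ : Measure Z} {a : Z → ℝ}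
    (ha : Measurable a) {ψ : Z → V →L[ℝ] (Fin m → ℝ)} (hψ : Measurable ψ) (h0 : ∀ z, 0 ≤ a z)
    (ξ : Fin m → V) :
    chi (croftonSigned (familyMeasure τ a ψ)) ξ = ∫ z, a z * |vdet (ψ z) ξ| ∂τ := by
  have hv : Measurable fun φ : V →L[ℝ] (Fin m → ℝ) => |vdet φ ξ| :=
    (continuous_vdet ξ).abs.measurable
  rw [chi_croftonSigned, lintegral_familyMeasure ha hψ hv.ennreal_ofReal,
    integral_eq_lintegral_of_nonneg_ae (Filter.Eventually.of_forall fun z =>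
      mul_nonneg (h0 z) (abs_nonneg _)) (ha.mul (hv.comp hψ)).aestronglyMeasurable]
  congr 1
  exact lintegral_congr fun z => (ENNReal.ofReal_mul (h0 z)).symm

/-- Integrals of decomposable densities are normal. -/
theorem isNormalAt_integral {Z : Type*} [MeasurableSpace Z] {τ : Measure Z}
    {D : Z → (Fin m → V) → ℝ} (hdec : ∀ z, IsDec (D z))
    (hmeas : ∀ ξ, Measurable fun z => D z ξ) (hint : ∀ ξ, Integrable (fun z => D z ξ) τ) :
    IsNormalAt fun ξ => ∫ z, D z ξ ∂τ := by
  obtain ⟨a, ψ, ha, hψ, ⟨C, hC⟩, h0, hai, h⟩ := exists_measurable_functionals hdec hmeas hint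
  have := isFiniteMeasure_familyMeasure hai ψ
  refine ⟨croftonSigned (familyMeasure τ a ψ), croftonSigned_isNormal _
    (ae_familyMeasure hψ hC), ?_⟩
  funext ξ
  simp only [chi_familyMeasure ha hψ h0, h]

theorem continuous_vdet_joint (ξ : Fin (p + q) → V) :
    Continuous fun z : (V →L[ℝ] (Fin p → ℝ)) × (V →L[ℝ] (Fin q → ℝ)) =>
      |vdet (joint z.1 z.2) ξ| :=
  ((continuous_vdet ξ).comp continuous_joint).abs

theorem measurable_vdet_joint_prod (ξ : Fin (p + q) → V) :
    Measurable fun z : (V →L[ℝ] (Fin p → ℝ)) × (V →L[ℝ] (Fin q → ℝ)) =>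
      |vdet (joint z.1 z.2) ξ| := (continuous_vdet_joint ξ).measurable

theorem measurable_vdet_joint {Z : Type*} [MeasurableSpace Z] {ψ : Z → V →L[ℝ] (Fin p → ℝ)}
    {ψ' : Z → V →L[ℝ] (Fin q → ℝ)} (hψ : Measurable ψ) (hψ' : Measurable ψ')
    (ξ : Fin (p + q) → V) : Measurable fun z => |vdet (joint (ψ z) (ψ' z)) ξ| := by
  have h0 : Measurable fun z => (ψ z, ψ' z) := Measurable.prodMk hψ hψ'
  have h := (measurable_vdet_joint_prod (V := V) (p := p) (q := q) ξ).comp h0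
  exact h

theorem mulAt_integral_aux {Z Z' : Type*} [MeasurableSpace Z] [MeasurableSpace Z'] {τ : Measure Z}
    {τ' : Measure Z'} [SFinite τ] [SFinite τ'] {a : Z → ℝ} {a' : Z' → ℝ}
    {ψ : Z → V →L[ℝ] (Fin p → ℝ)} {ψ' : Z' → V →L[ℝ] (Fin q → ℝ)}
    (ha : Measurable a) (ha' : Measurable a') (hψ : Measurable ψ) (hψ' : Measurable ψ')
    {C C' : ℝ} (hC : ∀ z, ‖ψ z‖ ≤ C) (hC' : ∀ z, ‖ψ' z‖ ≤ C') (h0 : ∀ z, 0 ≤ a z)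
    (h0' : ∀ z, 0 ≤ a' z) (hai : Integrable a τ) (hai' : Integrable a' τ')
    (ξ : Fin (p + q) → V) :
    mulAt (fun ξ => ∫ z, a z * |vdet (ψ z) ξ| ∂τ) (fun ξ => ∫ z, a' z * |vdet (ψ' z) ξ| ∂τ') ξ =
      ∫ z, a z.1 * a' z.2 * |vdet (joint (ψ z.1) (ψ' z.2)) ξ| ∂(τ.prod τ') := by
  have := isFiniteMeasure_familyMeasure hai ψ
  have := isFiniteMeasure_familyMeasure hai' ψ'
  have hb := ae_familyMeasure (τ := τ) (a := a) hψ hC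
  have hb' := ae_familyMeasure (τ := τ') (a := a') hψ' hC'
  rw [mulAt_eq_chi (croftonSigned_isNormal _ hb) (croftonSigned_isNormal _ hb')
    (funext fun ξ => chi_familyMeasure ha hψ h0 ξ)
    (funext fun ξ => chi_familyMeasure ha' hψ' h0' ξ), chi_croftonSigned_mul _ hb _ hb']
  have hm : Measurable fun z : Z × Z' =>
      a z.1 * a' z.2 * |vdet (joint (ψ z.1) (ψ' z.2)) ξ| := by
    have h2 : Measurable fun z : Z × Z' => |vdet (joint (ψ z.1) (ψ' z.2)) ξ| :=
      measurable_vdet_joint (hψ.comp measurable_fst) (hψ'.comp measurable_snd) ξ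
    exact Measurable.mul (by fun_prop) h2
  rw [integral_eq_lintegral_of_nonneg_ae (Filter.Eventually.of_forall fun z =>
      mul_nonneg (mul_nonneg (h0 _) (h0' _)) (abs_nonneg _)) hm.aestronglyMeasurable,
    lintegral_prod _ hm.ennreal_ofReal.aemeasurable]
  congr 1
  have hv' : Measurable (Function.uncurry fun (φ : V →L[ℝ] (Fin p → ℝ)) (ψ : V →L[ℝ] (Fin q → ℝ)) =>
    ENNReal.ofReal |vdet (joint φ ψ) ξ|) := (measurable_vdet_joint_prod ξ).ennreal_ofReal
  rw [lintegral_familyMeasure ha hψ hv'.lintegral_prod_right]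
  refine lintegral_congr fun z => ?_
  have hv2 : Measurable fun φ : V →L[ℝ] (Fin q → ℝ) => ENNReal.ofReal |vdet (joint (ψ z) φ) ξ| :=
    (measurable_vdet_joint measurable_const measurable_id ξ).ennreal_ofReal
  rw [lintegral_familyMeasure ha' hψ' hv2,
    ← lintegral_const_mul' _ _ ENNReal.ofReal_ne_top]
  refine lintegral_congr fun w => ?_
  rw [← ENNReal.ofReal_mul (h0' _), ← ENNReal.ofReal_mul (h0 _), mul_assoc]

/-- The product of decomposable densities. -/
theorem mulAt_dec (a a' : ℝ) (φ : V →L[ℝ] (Fin p → ℝ)) (ψ : V →L[ℝ] (Fin q → ℝ)) :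
    mulAt (fun ξ => |a * vdet φ ξ|) (fun ξ => |a' * vdet ψ ξ|) =
      fun ξ => |a * a' * vdet (joint φ ψ) ξ| := by
  funext ξ
  have h := mulAt_integral_aux (τ := Measure.dirac ()) (τ' := Measure.dirac ())
    (a := fun _ => |a|) (a' := fun _ => |a'|) (ψ := fun _ => φ) (ψ' := fun _ => ψ)
    measurable_const measurable_const measurable_const measurable_const (fun _ => le_rfl)
    (fun _ => le_rfl) (fun _ => abs_nonneg _) (fun _ => abs_nonneg _) (integrable_const _)
    (integrable_const _) ξ
  simpa [abs_mul] using h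

theorem IsDec.isNormalAt {δ : (Fin m → V) → ℝ} (h : IsDec δ) : IsNormalAt δ := by
  have := isNormalAt_integral (τ := Measure.dirac ()) (D := fun _ : Unit => δ) (fun _ => h)
    (fun _ => measurable_const) (fun _ => integrable_const _)
  simpa using this

theorem IsDec.mulAt {δ : (Fin p → V) → ℝ} {δ' : (Fin q → V) → ℝ} (h : IsDec δ) (h' : IsDec δ') :
    IsDec (mulAt δ δ') := by
  obtain ⟨a, φ, h⟩ := h
  obtain ⟨a', φ', h'⟩ := h'
  obtain rfl := funext h
  obtain rfl := funext h'
  exact ⟨_, _, fun ξ => congrFun (mulAt_dec a a' φ φ') ξ⟩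

/-- The product of integrals of decomposable densities is the integral of the products. -/
theorem mulAt_integral {Z Z' : Type*} [MeasurableSpace Z] [MeasurableSpace Z'] {τ : Measure Z}
    {τ' : Measure Z'} [SFinite τ] [SFinite τ']
    {D : Z → (Fin p → V) → ℝ} (hdec : ∀ z, IsDec (D z))
    (hmeas : ∀ ξ, Measurable fun z => D z ξ) (hint : ∀ ξ, Integrable (fun z => D z ξ) τ)
    {D' : Z' → (Fin q → V) → ℝ} (hdec' : ∀ z, IsDec (D' z))
    (hmeas' : ∀ ξ, Measurable fun z => D' z ξ) (hint' : ∀ ξ, Integrable (fun z => D' z ξ) τ')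
    (ξ : Fin (p + q) → V) :
    mulAt (fun ξ => ∫ z, D z ξ ∂τ) (fun ξ => ∫ z, D' z ξ ∂τ') ξ =
      ∫ z, mulAt (D z.1) (D' z.2) ξ ∂(τ.prod τ') := by
  obtain ⟨a, ψ, ha, hψ, ⟨C, hC⟩, h0, hai, h⟩ := exists_measurable_functionals hdec hmeas hint
  obtain ⟨a', ψ', ha', hψ', ⟨C', hC'⟩, h0', hai', h'⟩ :=
    exists_measurable_functionals hdec' hmeas' hint'
  have e : ∀ z, D z = fun ξ => |a z * vdet (ψ z) ξ| := fun z => funext fun ξ => by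
    rw [h, abs_mul, abs_of_nonneg (h0 z)]
  have e' : ∀ z, D' z = fun ξ => |a' z * vdet (ψ' z) ξ| := fun z => funext fun ξ => by
    rw [h', abs_mul, abs_of_nonneg (h0' z)]
  have key := mulAt_integral_aux ha ha' hψ hψ' hC hC' h0 h0' hai hai' ξ
  simp only [← h, ← h'] at key
  rw [key]
  refine integral_congr_ae (Filter.Eventually.of_forall fun z => ?_)
  simp only
  rw [e, e', mulAt_dec]
  dsimp only
  rw [abs_mul, abs_of_nonneg (mul_nonneg (h0 _) (h0' _))]

/-- The change of variables for decomposable densities. -/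
theorem IsDec.linear_comb {δ : (Fin m → V) → ℝ} (h : IsDec δ) (B : Matrix (Fin m) (Fin m) ℝ)
    (ξ : Fin m → V) : δ (fun j => ∑ i, B i j • ξ i) = |B.det| * δ ξ := by
  obtain ⟨a, φ, h⟩ := h
  rw [h, h]
  have : vdet φ (fun j => ∑ i, B i j • ξ i) = B.det * vdet φ ξ := by
    unfold vdet
    rw [← Matrix.det_transpose B, ← Matrix.det_mul]
    congr 1
    ext i k
    simp [Matrix.mul_apply]
  rw [this, ← abs_mul]
  congr 1; ring

end Decomposable

section Contraction

variable {V : Type*} [NormedAddCommGroup V] [NormedSpace ℝ V] {m n p q l k : ℕ}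
  [FiniteDimensional ℝ V]

theorem exists_surjective_ker_ge (C : Submodule ℝ (Fin (l + k) → ℝ)) (hC : finrank ℝ C ≤ k) :
    ∃ π : (Fin (l + k) → ℝ) →ₗ[ℝ] (Fin l → ℝ), Function.Surjective π ∧ ∀ c ∈ C, π c = 0 := by
  have hd := Submodule.finrank_quotient_add_finrank C
  rw [finrank_fin_fun] at hd
  have hl : l ≤ finrank ℝ ((Fin (l + k) → ℝ) ⧸ C) := by omega
  let b := finBasis ℝ ((Fin (l + k) → ℝ) ⧸ C)
  let r : (Fin (finrank ℝ ((Fin (l + k) → ℝ) ⧸ C)) → ℝ) →ₗ[ℝ] (Fin l → ℝ) :=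
    LinearMap.funLeft ℝ ℝ (Fin.castLE hl)
  refine ⟨r ∘ₗ b.equivFun.toLinearMap ∘ₗ C.mkQ, ?_, fun c hc => ?_⟩
  · exact (LinearMap.funLeft_surjective_of_injective ℝ ℝ _ (Fin.castLE_injective hl)).comp
      (b.equivFun.surjective.comp (Submodule.mkQ_surjective C))
  · simp [(Submodule.Quotient.mk_eq_zero C).2 hc]

theorem exists_linearEquiv_vanishing (C : Submodule ℝ (Fin (l + k) → ℝ)) (hC : finrank ℝ C ≤ k) :
    ∃ P : (Fin (l + k) → ℝ) ≃ₗ[ℝ] (Fin (l + k) → ℝ),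
      ∀ c ∈ C, ∀ i : Fin l, P c (Fin.castAdd k i) = 0 := by
  obtain ⟨π, hπ, hπC⟩ := exists_surjective_ker_ge C hC
  obtain ⟨R, hR⟩ := π.exists_rightInverse_of_surjective (LinearMap.range_eq_top.2 hπ)
  have hR' : ∀ c, π (R c) = c := fun c => by simpa using LinearMap.congr_fun hR c
  have hker : finrank ℝ (LinearMap.ker π) = k := by
    have := π.finrank_range_add_finrank_ker
    rw [LinearMap.range_eq_top.2 hπ, finrank_top, finrank_fin_fun, finrank_fin_fun] at this
    omega
  let e : LinearMap.ker π ≃ₗ[ℝ] (Fin k → ℝ) := LinearEquiv.ofFinrankEq _ _ (by simp [hker])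
  let pr : (Fin (l + k) → ℝ) →ₗ[ℝ] LinearMap.ker π :=
    LinearMap.codRestrict _ (LinearMap.id - R ∘ₗ π) fun v => by simp [hR']
  let Q : (Fin (l + k) → ℝ) →ₗ[ℝ] (Fin (l + k) → ℝ) :=
    LinearMap.funLeft ℝ ℝ finSumFinEquiv.symm ∘ₗ
      (LinearEquiv.sumArrowLequivProdArrow (Fin l) (Fin k) ℝ ℝ).symm.toLinearMap ∘ₗ
        (π.prod (e.toLinearMap ∘ₗ pr))
  have hQ1 : ∀ v i, Q v (Fin.castAdd k i) = π v i := fun v i => by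
    simp [Q, LinearMap.funLeft_apply]
  have hQ2 : ∀ v i, Q v (Fin.natAdd l i) = e (pr v) i := fun v i => by
    simp [Q, LinearMap.funLeft_apply]
  have hinj : Function.Injective Q := by
    refine (injective_iff_map_eq_zero _).2 fun v hv => ?_
    have h1 : π v = 0 := funext fun i => by rw [← hQ1, hv]; rfl
    have h2 : e (pr v) = 0 := funext fun i => by rw [← hQ2, hv]; rfl
    have h3 : pr v = 0 := e.map_eq_zero_iff.1 h2
    have h4 : v - R (π v) = 0 := congrArg Subtype.val h3
    rwa [h1, map_zero, sub_zero] at h4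
  exact ⟨LinearEquiv.ofInjectiveEndo Q hinj, fun c hc i => by
    rw [LinearEquiv.coe_ofInjectiveEndo, hQ1, hπC c hc]; rfl⟩

theorem vdet_comp_left (A : (Fin m → ℝ) →ₗ[ℝ] (Fin m → ℝ)) {φ ψ : V →L[ℝ] (Fin m → ℝ)}
    (h : ∀ v, φ v = A (ψ v)) (ξ : Fin m → V) : vdet φ ξ = LinearMap.det A * vdet ψ ξ := by
  unfold vdet
  simp only [h]
  rw [← LinearMap.det_toMatrix', mul_comm, ← Matrix.det_transpose (LinearMap.toMatrix' _),
    ← Matrix.det_mul]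
  congr 1
  ext i j
  rw [Matrix.of_apply, ← LinearMap.toMatrix'_mulVec]
  simp [Matrix.mulVec, dotProduct, Matrix.mul_apply, mul_comm]

/-- After a linear change of the functionals, the first `l` of them vanish on the given vectors. -/
theorem exists_split (φ : V →L[ℝ] (Fin (l + k) → ℝ)) (f : Fin k → V) :
    ∃ (ψ : V →L[ℝ] (Fin l → ℝ)) (χ : V →L[ℝ] (Fin k → ℝ)) (c : ℝ),
      (∀ j, ψ (f j) = 0) ∧ ∀ ξ, vdet φ ξ = c * vdet (joint ψ χ) ξ := by
  have hC : finrank ℝ (Submodule.span ℝ (range fun j => φ (f j))) ≤ k := by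
    have := finrank_range_le_card (R := ℝ) (fun j => φ (f j))
    rwa [Fintype.card_fin] at this
  obtain ⟨P, hP⟩ := exists_linearEquiv_vanishing _ hC
  let P' : V →ₗ[ℝ] (Fin (l + k) → ℝ) := P.toLinearMap ∘ₗ (φ : V →ₗ[ℝ] (Fin (l + k) → ℝ))
  let ψ : V →L[ℝ] (Fin l → ℝ) :=
    LinearMap.toContinuousLinearMap (LinearMap.funLeft ℝ ℝ (Fin.castAdd k) ∘ₗ P')
  let χ : V →L[ℝ] (Fin k → ℝ) :=
    LinearMap.toContinuousLinearMap (LinearMap.funLeft ℝ ℝ (Fin.natAdd l) ∘ₗ P')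
  refine ⟨ψ, χ, LinearMap.det (P.symm : (Fin (l + k) → ℝ) →ₗ[ℝ] (Fin (l + k) → ℝ)),
    fun j => funext fun i => hP _ (Submodule.subset_span (mem_range_self j)) i,
    vdet_comp_left _ fun v => ?_⟩
  rw [LinearEquiv.coe_coe, LinearEquiv.eq_symm_apply, joint_apply]
  exact (Fin.append_castAdd_natAdd (f := P (φ v))).symm

theorem vdet_joint_append (ψ : V →L[ℝ] (Fin l → ℝ)) (χ : V →L[ℝ] (Fin k → ℝ)) (ξ : Fin l → V)
    (f : Fin k → V) (h : ∀ j, ψ (f j) = 0) :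
    vdet (joint ψ χ) (Fin.append ξ f) = vdet ψ ξ * vdet χ f := by
  have : (Matrix.of fun j => joint ψ χ (Fin.append ξ f j)).submatrix finSumFinEquiv finSumFinEquiv =
      Matrix.fromBlocks (Matrix.of fun j => ψ (ξ j)) (Matrix.of fun j => χ (ξ j)) 0
        (Matrix.of fun j => χ (f j)) := by
    ext i j
    rcases i with i | i <;> rcases j with j | j <;> simp [joint_apply, h]
  rw [vdet, ← Matrix.det_submatrix_equiv_self finSumFinEquiv, this, Matrix.det_fromBlocks_zero₂₁]
  rfl

/-- The contraction of a decomposable density by vectors is decomposable. -/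
theorem IsDec.contract {δ : (Fin m → V) → ℝ} (hδ : IsDec δ) (h : l + k = m) (f : Fin k → V) :
    IsDec fun ξ : Fin l → V => δ (Fin.append ξ f ∘ Fin.cast h.symm) := by
  subst h
  obtain ⟨a, φ, hφ⟩ := hδ
  obtain ⟨ψ, χ, c, h0, hc⟩ := exists_split φ f
  refine ⟨a * c * vdet χ f, ψ, fun ξ => ?_⟩
  have : δ (Fin.append ξ f) = |a * (c * (vdet ψ ξ * vdet χ f))| := by
    rw [hφ, hc, vdet_joint_append ψ χ ξ f h0]
  refine Eq.trans this ?_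
  congr 1; ring

variable {U₁ U₂ W₁ W₂ : Type*} [NormedAddCommGroup U₁] [NormedSpace ℝ U₁] [NormedAddCommGroup U₂]
  [NormedSpace ℝ U₂] [NormedAddCommGroup W₁] [NormedSpace ℝ W₁] [NormedAddCommGroup W₂]
  [NormedSpace ℝ W₂] [FiniteDimensional ℝ U₁] [FiniteDimensional ℝ U₂] [FiniteDimensional ℝ W₁]
  [FiniteDimensional ℝ W₂]

/-- Contraction commutes with exterior products of decomposable densities. -/
theorem mulAt_contract {m₁ m₂ l₁ l₂ k₁ k₂ : ℕ} (h₁ : l₁ + k₁ = m₁) (h₂ : l₂ + k₂ = m₂)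
    {δ₁ : (Fin m₁ → W₁) → ℝ} {δ₂ : (Fin m₂ → W₂) → ℝ} (hδ₁ : IsDec δ₁) (hδ₂ : IsDec δ₂)
    (g₁ : U₁ →L[ℝ] W₁) (g₂ : U₂ →L[ℝ] W₂) (f₁ : Fin k₁ → W₁) (f₂ : Fin k₂ → W₂)
    (e : Fin (m₁ + m₂) ≃ Fin (l₁ + l₂) ⊕ (Fin k₁ ⊕ Fin k₂)) (η : Fin (l₁ + l₂) → U₁ × U₂) :
    mulAt (fun ξ : Fin m₁ → W₁ × W₂ => δ₁ fun i => (ξ i).1)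
      (fun ξ : Fin m₂ → W₁ × W₂ => δ₂ fun i => (ξ i).2)
      (fun i => Sum.elim (fun i => (g₁ (η i).1, g₂ (η i).2))
        (Sum.elim (fun j => (f₁ j, 0)) (fun j => (0, f₂ j))) (e i)) =
    mulAt (fun ξ : Fin l₁ → U₁ × U₂ =>
        δ₁ (Fin.append (fun i => g₁ (ξ i).1) f₁ ∘ Fin.cast h₁.symm))
      (fun ξ : Fin l₂ → U₁ × U₂ =>
        δ₂ (Fin.append (fun i => g₂ (ξ i).2) f₂ ∘ Fin.cast h₂.symm)) η := by
  subst h₁ h₂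
  obtain ⟨a₁, φ₁, hφ₁⟩ := hδ₁
  obtain ⟨ψ₁, χ₁, c₁, h01, hc₁⟩ := exists_split φ₁ f₁
  obtain ⟨a₂, φ₂, hφ₂⟩ := hδ₂
  obtain ⟨ψ₂, χ₂, c₂, h02, hc₂⟩ := exists_split φ₂ f₂
  have e1 : (fun ξ : Fin (l₁ + k₁) → W₁ × W₂ => δ₁ fun i => (ξ i).1) =
      fun ξ => |(a₁ * c₁) * vdet (joint ψ₁ χ₁ ∘L ContinuousLinearMap.fst ℝ W₁ W₂) ξ| := by
    funext ξ; rw [hφ₁, hc₁, vdet_comp, mul_assoc]; rfl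
  have e2 : (fun ξ : Fin (l₂ + k₂) → W₁ × W₂ => δ₂ fun i => (ξ i).2) =
      fun ξ => |(a₂ * c₂) * vdet (joint ψ₂ χ₂ ∘L ContinuousLinearMap.snd ℝ W₁ W₂) ξ| := by
    funext ξ; rw [hφ₂, hc₂, vdet_comp, mul_assoc]; rfl
  have e3 : (fun ξ : Fin l₁ → U₁ × U₂ =>
        δ₁ (Fin.append (fun i => g₁ (ξ i).1) f₁ ∘ Fin.cast rfl)) =
      fun ξ => |(a₁ * c₁ * vdet χ₁ f₁) *
        vdet (ψ₁ ∘L g₁ ∘L ContinuousLinearMap.fst ℝ U₁ U₂) ξ| := by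
    funext ξ
    have : δ₁ (Fin.append (fun i => g₁ (ξ i).1) f₁) = _ := hφ₁ _
    rw [hc₁, vdet_joint_append _ _ _ _ h01] at this
    refine Eq.trans this ?_
    congr 1
    simp only [vdet_comp, ContinuousLinearMap.coe_fst', ContinuousLinearMap.comp_apply]
    ring
  have e4 : (fun ξ : Fin l₂ → U₁ × U₂ =>
        δ₂ (Fin.append (fun i => g₂ (ξ i).2) f₂ ∘ Fin.cast rfl)) =
      fun ξ => |(a₂ * c₂ * vdet χ₂ f₂) *
        vdet (ψ₂ ∘L g₂ ∘L ContinuousLinearMap.snd ℝ U₁ U₂) ξ| := by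
    funext ξ
    have : δ₂ (Fin.append (fun i => g₂ (ξ i).2) f₂) = _ := hφ₂ _
    rw [hc₂, vdet_joint_append _ _ _ _ h02] at this
    refine Eq.trans this ?_
    congr 1
    simp only [vdet_comp, ContinuousLinearMap.coe_snd', ContinuousLinearMap.comp_apply]
    ring
  rw [e1, e2, e3, e4, mulAt_dec, mulAt_dec]
  simp only
  set X : Fin (l₁ + l₂) ⊕ (Fin k₁ ⊕ Fin k₂) → W₁ × W₂ :=
    Sum.elim (fun i => (g₁ (η i).1, g₂ (η i).2))
      (Sum.elim (fun j => (f₁ j, 0)) (fun j => (0, f₂ j))) with hX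
  set Ψ := joint (ψ₁ ∘L g₁ ∘L ContinuousLinearMap.fst ℝ U₁ U₂)
    (ψ₂ ∘L g₂ ∘L ContinuousLinearMap.snd ℝ U₁ U₂) with hΨ
  let e' : Fin ((l₁ + k₁) + (l₂ + k₂)) ≃ Fin (l₁ + l₂) ⊕ (Fin k₁ ⊕ Fin k₂) :=
    finSumFinEquiv.symm.trans (((Equiv.sumCongr finSumFinEquiv.symm finSumFinEquiv.symm).trans
      (Equiv.sumSumSumComm _ _ _ _)).trans (Equiv.sumCongr finSumFinEquiv (Equiv.refl _)))
  let T : Matrix (Fin k₁ ⊕ Fin k₂) (Fin k₁ ⊕ Fin k₂) ℝ :=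
    Matrix.fromBlocks (Matrix.of fun j => χ₁ (f₁ j)) 0 0 (Matrix.of fun j => χ₂ (f₂ j))
  let S : Matrix (Fin (l₁ + l₂)) (Fin k₁ ⊕ Fin k₂) ℝ :=
    Matrix.of fun i j => Sum.elim (χ₁ (g₁ (η i).1)) (χ₂ (g₂ (η i).2)) j
  let M : Matrix (Fin (l₁ + l₂) ⊕ (Fin k₁ ⊕ Fin k₂)) (Fin (l₁ + l₂) ⊕ (Fin k₁ ⊕ Fin k₂)) ℝ :=
    Matrix.fromBlocks (Matrix.of fun i => Ψ (η i)) S 0 T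
  have hM : (Matrix.of fun i => joint (joint ψ₁ χ₁ ∘L ContinuousLinearMap.fst ℝ W₁ W₂)
      (joint ψ₂ χ₂ ∘L ContinuousLinearMap.snd ℝ W₁ W₂) (X (e i))) = M.submatrix e e' := by
    ext i j
    rw [Matrix.submatrix_apply, Matrix.of_apply]
    generalize e i = x
    refine Fin.addCases (fun j => ?_) (fun j => ?_) j <;>
      refine Fin.addCases (fun j => ?_) (fun j => ?_) j <;>
      rcases x with x | x | x <;>
      simp [joint_apply, hX, hΨ, e', M, T, S, h01, h02]
  have hdet : |vdet (joint (joint ψ₁ χ₁ ∘L ContinuousLinearMap.fst ℝ W₁ W₂)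
      (joint ψ₂ χ₂ ∘L ContinuousLinearMap.snd ℝ W₁ W₂)) fun i => X (e i)| =
      |vdet Ψ η * (vdet χ₁ f₁ * vdet χ₂ f₂)| := by
    rw [vdet, hM, Matrix.abs_det_submatrix_equiv_equiv, Matrix.det_fromBlocks_zero₂₁,
      Matrix.det_fromBlocks_zero₂₁]
    rfl
  rw [abs_mul, hdet, ← abs_mul]
  congr 1; ring

end Contraction

section Params

variable {E : Type*} [NormedAddCommGroup E] [NormedSpace ℝ E]
  {H : Type*} [TopologicalSpace H] {I : ModelWithCorners ℝ E H}
  {F : Type*} [TopologicalSpace F] [ChartedSpace H F] {k : ℕ}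

variable (I) in
/-- A parametrization of an open subset of `F` by an open subset of `ℝ^k`. -/
structure IsParam (Θ : OpenPartialHomeomorph (Fin k → ℝ) F) : Prop where
  smooth : ContMDiffOn 𝓘(ℝ, Fin k → ℝ) I 1 Θ Θ.source
  smooth_symm : ContMDiffOn I 𝓘(ℝ, Fin k → ℝ) 1 Θ.symm Θ.target

variable (I) in
/-- The coordinate vector fields of a parametrization. -/
def frame (Θ : OpenPartialHomeomorph (Fin k → ℝ) F) (t : Fin k → ℝ) (i : Fin k) :
    TangentSpace I (Θ t) :=
  mfderiv 𝓘(ℝ, Fin k → ℝ) I Θ t (Pi.single i 1 : Fin k → ℝ)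

/-- The coordinate expression of a density, weighted by a function. -/
def coordIntegrand (β : DensityField I F k) (h : F → ℝ)
    (Θ : OpenPartialHomeomorph (Fin k → ℝ) F) : (Fin k → ℝ) → ℝ :=
  Θ.source.indicator fun t => h (Θ t) * β (Θ t) (frame I Θ t)

/-- The transformation law of densities of top order. -/
def IsTopDensity (β : DensityField I F k) : Prop :=
  ∀ (z : F) (B : Matrix (Fin k) (Fin k) ℝ) (f : Fin k → TangentSpace I z),
    β z (fun j => ∑ i, B i j • f i) = |B.det| * β z f

theorem IsParam.mdifferentiableAt {Θ : OpenPartialHomeomorph (Fin k → ℝ) F} (h : IsParam I Θ)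
    {t : Fin k → ℝ} (ht : t ∈ Θ.source) : MDifferentiableAt 𝓘(ℝ, Fin k → ℝ) I Θ t :=
  (h.smooth.contMDiffAt (Θ.open_source.mem_nhds ht)).mdifferentiableAt one_ne_zero

theorem IsParam.mdifferentiableAt_symm {Θ : OpenPartialHomeomorph (Fin k → ℝ) F}
    (h : IsParam I Θ) {z : F} (hz : z ∈ Θ.target) :
    MDifferentiableAt I 𝓘(ℝ, Fin k → ℝ) Θ.symm z :=
  (h.smooth_symm.contMDiffAt (Θ.open_target.mem_nhds hz)).mdifferentiableAt one_ne_zero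

theorem densityField_congr (β : DensityField I F k) {x y : F} (h : x = y) (v : Fin k → E) :
    β x v = β y v := by
  subst h; rfl

/-- The change of variables formula for the coordinate expressions of a density. -/
theorem integral_coordIntegrand_eq {β : DensityField I F k} (hβ : IsTopDensity β)
    {Θ Θ' : OpenPartialHomeomorph (Fin k → ℝ) F} (hΘ : IsParam I Θ) (hΘ' : IsParam I Θ')
    {h : F → ℝ} (hh : ∀ z, h z ≠ 0 → z ∈ Θ.target ∧ z ∈ Θ'.target) :
    ∫ t, coordIntegrand β h Θ t = ∫ t, coordIntegrand β h Θ' t := by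
  set Φ := Θ.trans Θ'.symm with hΦ
  have hs : Φ.source ⊆ Θ.source := by
    rw [hΦ, OpenPartialHomeomorph.trans_source]; exact inter_subset_left
  have ht : Φ.target ⊆ Θ'.source := by
    rw [hΦ, OpenPartialHomeomorph.trans_target]; exact inter_subset_left
  have hs2 : ∀ t ∈ Φ.source, Θ t ∈ Θ'.target := fun t h => by
    rw [hΦ, OpenPartialHomeomorph.trans_source] at h; exact h.2
  have e1 : ∫ t, coordIntegrand β h Θ t =
      ∫ t in Φ.source, h (Θ t) * β (Θ t) (frame I Θ t) := by
    rw [← integral_indicator Φ.open_source.measurableSet]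
    congr 1
    funext t
    by_cases h1 : t ∈ Φ.source
    · rw [indicator_of_mem h1, coordIntegrand, indicator_of_mem (hs h1)]
    · rw [indicator_of_notMem h1]
      by_cases h2 : t ∈ Θ.source
      · rw [coordIntegrand, indicator_of_mem h2]
        have : h (Θ t) = 0 := by
          by_contra h0
          refine h1 ?_
          rw [hΦ, OpenPartialHomeomorph.trans_source]
          exact ⟨h2, (hh _ h0).2⟩
        rw [this, zero_mul]
      · rw [coordIntegrand, indicator_of_notMem h2]
  have e2 : ∫ t, coordIntegrand β h Θ' t =
      ∫ t in Φ.target, h (Θ' t) * β (Θ' t) (frame I Θ' t) := by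
    rw [← integral_indicator Φ.open_target.measurableSet]
    congr 1
    funext t
    by_cases h1 : t ∈ Φ.target
    · rw [indicator_of_mem h1, coordIntegrand, indicator_of_mem (ht h1)]
    · rw [indicator_of_notMem h1]
      by_cases h2 : t ∈ Θ'.source
      · rw [coordIntegrand, indicator_of_mem h2]
        have : h (Θ' t) = 0 := by
          by_contra h0
          refine h1 ?_
          rw [hΦ, OpenPartialHomeomorph.trans_target]
          exact ⟨h2, (hh _ h0).1⟩
        rw [this, zero_mul]
      · rw [coordIntegrand, indicator_of_notMem h2]
  have hΦd : ∀ t ∈ Φ.source,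
      MDifferentiableAt 𝓘(ℝ, Fin k → ℝ) 𝓘(ℝ, Fin k → ℝ) Φ t := fun t h1 =>
    MDifferentiableAt.comp (I := 𝓘(ℝ, Fin k → ℝ)) (I' := I) (I'' := 𝓘(ℝ, Fin k → ℝ)) (M' := F)
      (g := Θ'.symm) (f := Θ) t (hΘ'.mdifferentiableAt_symm (hs2 t h1))
      (hΘ.mdifferentiableAt (hs h1))
  rw [e1, e2, integral_target_eq_integral_abs_det_fderiv_smul volume (f := Φ)
    (f' := fun t => fderiv ℝ Φ t)
    (fun t h1 => (mdifferentiableAt_iff_differentiableAt.1 (hΦd t h1)).hasFDerivAt)]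
  refine setIntegral_congr_fun Φ.open_source.measurableSet fun t h1 => ?_
  have hval : Θ' (Φ t) = Θ t := Θ'.right_inv (hs2 t h1)
  have hder : ∀ v : Fin k → ℝ, (mfderiv 𝓘(ℝ, Fin k → ℝ) I Θ t v : E) =
      mfderiv 𝓘(ℝ, Fin k → ℝ) I Θ' (Φ t) (fderiv ℝ Φ t v) := fun v => by
    have hev : Θ =ᶠ[𝓝 t] (Θ' ∘ Φ) := by
      filter_upwards [Φ.open_source.mem_nhds h1] with s h2
      exact (Θ'.right_inv (hs2 s h2)).symm
    have h3 := hev.mfderiv_eq (I := 𝓘(ℝ, Fin k → ℝ)) (I' := I)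
    have h4 := mfderiv_comp (I := 𝓘(ℝ, Fin k → ℝ)) (I' := 𝓘(ℝ, Fin k → ℝ)) (I'' := I) t
      (hΘ'.mdifferentiableAt (ht (Φ.map_source h1))) (hΦd t h1)
    rw [mfderiv_eq_fderiv] at h4
    have h5 := DFunLike.congr_fun h3 v
    refine h5.trans ?_
    rw [h4]
    rfl
  simp only [smul_eq_mul]
  have hfr : (frame I Θ t : Fin k → E) = fun j => ∑ i,
      (LinearMap.toMatrix' (fderiv ℝ Φ t : (Fin k → ℝ) →ₗ[ℝ] (Fin k → ℝ))) i j •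
        (frame I Θ' (Φ t) i : E) := by
    funext j
    refine (hder _).trans ?_
    have : fderiv ℝ Φ t (Pi.single j 1) = ∑ i,
        (LinearMap.toMatrix' (fderiv ℝ Φ t : (Fin k → ℝ) →ₗ[ℝ] (Fin k → ℝ))) i j •
          (Pi.single i 1 : Fin k → ℝ) := by
      ext i
      simp [LinearMap.toMatrix'_apply, Pi.single_apply]
    let A : (Fin k → ℝ) →L[ℝ] E := mfderiv 𝓘(ℝ, Fin k → ℝ) I Θ' (Φ t)
    have hA : A (fderiv ℝ Φ t (Pi.single j 1)) = ∑ i,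
        (LinearMap.toMatrix' (fderiv ℝ Φ t : (Fin k → ℝ) →ₗ[ℝ] (Fin k → ℝ))) i j •
          A (Pi.single i 1 : Fin k → ℝ) := by
      rw [this, map_sum]
      simp only [map_smul]
    exact hA
  have hdet : (fderiv ℝ Φ t).det =
      (LinearMap.toMatrix' (fderiv ℝ Φ t : (Fin k → ℝ) →ₗ[ℝ] (Fin k → ℝ))).det := by
    rw [LinearMap.det_toMatrix']
  have key : β (Θ t) (frame I Θ t) = |(fderiv ℝ Φ t).det| * β (Θ' (Φ t)) (frame I Θ' (Φ t)) := by
    rw [hdet, ← hβ]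
    refine (densityField_congr β hval.symm (frame I Θ t)).trans ?_
    exact congrArg (β (Θ' (Φ t))) hfr
  rw [key, hval]; ring

/-- A finite family of parametrizations and a partition of unity subordinate to it. -/
structure ParamPartition (I : ModelWithCorners ℝ E H) (F : Type*) [TopologicalSpace F]
    [ChartedSpace H F] (k : ℕ) (ι : Type*) [Fintype ι] where
  Θ : ι → OpenPartialHomeomorph (Fin k → ℝ) F
  isParam : ∀ i, IsParam I (Θ i)
  h : ι → F → ℝ
  continuous : ∀ i, Continuous (h i)
  nonneg : ∀ i z, 0 ≤ h i z
  subordinate : ∀ i, tsupport (h i) ⊆ (Θ i).target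
  sum_eq : ∀ z, ∑ i, h i z = 1

/-- The integral of a density in terms of a partition of unity. -/
def ParamPartition.integral {ι : Type*} [Fintype ι] (P : ParamPartition I F k ι)
    (β : DensityField I F k) : ℝ :=
  ∑ i, ∫ t, coordIntegrand β (P.h i) (P.Θ i) t

/-- Continuity of the coordinate expressions of a density. -/
def IsContDensity (β : DensityField I F k) : Prop :=
  ∀ Θ : OpenPartialHomeomorph (Fin k → ℝ) F, IsParam I Θ →
    ContinuousOn (fun t => β (Θ t) (frame I Θ t)) Θ.source

variable [CompactSpace F]

theorem isCompact_symm_image (Θ : OpenPartialHomeomorph (Fin k → ℝ) F) {h : F → ℝ}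
    (hs : tsupport h ⊆ Θ.target) : IsCompact (Θ.symm '' tsupport h) :=
  (isClosed_tsupport h).isCompact.image_of_continuousOn (Θ.continuousOn_symm.mono hs)

theorem coordIntegrand_eq_zero (Θ : OpenPartialHomeomorph (Fin k → ℝ) F) {h : F → ℝ}
    (β : DensityField I F k) {t : Fin k → ℝ}
    (ht : t ∉ Θ.symm '' tsupport h) : coordIntegrand β h Θ t = 0 := by
  by_cases h1 : t ∈ Θ.source
  · rw [coordIntegrand, indicator_of_mem h1]
    have : h (Θ t) = 0 := image_eq_zero_of_notMem_tsupport fun h2 =>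
      ht ⟨Θ t, h2, Θ.left_inv h1⟩
    rw [this, zero_mul]
  · rw [coordIntegrand, indicator_of_notMem h1]

theorem continuousOn_coordIntegrand {P : Type*} [TopologicalSpace P] {s : Set P}
    {Θ : OpenPartialHomeomorph (Fin k → ℝ) F} {h : F → ℝ} (hc : Continuous h)
    (hs : tsupport h ⊆ Θ.target) {β : P → DensityField I F k}
    (hβ : ContinuousOn (fun z : P × (Fin k → ℝ) => β z.1 (Θ z.2) (frame I Θ z.2))
      (s ×ˢ Θ.source)) :
    ContinuousOn (fun z : P × (Fin k → ℝ) => coordIntegrand (β z.1) h Θ z.2) (s ×ˢ univ) := by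
  have hK := isCompact_symm_image Θ hs
  rintro ⟨p, t⟩ ⟨hp, -⟩
  by_cases ht : t ∈ Θ.source
  · have h1 : ContinuousOn (fun z : P × (Fin k → ℝ) => coordIntegrand (β z.1) h Θ z.2)
        (s ×ˢ Θ.source) := by
      have : ContinuousOn (fun z : P × (Fin k → ℝ) => h (Θ z.2) * β z.1 (Θ z.2) (frame I Θ z.2))
          (s ×ˢ Θ.source) := by
        refine ContinuousOn.mul ?_ hβ
        exact hc.comp_continuousOn (Θ.continuousOn.comp continuousOn_snd fun z hz => hz.2)
      refine this.congr fun z hz => ?_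
      simp only [coordIntegrand, indicator_of_mem hz.2]
    refine (h1 (p, t) ⟨hp, ht⟩).mono_of_mem_nhdsWithin ?_
    exact nhdsWithin_prod self_mem_nhdsWithin
      (mem_nhdsWithin_of_mem_nhds (Θ.open_source.mem_nhds ht))
  · have ht' : t ∈ (Θ.symm '' tsupport h)ᶜ := by
      rintro ⟨z, hz, rfl⟩
      exact ht (Θ.map_target (hs hz))
    have : (fun z : P × (Fin k → ℝ) => coordIntegrand (β z.1) h Θ z.2) =ᶠ[𝓝 (p, t)] fun _ => 0 := by
      filter_upwards [continuous_snd.continuousAt.preimage_mem_nhds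
        (hK.isClosed.isOpen_compl.mem_nhds ht')] with z hz
      exact coordIntegrand_eq_zero Θ _ hz
    exact (continuousAt_const.congr this.symm).continuousWithinAt

theorem continuousOn_integral_coordIntegrand {P : Type*} [TopologicalSpace P] {s : Set P}
    {Θ : OpenPartialHomeomorph (Fin k → ℝ) F} {h : F → ℝ} (hc : Continuous h)
    (hs : tsupport h ⊆ Θ.target) {β : P → DensityField I F k}
    (hβ : ContinuousOn (fun z : P × (Fin k → ℝ) => β z.1 (Θ z.2) (frame I Θ z.2))
      (s ×ˢ Θ.source)) :
    ContinuousOn (fun p => ∫ t, coordIntegrand (β p) h Θ t) s :=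
  continuousOn_integral_of_compact_support (isCompact_symm_image Θ hs)
    (continuousOn_coordIntegrand hc hs hβ) fun _ _ _ ht => coordIntegrand_eq_zero Θ _ ht

theorem continuous_coordIntegrand {Θ : OpenPartialHomeomorph (Fin k → ℝ) F} {h : F → ℝ}
    (hc : Continuous h) (hs : tsupport h ⊆ Θ.target) {β : DensityField I F k}
    (hβ : ContinuousOn (fun t => β (Θ t) (frame I Θ t)) Θ.source) :
    Continuous (coordIntegrand β h Θ) := by
  have := continuousOn_coordIntegrand (P := Unit) (s := univ) hc hs (β := fun _ => β)
    (hβ.comp continuousOn_snd fun z hz => hz.2)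
  rw [univ_prod_univ, continuousOn_univ] at this
  exact this.comp (Continuous.prodMk (continuous_const (y := ())) continuous_id)

theorem integrable_coordIntegrand {Θ : OpenPartialHomeomorph (Fin k → ℝ) F} {h : F → ℝ}
    (hc : Continuous h) (hs : tsupport h ⊆ Θ.target) {β : DensityField I F k}
    (hβ : ContinuousOn (fun t => β (Θ t) (frame I Θ t)) Θ.source) :
    Integrable (coordIntegrand β h Θ) :=
  (continuous_coordIntegrand hc hs hβ).integrable_of_hasCompactSupport
    (HasCompactSupport.intro (isCompact_symm_image Θ hs) fun _ ht => coordIntegrand_eq_zero Θ _ ht)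

theorem coordIntegrand_sum {ι : Type*} [Fintype ι] (β : DensityField I F k) (h : F → ℝ)
    (g : ι → F → ℝ) (hg : ∀ z, ∑ i, g i z = 1) (Θ : OpenPartialHomeomorph (Fin k → ℝ) F)
    (t : Fin k → ℝ) :
    coordIntegrand β h Θ t = ∑ i, coordIntegrand β (fun z => h z * g i z) Θ t := by
  by_cases ht : t ∈ Θ.source
  · simp only [coordIntegrand, indicator_of_mem ht]
    rw [← Finset.sum_mul, ← Finset.mul_sum, hg, mul_one]
  · simp [coordIntegrand, indicator_of_notMem ht]

theorem ParamPartition.integral_eq_sum {β : DensityField I F k} (hβc : IsContDensity β)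
    {ι ι' : Type*} [Fintype ι] [Fintype ι'] (Q : ParamPartition I F k ι)
    (Q' : ParamPartition I F k ι') : Q.integral β =
      ∑ i, ∑ j, ∫ t, coordIntegrand β (fun z => Q.h i z * Q'.h j z) (Q.Θ i) t := by
  refine Finset.sum_congr rfl fun i _ => ?_
  rw [← integral_finsetSum]
  · congr 1
    funext t
    exact coordIntegrand_sum β _ _ Q'.sum_eq _ t
  · intro j _
    exact integrable_coordIntegrand ((Q.continuous i).mul (Q'.continuous j))
      ((tsupport_mul_subset_left).trans (Q.subordinate i)) (hβc _ (Q.isParam i))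

/-- The integral of a density does not depend on the partition. -/
theorem ParamPartition.integral_eq {β : DensityField I F k} (hβ : IsTopDensity β)
    (hβc : IsContDensity β) {ι ι' : Type*} [Fintype ι] [Fintype ι']
    (P : ParamPartition I F k ι) (P' : ParamPartition I F k ι') : P.integral β = P'.integral β := by
  rw [P.integral_eq_sum hβc P', P'.integral_eq_sum hβc P, Finset.sum_comm]
  refine Finset.sum_congr rfl fun j _ => Finset.sum_congr rfl fun i _ => ?_
  rw [integral_coordIntegrand_eq hβ (P.isParam i) (P'.isParam j)]
  · simp only [mul_comm]
  · intro z hz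
    exact ⟨P.subordinate i (subset_tsupport _ (left_ne_zero_of_mul hz)),
      P'.subordinate j (subset_tsupport _ (right_ne_zero_of_mul hz))⟩

end Params

section Charts

variable {E : Type*} [NormedAddCommGroup E] [NormedSpace ℝ E] [FiniteDimensional ℝ E]
  {H : Type*} [TopologicalSpace H] (I : ModelWithCorners ℝ E H) [I.Boundaryless]
  {F : Type*} [TopologicalSpace F] [ChartedSpace H F]

variable (E) in
/-- The linear coordinates on `E`. -/
def linCoord : (Fin (finrank ℝ E) → ℝ) ≃L[ℝ] E :=
  (finBasis ℝ E).equivFun.symm.toContinuousLinearEquiv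

theorem linCoord_apply (t : Fin (finrank ℝ E) → ℝ) :
    linCoord E t = ∑ j, t j • finBasis ℝ E j := by
  simp [linCoord, Basis.equivFun_symm_apply]

/-- The inverse of a chart in linear coordinates. -/
def chartParam (c : F) : OpenPartialHomeomorph (Fin (finrank ℝ E) → ℝ) F :=
  ((linCoord E).toHomeomorph.trans I.toHomeomorph.symm).transOpenPartialHomeomorph
    (chartAt H c).symm

theorem chartParam_source (c : F) :
    (chartParam I c).source = linCoord E ⁻¹' (extChartAt I c).target := by
  ext t
  rw [mem_preimage, extChartAt_target, I.range_eq_univ, inter_univ]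
  rfl

theorem chartParam_target (c : F) : (chartParam I c).target = (chartAt H c).source := by
  rw [chartParam, Homeomorph.transOpenPartialHomeomorph_target, OpenPartialHomeomorph.symm_target]

variable [IsManifold I 1 F]

theorem isParam_chartParam (c : F) : IsParam I (chartParam I c) where
  smooth := by
    have h1 := contMDiffOn_extChartAt_symm (I := I) (n := 1) c
    rw [chartParam_source]
    exact h1.comp ((linCoord E).contDiff.contMDiff.contMDiffOn) fun t ht => ht
  smooth_symm := by
    have h1 := contMDiffOn_extChartAt (I := I) (n := 1) (x := c)
    rw [chartParam_target]
    exact ((linCoord E).symm.contDiff.contMDiff.comp_contMDiffOn h1)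

theorem frame_chartParam (c : F) {t : Fin (finrank ℝ E) → ℝ} (ht : t ∈ (chartParam I c).source)
    (i : Fin (finrank ℝ E)) : frame I (chartParam I c) t i =
      mfderiv 𝓘(ℝ, E) I (extChartAt I c).symm (linCoord E t) (finBasis ℝ E i) := by
  rw [chartParam_source] at ht
  have h1 : MDifferentiableAt 𝓘(ℝ, E) I (extChartAt I c).symm (linCoord E t) := by
    have := (contMDiffOn_extChartAt_symm (I := I) (n := 1) c).contMDiffAt
      ((isOpen_extChartAt_target c).mem_nhds ht)
    exact this.mdifferentiableAt one_ne_zero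
  have h2 : MDifferentiableAt 𝓘(ℝ, Fin (finrank ℝ E) → ℝ) 𝓘(ℝ, E) (linCoord E) t :=
    (linCoord E).differentiableAt.mdifferentiableAt
  have h3 := mfderiv_comp_apply (I := 𝓘(ℝ, Fin (finrank ℝ E) → ℝ)) (I' := 𝓘(ℝ, E)) (I'' := I)
    t h1 h2 (Pi.single i 1 : Fin (finrank ℝ E) → ℝ)
  refine h3.trans ?_
  congr 1
  rw [mfderiv_eq_fderiv]
  have h4 : fderiv ℝ (linCoord E) t = (linCoord E : (Fin (finrank ℝ E) → ℝ) →L[ℝ] E) :=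
    (linCoord E).hasFDerivAt.fderiv
  have : fderiv ℝ (linCoord E) t (Pi.single i 1) = finBasis ℝ E i := by
    rw [h4, ContinuousLinearEquiv.coe_coe, linCoord_apply]
    simp [Pi.single_apply]
  exact this

variable [T2Space F] [CompactSpace F]

theorem finite_chartPartition_ne_zero :
    {c : F | Function.support (chartPartition H F c) ≠ ∅}.Finite := by
  have := (chartPartition H F).locallyFinite.finite_nonempty_of_compact
  simpa only [nonempty_iff_ne_empty] using this

variable (H F) in
/-- The charts that occur in the partition of unity. -/
abbrev ChartIndex : Type _ := {c : F // Function.support (chartPartition H F c) ≠ ∅}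

instance : Fintype (ChartIndex H F) := (finite_chartPartition_ne_zero (H := H) (F := F)).fintype

variable (F) in
/-- The partition given by the charts. -/
def chartParamPartition : ParamPartition I F (finrank ℝ E) (ChartIndex H F) where
  Θ c := chartParam I c.1
  isParam c := isParam_chartParam I c.1
  h c := chartPartition H F c.1
  continuous c := (chartPartition H F c.1).continuous
  nonneg c z := (chartPartition H F).nonneg c.1 z
  subordinate c := by
    rw [chartParam_target]
    exact (exists_chartPartition H F).choose_spec c.1
  sum_eq z := by
    have h1 := (chartPartition H F).sum_eq_one (mem_univ z)
    rw [finsum_eq_sum_of_support_subset (s := (finite_chartPartition_ne_zero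
      (H := H) (F := F)).toFinset)] at h1
    · rw [← h1]
      symm
      refine Finset.sum_subtype _ (fun c => ?_) (fun c => chartPartition H F c z)
      simp
    · intro c hc
      simp only [Finite.coe_toFinset, Set.mem_ofPred_eq]
      exact (nonempty_iff_ne_empty.1 ⟨z, hc⟩)

theorem densityIntegral_eq (β : DensityField I F (finrank ℝ E)) :
    densityIntegral I β = (chartParamPartition I F).integral β := by
  have hterm : ∀ c : F, ∫ t in {t : Fin (finrank ℝ E) → ℝ |
      ∑ j, t j • finBasis ℝ E j ∈ (extChartAt I c).target},
    chartPartition H F c ((extChartAt I c).symm (∑ j, t j • finBasis ℝ E j)) *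
      β ((extChartAt I c).symm (∑ j, t j • finBasis ℝ E j))
        (fun i => mfderiv 𝓘(ℝ, E) I (extChartAt I c).symm (∑ j, t j • finBasis ℝ E j)
          (finBasis ℝ E i)) =
      ∫ t, coordIntegrand β (chartPartition H F c) (chartParam I c) t := by
    intro c
    have hm : MeasurableSet (chartParam I c).source := (chartParam I c).open_source.measurableSet
    have hset : {t : Fin (finrank ℝ E) → ℝ |
        ∑ j, t j • finBasis ℝ E j ∈ (extChartAt I c).target} = (chartParam I c).source := by
      rw [chartParam_source]
      ext t
      rw [mem_preimage, linCoord_apply]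
      rfl
    unfold coordIntegrand
    rw [hset, integral_indicator hm]
    refine setIntegral_congr_fun hm fun t ht => ?_
    have hfr : frame I (chartParam I c) t = fun i =>
      mfderiv 𝓘(ℝ, E) I (extChartAt I c).symm (linCoord E t) (finBasis ℝ E i) :=
        funext fun i => frame_chartParam I c ht i
    have : ∀ u : E, u = linCoord E t →
        chartPartition H F c ((extChartAt I c).symm u) * β ((extChartAt I c).symm u)
          (fun i => mfderiv 𝓘(ℝ, E) I (extChartAt I c).symm u (finBasis ℝ E i)) =
        chartPartition H F c (chartParam I c t) *
          β (chartParam I c t) (frame I (chartParam I c) t) := by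
      rintro _ rfl
      rw [hfr]
      rfl
    exact this _ (linCoord_apply t).symm
  unfold densityIntegral
  simp only [hterm]
  rw [finsum_eq_sum_of_support_subset (s := (finite_chartPartition_ne_zero
      (H := H) (F := F)).toFinset)]
  · refine Finset.sum_subtype _ (fun c => ?_)
      (fun c => ∫ t, coordIntegrand β (chartPartition H F c) (chartParam I c) t)
    simp
  · intro c hc
    simp only [Finite.coe_toFinset, Set.mem_ofPred_eq]
    intro h0
    refine hc ?_
    have : ∀ z, chartPartition H F c z = 0 := fun z => by
      by_contra hz
      exact (h0 ▸ (hz : z ∈ Function.support (chartPartition H F c)) : z ∈ (∅ : Set F))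
    simp [coordIntegrand, this]

end Charts

section Diffeo

variable {E : Type*} [NormedAddCommGroup E] [NormedSpace ℝ E] [FiniteDimensional ℝ E]
  {H : Type*} [TopologicalSpace H] {I : ModelWithCorners ℝ E H}
  {F : Type*} [TopologicalSpace F] [ChartedSpace H F] {k : ℕ}

theorem IsParam.transHomeomorph {Θ : OpenPartialHomeomorph (Fin k → ℝ) F} (hΘ : IsParam I Θ)
    {g : F ≃ₜ F} (hg : ContMDiff I I 1 g) (hg' : ContMDiff I I 1 g.symm) :
    IsParam I (Θ.transHomeomorph g) where
  smooth := hg.comp_contMDiffOn hΘ.smooth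
  smooth_symm := hΘ.smooth_symm.comp hg'.contMDiffOn fun _ hz => hz

/-- The image of a partition under a diffeomorphism. -/
def ParamPartition.map {ι : Type*} [Fintype ι] (P : ParamPartition I F k ι)
    {g : F ≃ₜ F} (hg : ContMDiff I I 1 g) (hg' : ContMDiff I I 1 g.symm) :
    ParamPartition I F k ι where
  Θ i := (P.Θ i).transHomeomorph g
  isParam i := (P.isParam i).transHomeomorph hg hg'
  h i := P.h i ∘ g.symm
  continuous i := (P.continuous i).comp g.symm.continuous
  nonneg i z := P.nonneg i _
  subordinate i := by
    rw [tsupport_comp_eq_preimage]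
    exact preimage_mono (P.subordinate i)
  sum_eq z := P.sum_eq _

theorem ParamPartition.integral_map {ι : Type*} [Fintype ι] (P : ParamPartition I F k ι)
    {g : F ≃ₜ F} (hg : ContMDiff I I 1 g) (hg' : ContMDiff I I 1 g.symm)
    (β : DensityField I F k) : (P.map hg hg').integral β = P.integral (pullback g β) := by
  refine Finset.sum_congr rfl fun i _ => ?_
  congr 1
  funext t
  change ((P.Θ i).source.indicator _ t : ℝ) = (P.Θ i).source.indicator _ t
  by_cases ht : t ∈ (P.Θ i).source
  · rw [indicator_of_mem ht, indicator_of_mem ht]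
    have h1 : frame I ((P.Θ i).transHomeomorph g) t = fun j =>
        (mfderiv I I g (P.Θ i t) (frame I (P.Θ i) t j)) := by
      funext j
      exact mfderiv_comp_apply (I := 𝓘(ℝ, Fin k → ℝ)) (I' := I) (I'' := I) t
        (hg.mdifferentiable one_ne_zero _) ((P.isParam i).mdifferentiableAt ht) _
    have h2 : (P.map hg hg').h i ((P.map hg hg').Θ i t) = P.h i (P.Θ i t) :=
      congrArg (P.h i) (g.symm_apply_apply _)
    rw [h2]
    refine congrArg (P.h i (P.Θ i t) * ·) ?_
    exact congrArg (β (g (P.Θ i t))) h1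
  · rw [indicator_of_notMem ht, indicator_of_notMem ht]

theorem densityIntegral_pullback [I.Boundaryless] [IsManifold I 1 F] [T2Space F] [CompactSpace F]
    {β : DensityField I F (finrank ℝ E)}
    (hβ : IsTopDensity β) (hβc : IsContDensity β) {g : F ≃ₜ F} (hg : ContMDiff I I 1 g)
    (hg' : ContMDiff I I 1 g.symm) :
    densityIntegral I (pullback g β) = densityIntegral I β := by
  rw [densityIntegral_eq, densityIntegral_eq, ← (chartParamPartition I F).integral_map hg hg',
    ParamPartition.integral_eq hβ hβc _ (chartParamPartition I F)]

end Diffeo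

section Prod

variable {k₁ k₂ k : ℕ} (σ : Fin k₁ ⊕ Fin k₂ ≃ Fin k)

/-- The decomposition of `ℝ^k` that belongs to a decomposition of the indices. -/
def splitCoord : (Fin k → ℝ) ≃L[ℝ] (Fin k₁ → ℝ) × (Fin k₂ → ℝ) :=
  ((LinearEquiv.funCongrLeft ℝ ℝ σ).trans
    (LinearEquiv.sumArrowLequivProdArrow (Fin k₁) (Fin k₂) ℝ ℝ)).toContinuousLinearEquiv

theorem splitCoord_apply (t : Fin k → ℝ) :
    splitCoord σ t = (fun i => t (σ (Sum.inl i)), fun j => t (σ (Sum.inr j))) := rfl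

theorem splitCoord_single_inl (i : Fin k₁) :
    splitCoord σ (Pi.single (σ (Sum.inl i)) 1) = (Pi.single i 1, 0) := by
  rw [splitCoord_apply]
  ext j <;> simp [Pi.single_apply]

theorem splitCoord_single_inr (i : Fin k₂) :
    splitCoord σ (Pi.single (σ (Sum.inr i)) 1) = (0, Pi.single i 1) := by
  rw [splitCoord_apply]
  ext j <;> simp [Pi.single_apply]

theorem measurePreserving_splitCoord_symm : MeasurePreserving (splitCoord σ).symm := by
  have h1 := volume_measurePreserving_sumPiEquivProdPi_symm (fun _ : Fin k₁ ⊕ Fin k₂ => ℝ)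
  have h2 := volume_measurePreserving_piCongrLeft (fun _ : Fin k => ℝ) σ
  suffices h : ((splitCoord σ).symm : _ → Fin k → ℝ) =
      MeasurableEquiv.piCongrLeft (fun _ => ℝ) σ ∘
        (MeasurableEquiv.sumPiEquivProdPi fun _ => ℝ).symm by
    rw [h]; exact h2.comp h1
  funext z
  rw [ContinuousLinearEquiv.symm_apply_eq, splitCoord_apply]
  refine Prod.ext (funext fun i => ?_) (funext fun i => ?_) <;>
  · simp only [Function.comp_apply]
    rw [MeasurableEquiv.piCongrLeft, MeasurableEquiv.coe_mk, Equiv.piCongrLeft_apply_apply]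
    simp [MeasurableEquiv.coe_sumPiEquivProdPi_symm]

variable {E₁ : Type*} [NormedAddCommGroup E₁] [NormedSpace ℝ E₁]
  {H₁ : Type*} [TopologicalSpace H₁] {I₁ : ModelWithCorners ℝ E₁ H₁}
  {F₁ : Type*} [TopologicalSpace F₁] [ChartedSpace H₁ F₁]
  {E₂ : Type*} [NormedAddCommGroup E₂] [NormedSpace ℝ E₂]
  {H₂ : Type*} [TopologicalSpace H₂] {I₂ : ModelWithCorners ℝ E₂ H₂}
  {F₂ : Type*} [TopologicalSpace F₂] [ChartedSpace H₂ F₂]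
  {Θ₁ : OpenPartialHomeomorph (Fin k₁ → ℝ) F₁} {Θ₂ : OpenPartialHomeomorph (Fin k₂ → ℝ) F₂}

/-- The product of two parametrizations. -/
def prodParam (Θ₁ : OpenPartialHomeomorph (Fin k₁ → ℝ) F₁)
    (Θ₂ : OpenPartialHomeomorph (Fin k₂ → ℝ) F₂) :
    OpenPartialHomeomorph (Fin k → ℝ) (F₁ × F₂) :=
  (splitCoord σ).toHomeomorph.transOpenPartialHomeomorph (Θ₁.prod Θ₂)

theorem prodParam_apply (t : Fin k → ℝ) :
    prodParam σ Θ₁ Θ₂ t = (Θ₁ (splitCoord σ t).1, Θ₂ (splitCoord σ t).2) := rfl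

theorem mem_prodParam_source {t : Fin k → ℝ} : t ∈ (prodParam σ Θ₁ Θ₂).source ↔
    (splitCoord σ t).1 ∈ Θ₁.source ∧ (splitCoord σ t).2 ∈ Θ₂.source := Iff.rfl

theorem prodParam_target : (prodParam σ Θ₁ Θ₂).target = Θ₁.target ×ˢ Θ₂.target := rfl

theorem isParam_prodParam (h₁ : IsParam I₁ Θ₁) (h₂ : IsParam I₂ Θ₂) :
    IsParam (I₁.prod I₂) (prodParam σ Θ₁ Θ₂) where
  smooth := by
    have a1 : ContMDiff 𝓘(ℝ, Fin k → ℝ) 𝓘(ℝ, Fin k₁ → ℝ) 1 fun t => (splitCoord σ t).1 :=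
      (contDiff_fst.comp (splitCoord σ).contDiff).contMDiff
    have a2 : ContMDiff 𝓘(ℝ, Fin k → ℝ) 𝓘(ℝ, Fin k₂ → ℝ) 1 fun t => (splitCoord σ t).2 :=
      (contDiff_snd.comp (splitCoord σ).contDiff).contMDiff
    exact (h₁.smooth.comp a1.contMDiffOn fun t ht => ht.1).prodMk
      (h₂.smooth.comp a2.contMDiffOn fun t ht => ht.2)
  smooth_symm := by
    have a1 : ContMDiffOn (I₁.prod I₂) 𝓘(ℝ, Fin k₁ → ℝ) 1 (fun z : F₁ × F₂ => Θ₁.symm z.1)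
        (prodParam σ Θ₁ Θ₂).target :=
      h₁.smooth_symm.comp contMDiffOn_fst fun t ht => ht.1
    have a2 : ContMDiffOn (I₁.prod I₂) 𝓘(ℝ, Fin k₂ → ℝ) 1 (fun z : F₁ × F₂ => Θ₂.symm z.2)
        (prodParam σ Θ₁ Θ₂).target :=
      h₂.smooth_symm.comp contMDiffOn_snd fun t ht => ht.2
    have a3 : ContMDiff 𝓘(ℝ, (Fin k₁ → ℝ) × (Fin k₂ → ℝ)) 𝓘(ℝ, Fin k → ℝ) 1
      (splitCoord σ).symm := (splitCoord σ).symm.contDiff.contMDiff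
    exact a3.comp_contMDiffOn (a1.prodMk_space a2)

theorem mfderiv_prodParam (h₁ : IsParam I₁ Θ₁) (h₂ : IsParam I₂ Θ₂) {t : Fin k → ℝ}
    (ht : t ∈ (prodParam σ Θ₁ Θ₂).source) (v : Fin k → ℝ) :
    (mfderiv 𝓘(ℝ, Fin k → ℝ) (I₁.prod I₂) (prodParam σ Θ₁ Θ₂) t v : E₁ × E₂) =
      (mfderiv 𝓘(ℝ, Fin k₁ → ℝ) I₁ Θ₁ (splitCoord σ t).1 (splitCoord σ v).1,
        mfderiv 𝓘(ℝ, Fin k₂ → ℝ) I₂ Θ₂ (splitCoord σ t).2 (splitCoord σ v).2) := by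
  let A1 : (Fin k → ℝ) →L[ℝ] (Fin k₁ → ℝ) := (ContinuousLinearMap.fst ℝ _ _).comp
    (splitCoord σ : (Fin k → ℝ) →L[ℝ] (Fin k₁ → ℝ) × (Fin k₂ → ℝ))
  let A2 : (Fin k → ℝ) →L[ℝ] (Fin k₂ → ℝ) := (ContinuousLinearMap.snd ℝ _ _).comp
    (splitCoord σ : (Fin k → ℝ) →L[ℝ] (Fin k₁ → ℝ) × (Fin k₂ → ℝ))
  have b1 : HasMFDerivAt 𝓘(ℝ, Fin k → ℝ) 𝓘(ℝ, Fin k₁ → ℝ) (fun t => (splitCoord σ t).1) t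
      A1 := (A1.hasFDerivAt (x := t)).hasMFDerivAt
  have b2 : HasMFDerivAt 𝓘(ℝ, Fin k → ℝ) 𝓘(ℝ, Fin k₂ → ℝ) (fun t => (splitCoord σ t).2) t
      A2 := (A2.hasFDerivAt (x := t)).hasMFDerivAt
  have c1 := HasMFDerivAt.comp (I := 𝓘(ℝ, Fin k → ℝ)) (I' := 𝓘(ℝ, Fin k₁ → ℝ)) (I'' := I₁)
    t (h₁.mdifferentiableAt ht.1).hasMFDerivAt b1
  have c2 := HasMFDerivAt.comp (I := 𝓘(ℝ, Fin k → ℝ)) (I' := 𝓘(ℝ, Fin k₂ → ℝ)) (I'' := I₂)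
    t (h₂.mdifferentiableAt ht.2).hasMFDerivAt b2
  have d := (c1.prodMk c2).mfderiv
  exact DFunLike.congr_fun d v

theorem frame_prodParam_inl (h₁ : IsParam I₁ Θ₁) (h₂ : IsParam I₂ Θ₂) {t : Fin k → ℝ}
    (ht : t ∈ (prodParam σ Θ₁ Θ₂).source) (i : Fin k₁) :
    (frame (I₁.prod I₂) (prodParam σ Θ₁ Θ₂) t (σ (Sum.inl i)) : E₁ × E₂) =
      (frame I₁ Θ₁ (splitCoord σ t).1 i, 0) := by
  refine (mfderiv_prodParam σ h₁ h₂ ht _).trans ?_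
  rw [splitCoord_single_inl]
  exact Prod.ext rfl (map_zero (mfderiv 𝓘(ℝ, Fin k₂ → ℝ) I₂ Θ₂ (splitCoord σ t).2))

theorem frame_prodParam_inr (h₁ : IsParam I₁ Θ₁) (h₂ : IsParam I₂ Θ₂) {t : Fin k → ℝ}
    (ht : t ∈ (prodParam σ Θ₁ Θ₂).source) (i : Fin k₂) :
    (frame (I₁.prod I₂) (prodParam σ Θ₁ Θ₂) t (σ (Sum.inr i)) : E₁ × E₂) =
      (0, frame I₂ Θ₂ (splitCoord σ t).2 i) := by
  refine (mfderiv_prodParam σ h₁ h₂ ht _).trans ?_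
  rw [splitCoord_single_inr]
  exact Prod.ext (map_zero (mfderiv 𝓘(ℝ, Fin k₁ → ℝ) I₁ Θ₁ (splitCoord σ t).1)) rfl

/-- The product of two partitions. -/
def ParamPartition.prod {ι₁ ι₂ : Type*} [Fintype ι₁] [Fintype ι₂] (P₁ : ParamPartition I₁ F₁ k₁ ι₁)
    (P₂ : ParamPartition I₂ F₂ k₂ ι₂) : ParamPartition (I₁.prod I₂) (F₁ × F₂) k (ι₁ × ι₂) where
  Θ i := prodParam σ (P₁.Θ i.1) (P₂.Θ i.2)
  isParam i := isParam_prodParam σ (P₁.isParam i.1) (P₂.isParam i.2)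
  h i z := P₁.h i.1 z.1 * P₂.h i.2 z.2
  continuous i := ((P₁.continuous i.1).comp continuous_fst).mul
    ((P₂.continuous i.2).comp continuous_snd)
  nonneg i z := mul_nonneg (P₁.nonneg _ _) (P₂.nonneg _ _)
  subordinate i := by
    rw [prodParam_target]
    intro z hz
    refine ⟨P₁.subordinate i.1 ?_, P₂.subordinate i.2 ?_⟩
    · exact tsupport_comp_subset_preimage (P₁.h i.1) continuous_fst
        (tsupport_mul_subset_left hz)
    · exact tsupport_comp_subset_preimage (P₂.h i.2) continuous_snd
        (tsupport_mul_subset_right hz)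
  sum_eq z := by
    rw [Fintype.sum_prod_type]
    simp only [← Finset.mul_sum, P₂.sum_eq, mul_one, P₁.sum_eq]

end Prod

section Indexed

variable {ι A ι' A' : Type*} [Fintype ι] [Fintype ι'] [MeasurableSpace A] [MeasurableSpace A']

/-- The measure on the disjoint union of copies of a measure space. -/
def indexed (ι : Type*) [Fintype ι] [MeasurableSpace ι] (μ : Measure A) : Measure (ι × A) :=
  Measure.sum fun i => μ.map (Prod.mk i)

variable [MeasurableSpace ι] [MeasurableSpace ι'] [MeasurableSingletonClass ι]
  [MeasurableSingletonClass ι'] {μ : Measure A} {μ' : Measure A'}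

instance [SFinite μ] : SFinite (indexed ι μ) := by
  unfold indexed; infer_instance

theorem measurableEmbedding_prodMk (i : ι) : MeasurableEmbedding (Prod.mk i : A → ι × A) where
  injective := Prod.mk_right_injective i
  measurable := measurable_prodMk_left
  measurableSet_image' s hs := by
    have : Prod.mk i '' s = {i} ×ˢ s := by
      ext ⟨j, a⟩
      simp only [mem_image, Prod.mk.injEq, mem_prod, mem_singleton_iff]
      constructor
      · rintro ⟨b, hb, rfl, rfl⟩; exact ⟨rfl, hb⟩
      · rintro ⟨rfl, h⟩; exact ⟨a, h, rfl, rfl⟩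
    rw [this]
    exact (measurableSet_singleton i).prod hs

theorem integrable_indexed {f : ι × A → ℝ} (hf : ∀ i, Integrable (fun a => f (i, a)) μ) :
    Integrable f (indexed ι μ) := by
  rw [indexed, Measure.sum_fintype, integrable_finsetSum_measure]
  intro i _
  rw [(measurableEmbedding_prodMk i).integrable_map_iff]
  exact hf i

theorem integral_indexed {f : ι × A → ℝ} (hf : ∀ i, Integrable (fun a => f (i, a)) μ) :
    ∫ z, f z ∂indexed ι μ = ∑ i, ∫ a, f (i, a) ∂μ := by
  rw [indexed, Measure.sum_fintype, integral_finsetSum_measure]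
  · exact Finset.sum_congr rfl fun i _ => (measurableEmbedding_prodMk i).integral_map f
  · intro i _
    rw [(measurableEmbedding_prodMk i).integrable_map_iff]
    exact hf i

theorem indexed_prod_indexed [SFinite μ] [SFinite μ'] :
    (indexed ι μ).prod (indexed ι' μ') = ∑ i : ι × ι',
      (μ.prod μ').map (Prod.map (Prod.mk i.1) (Prod.mk i.2)) := by
  rw [indexed, indexed, Measure.prod_sum, Measure.sum_fintype]
  refine Finset.sum_congr rfl fun i _ => ?_
  exact Measure.map_prod_map _ _ measurable_prodMk_left measurable_prodMk_left

theorem integral_indexed_prod [SFinite μ] [SFinite μ'] {f : (ι × A) × (ι' × A') → ℝ}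
    (hf : ∀ i j, Integrable (fun z => f ((i, z.1), (j, z.2))) (μ.prod μ')) :
    ∫ z, f z ∂(indexed ι μ).prod (indexed ι' μ') =
      ∑ i : ι × ι', ∫ z, f ((i.1, z.1), (i.2, z.2)) ∂μ.prod μ' := by
  have he : ∀ i : ι × ι', MeasurableEmbedding
      (Prod.map (Prod.mk i.1) (Prod.mk i.2) : A × A' → (ι × A) × (ι' × A')) := fun i =>
    (measurableEmbedding_prodMk i.1).prodMap (measurableEmbedding_prodMk i.2)
  rw [indexed_prod_indexed, integral_finsetSum_measure]
  · exact Finset.sum_congr rfl fun i _ => (he i).integral_map f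
  · intro i _
    rw [(he i).integrable_map_iff]
    exact hf i.1 i.2

end Indexed

section LinearComb

variable {V W : Type*} [NormedAddCommGroup V] [NormedSpace ℝ V] [FiniteDimensional ℝ V] {m l k : ℕ}
  [NormedAddCommGroup W] [NormedSpace ℝ W] [FiniteDimensional ℝ W]

theorem IsDec.append_linear_comb {δ : (Fin m → V) → ℝ} (hδ : IsDec δ) (h : l + k = m)
    (C : Matrix (Fin k) (Fin l) ℝ) (B : Matrix (Fin k) (Fin k) ℝ) (ξ : Fin l → V) (f : Fin k → V) :
    δ (Fin.append (fun i => ξ i + ∑ a, C a i • f a) (fun b => ∑ a, B a b • f a) ∘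
      Fin.cast h.symm) = |B.det| * δ (Fin.append ξ f ∘ Fin.cast h.symm) := by
  subst h
  have h1 := hδ.linear_comb (Matrix.reindex finSumFinEquiv finSumFinEquiv
    (Matrix.fromBlocks 1 0 C B)) (Fin.append ξ f)
  rw [Matrix.det_reindex_self, Matrix.det_fromBlocks_zero₁₂, Matrix.det_one, one_mul] at h1
  refine Eq.trans (congrArg δ ?_) h1
  funext j
  refine Fin.addCases (fun i => ?_) (fun i => ?_) j
  · simp [Fin.sum_univ_add, Matrix.one_apply]
  · simp [Fin.sum_univ_add]

theorem IsDec.eq_zero_of_not_linearIndependent {δ : (Fin m → V) → ℝ} (hδ : IsDec δ)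
    {ξ : Fin m → V} (hξ : ¬ LinearIndependent ℝ ξ) : δ ξ = 0 := by
  obtain ⟨a, φ, h⟩ := hδ
  rw [h, ← vdetAlt_apply, AlternatingMap.map_linearDependent _ _ hξ, mul_zero, abs_zero]

/-- Vectors tangent to the fiber do not matter in the contraction by a frame of the fiber. -/
theorem IsDec.append_add {δ : (Fin m → V) → ℝ} (hδ : IsDec δ) (h : l + k = m)
    (hk : finrank ℝ W = k) (A : W →L[ℝ] V) (ξ : Fin l → V) (w : Fin l → W) (f : Fin k → W) :
    δ (Fin.append (fun i => ξ i + A (w i)) (fun j => A (f j)) ∘ Fin.cast h.symm) =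
      δ (Fin.append ξ (fun j => A (f j)) ∘ Fin.cast h.symm) := by
  by_cases hf : LinearIndependent ℝ f
  · let b := basisOfLinearIndependentOfCardEqFinrank' f hf (by simp [hk])
    have hb : ⇑b = f := coe_basisOfLinearIndependentOfCardEqFinrank' f hf _
    have h1 := hδ.append_linear_comb h (Matrix.of fun a i => b.repr (w i) a) 1 ξ (fun j => A (f j))
    rw [Matrix.det_one, abs_one, one_mul] at h1
    refine Eq.trans ?_ h1
    have h2 : ∀ i, A (w i) = ∑ a, b.repr (w i) a • A (f a) := fun i => by
      conv_lhs => rw [← b.sum_repr (w i)]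
      rw [map_sum]
      simp only [map_smul, hb]
    simp [h2, Matrix.one_apply]
  · have h0 : ∀ ζ : Fin l → V,
        δ (Fin.append ζ (fun j => A (f j)) ∘ Fin.cast h.symm) = 0 := fun ζ => by
      refine hδ.eq_zero_of_not_linearIndependent fun hL => hf ?_
      subst h
      have h3 := hL.comp (Fin.natAdd l) (Fin.natAdd_injective k l)
      have h4 : LinearIndependent ℝ (A ∘ f) := by
        convert h3 using 1
        funext j
        simp
      exact LinearIndependent.of_comp (A : W →ₗ[ℝ] V) h4
    rw [h0, h0]

theorem IsDec.contract_left {δ : (Fin m → V) → ℝ} (hδ : IsDec δ) (h : l + k = m)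
    (ξ : Fin l → V) (B : Matrix (Fin k) (Fin k) ℝ) (f : Fin k → V) :
    δ (Fin.append ξ (fun b => ∑ a, B a b • f a) ∘ Fin.cast h.symm) =
      |B.det| * δ (Fin.append ξ f ∘ Fin.cast h.symm) := by
  simpa using hδ.append_linear_comb h 0 B ξ f

end LinearComb

section Along

variable {E : Type*} [NormedAddCommGroup E] [NormedSpace ℝ E]
  {H : Type*} [TopologicalSpace H] {I : ModelWithCorners ℝ E H}
  {X : Type*} [TopologicalSpace X] [ChartedSpace H X] [IsManifold I 1 X]
  {E' : Type*} [NormedAddCommGroup E'] [NormedSpace ℝ E']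
  {H' : Type*} [TopologicalSpace H'] {I' : ModelWithCorners ℝ E' H'}
  {X' : Type*} [TopologicalSpace X'] [ChartedSpace H' X'] [IsManifold I' 1 X']
  {T : Type*} [TopologicalSpace T] {S : Set T} {m : ℕ}

variable (I) in
/-- Continuity of a family of tangent vectors. -/
def ContinuousVectorOn (x : T → X) (v : T → E) (S : Set T) : Prop :=
  ContinuousOn (fun t => (⟨x t, v t⟩ : TangentBundle I X)) S

theorem ContinuousVectorOn.mono {x : T → X} {v : T → E} {S' : Set T}
    (h : ContinuousVectorOn I x v S) (hS : S' ⊆ S) : ContinuousVectorOn I x v S' :=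
  ContinuousOn.mono h hS

/-- A continuous field is continuous along continuous families of vectors. -/
theorem ContinuousFieldOn.comp {U : Set X} {δ : DensityField I X m} (hδ : ContinuousFieldOn δ U)
    {x : T → X} {ξ : T → Fin m → E} (hx : ContinuousOn x S) (hU : MapsTo x S U)
    (hξ : ∀ i, ContinuousVectorOn I x (fun t => ξ t i) S) :
    ContinuousOn (fun t => δ (x t) (ξ t)) S := by
  intro t₀ ht₀
  set e := trivializationAt E (TangentSpace I : X → Type _) (x t₀) with he
  set S' := S ∩ x ⁻¹' e.baseSet with hS'
  have hn : S' ∈ 𝓝[S] t₀ := Filter.inter_mem self_mem_nhdsWithin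
    ((hx t₀ ht₀).preimage_mem_nhdsWithin (e.open_baseSet.mem_nhds
      (FiberBundle.mem_baseSet_trivializationAt' (x t₀))))
  have h1 : ContinuousOn (fun t => (x t, fun i => (e (⟨x t, ξ t i⟩ : TangentBundle I X)).2)) S' := by
    refine (hx.mono inter_subset_left).prodMk (continuousOn_pi.2 fun i => ?_)
    refine continuous_snd.comp_continuousOn (e.continuousOn.comp ((hξ i).mono inter_subset_left) ?_)
    intro t ht
    exact e.mem_source.2 ht.2
  have h2 : ContinuousOn (fun t => δ (x t) (ξ t)) S' := by
    refine ((hδ (x t₀)).comp h1 fun t ht => ⟨⟨hU ht.1, ht.2⟩, mem_univ _⟩).congr fun t ht => ?_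
    refine congrArg (δ (x t)) (funext fun i => ?_)
    have h3 := e.symmL_continuousLinearMapAt (R := ℝ) ht.2 (ξ t i)
    have h4 : e.continuousLinearMapAt ℝ (x t) (ξ t i) =
        (e (⟨x t, ξ t i⟩ : TangentBundle I X)).2 := by
      rw [Bundle.Trivialization.continuousLinearMapAt_apply,
        Bundle.Trivialization.coe_linearMapAt_of_mem e ht.2]
    rw [h4] at h3
    exact h3.symm
  have h5 : t₀ ∈ S' := mem_of_mem_nhdsWithin ht₀ hn
  exact (h2 t₀ h5).mono_of_mem_nhdsWithin hn

theorem continuousVectorOn_symmL (x₀ : X) : ContinuousVectorOn I (fun z : X × E => z.1)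
    (fun z => (trivializationAt E (TangentSpace I : X → Type _) x₀).symmL ℝ z.1 z.2)
    ((trivializationAt E (TangentSpace I : X → Type _) x₀).baseSet ×ˢ univ) := by
  refine (trivializationAt E (TangentSpace I : X → Type _) x₀).continuousOn_symm.congr
    fun z hz => ?_
  have := (trivializationAt E (TangentSpace I : X → Type _) x₀).symmL_apply (R := ℝ) hz.1 z.2
  exact congrArg (fun v => (⟨z.1, v⟩ : TangentBundle I X)) this

theorem ContinuousVectorOn.mfderiv {f : X → X'} {s : Set X} (hs : IsOpen s)
    (hf : ContMDiffOn I I' 1 f s) {x : T → X} {v : T → E} (hv : ContinuousVectorOn I x v S)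
    (hx : MapsTo x S s) :
    ContinuousVectorOn I' (fun t => f (x t)) (fun t => mfderiv I I' f (x t) (v t)) S := by
  have h1 := hf.continuousOn_tangentMapWithin le_rfl hs.uniqueMDiffOn
  refine (h1.comp hv fun t ht => hx ht).congr fun t ht => ?_
  have := tangentMapWithin_eq_tangentMap (p := (⟨x t, v t⟩ : TangentBundle I X))
    (hs.uniqueMDiffWithinAt (hx ht))
    ((hf.contMDiffAt (hs.mem_nhds (hx ht))).mdifferentiableAt one_ne_zero)
  exact this.symm

theorem ContinuousVectorOn.prodMk {x : T → X} {v : T → E} {x' : T → X'} {v' : T → E'}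
    (h : ContinuousVectorOn I x v S) (h' : ContinuousVectorOn I' x' v' S) :
    ContinuousVectorOn (I.prod I') (fun t => (x t, x' t)) (fun t => (v t, v' t)) S :=
  (contMDiff_equivTangentBundleProd_symm (n := 0) (I := I) (M := X) (I' := I')
    (M' := X')).continuous.comp_continuousOn (ContinuousOn.prodMk h h')

theorem continuousVectorOn_zero {x : T → X} (hx : ContinuousOn x S) :
    ContinuousVectorOn I x (fun _ => (0 : E)) S :=
  (Bundle.Trivialization.continuous_zeroSection ℝ (F := E)
    (E := (TangentSpace I : X → Type _))).comp_continuousOn hx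

theorem continuousVectorOn_const (v : E) {x : T → E} (hx : ContinuousOn x S) :
    ContinuousVectorOn 𝓘(ℝ, E) x (fun _ => v) S :=
  (tangentBundleModelSpaceHomeomorph 𝓘(ℝ, E)).symm.continuous.comp_continuousOn
    (hx.prodMk continuousOn_const)

theorem continuousVectorOn_frame {k : ℕ} {Θ : OpenPartialHomeomorph (Fin k → ℝ) X}
    (hΘ : IsParam I Θ) (i : Fin k) {x : T → Fin k → ℝ} (hx : ContinuousOn x S)
    (hxs : MapsTo x S Θ.source) :
    ContinuousVectorOn I (fun t => Θ (x t)) (fun t => frame I Θ (x t) i) S :=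
  (continuousVectorOn_const (Pi.single i 1 : Fin k → ℝ) hx).mfderiv Θ.open_source hΘ.smooth hxs

end Along

section Trivialization

variable {EX : Type*} [NormedAddCommGroup EX] [NormedSpace ℝ EX] [FiniteDimensional ℝ EX]
  {HX : Type*} [TopologicalSpace HX] {IX : ModelWithCorners ℝ EX HX}
  {X : Type*} [TopologicalSpace X] [ChartedSpace HX X]
  {EY : Type*} [NormedAddCommGroup EY] [NormedSpace ℝ EY] [FiniteDimensional ℝ EY]
  {HY : Type*} [TopologicalSpace HY] {IY : ModelWithCorners ℝ EY HY}
  {Y : Type*} [TopologicalSpace Y] [ChartedSpace HY Y]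
  {EF : Type*} [NormedAddCommGroup EF] [NormedSpace ℝ EF] [FiniteDimensional ℝ EF]
  {HF : Type*} [TopologicalSpace HF] {IF : ModelWithCorners ℝ EF HF}
  {F : Type*} [TopologicalSpace F] [ChartedSpace HF F]
  {p : X → Y} {e e' : Bundle.Trivialization F p} {y : Y} {l m : ℕ}

/-- The parametrization of the total space by a local trivialization. -/
def param (e : Bundle.Trivialization F p) (y : Y) (z : F) : X :=
  e.toOpenPartialHomeomorph.symm (y, z)

variable (IX IY IF) in
/-- The derivative of the inverse of a local trivialization. -/
def dparam (e : Bundle.Trivialization F p) (y : Y) (z : F) : EY × EF →L[ℝ] EX :=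
  mfderiv (IY.prod IF) IX e.toOpenPartialHomeomorph.symm (y, z)

variable (IX IY) in
/-- The derivative of a map, as a map between the model spaces. -/
def dmap (p : X → Y) (x : X) : EX →L[ℝ] EY := mfderiv IX IY p x

theorem mem_target_of_mem_baseSet (hy : y ∈ e.baseSet) (z : F) : (y, z) ∈ e.target :=
  e.mem_target.2 hy

theorem proj_param (hy : y ∈ e.baseSet) (z : F) : p (param e y z) = y :=
  e.proj_symm_apply' hy

theorem param_mem_source (hy : y ∈ e.baseSet) (z : F) : param e y z ∈ e.source :=
  e.toOpenPartialHomeomorph.map_target (mem_target_of_mem_baseSet hy z)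

theorem apply_param (hy : y ∈ e.baseSet) (z : F) : e (param e y z) = (y, z) :=
  e.toOpenPartialHomeomorph.right_inv (mem_target_of_mem_baseSet hy z)

theorem param_apply_snd {x : X} (hx : p x ∈ e.baseSet) : param e (p x) (e x).2 = x := by
  have h1 : x ∈ e.source := e.mem_source.2 hx
  have h2 : (p x, (e x).2) = e x := Prod.ext (e.coe_fst h1).symm rfl
  rw [param, h2]
  exact e.toOpenPartialHomeomorph.left_inv h1

theorem IsSmoothTrivializationNear.of_mem {y₀ : Y}
    (he : IsSmoothTrivializationNear IX IY IF F e y₀) (hy : y ∈ e.baseSet) :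
    IsSmoothTrivializationNear IX IY IF F e y := ⟨hy, he.2⟩

theorem IsSmoothTrivializationNear.contMDiffOn
    (he : IsSmoothTrivializationNear IX IY IF F e y) :
    ContMDiffOn IX (IY.prod IF) 1 e e.source := he.2.1.of_le (by exact_mod_cast le_top)

theorem IsSmoothTrivializationNear.contMDiffOn_symm
    (he : IsSmoothTrivializationNear IX IY IF F e y) :
    ContMDiffOn (IY.prod IF) IX 1 e.toOpenPartialHomeomorph.symm e.target :=
  he.2.2.of_le (by exact_mod_cast le_top)

theorem IsSmoothTrivializationNear.mdifferentiableAt_symm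
    (he : IsSmoothTrivializationNear IX IY IF F e y) (z : F) :
    MDifferentiableAt (IY.prod IF) IX e.toOpenPartialHomeomorph.symm (y, z) :=
  (he.contMDiffOn_symm.contMDiffAt (e.open_target.mem_nhds
    (mem_target_of_mem_baseSet he.1 z))).mdifferentiableAt one_ne_zero

theorem IsSmoothTrivializationNear.mdifferentiableAt
    (he : IsSmoothTrivializationNear IX IY IF F e y) {x : X} (hx : x ∈ e.source) :
    MDifferentiableAt IX (IY.prod IF) e x :=
  (he.contMDiffOn.contMDiffAt (e.open_source.mem_nhds hx)).mdifferentiableAt one_ne_zero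

theorem IsSmoothTrivializationNear.hasMFDerivAt_proj
    (he : IsSmoothTrivializationNear IX IY IF F e y) {x : X} (hx : x ∈ e.source) :
    HasMFDerivAt IX IY p x ((ContinuousLinearMap.fst ℝ EY EF).comp
      (dmap IX (IY.prod IF) e x)) := by
  have h1 := HasMFDerivAt.comp (I := IX) (I' := IY.prod IF) (I'' := IY) x
    (hasMFDerivAt_fst (I := IY) (I' := IF) (x := e x)) (he.mdifferentiableAt hx).hasMFDerivAt
  refine h1.congr_of_eventuallyEq ?_
  filter_upwards [e.open_source.mem_nhds hx] with x' hx'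
  exact (e.coe_fst hx').symm

theorem IsSmoothTrivializationNear.dmap_dparam
    (he : IsSmoothTrivializationNear IX IY IF F e y) (z : F) (v : EY × EF) :
    dmap IX IY p (param e y z) (dparam IX IY IF e y z v) = v.1 := by
  have h1 := HasMFDerivAt.comp (I := IY.prod IF) (I' := IX) (I'' := IY) (y, z)
    (he.hasMFDerivAt_proj (param_mem_source he.1 z)).mdifferentiableAt.hasMFDerivAt
    (he.mdifferentiableAt_symm z).hasMFDerivAt
  have h2 : HasMFDerivAt (IY.prod IF) IY (p ∘ e.toOpenPartialHomeomorph.symm) (y, z)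
      (ContinuousLinearMap.fst ℝ EY EF) := by
    refine (hasMFDerivAt_fst (I := IY) (I' := IF) (x := (y, z))).congr_of_eventuallyEq ?_
    filter_upwards [e.open_target.mem_nhds (mem_target_of_mem_baseSet he.1 z)] with w hw
    exact e.proj_symm_apply hw
  exact DFunLike.congr_fun (hasMFDerivAt_unique h1 h2) v

/-- Every tangent vector comes from the trivialization. -/
theorem IsSmoothTrivializationNear.exists_vertical
    (he : IsSmoothTrivializationNear IX IY IF F e y) {z : F} {x : X} (hx : param e y z = x)
    (ξ : EX) : ∃ b : EF, ξ = dparam IX IY IF e y z (dmap IX IY p x ξ, b) := by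
  subst hx
  have hs := param_mem_source he.1 z
  have h0 : (e (param e y z)) = (y, z) := apply_param he.1 z
  have hd : MDifferentiableAt (IY.prod IF) IX e.toOpenPartialHomeomorph.symm
      (e (param e y z)) := by
    rw [h0]; exact he.mdifferentiableAt_symm z
  have h1 := HasMFDerivAt.comp (I := IX) (I' := IY.prod IF) (I'' := IX) (param e y z)
    hd.hasMFDerivAt (he.mdifferentiableAt hs).hasMFDerivAt
  have h2 : HasMFDerivAt IX IX (e.toOpenPartialHomeomorph.symm ∘ e) (param e y z)
      (ContinuousLinearMap.id ℝ EX) := by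
    refine (hasMFDerivAt_id (I := IX) (param e y z)).congr_of_eventuallyEq ?_
    filter_upwards [e.open_source.mem_nhds hs] with w hw
    exact e.toOpenPartialHomeomorph.left_inv hw
  have h3 : dmap (IY.prod IF) IX e.toOpenPartialHomeomorph.symm (e (param e y z))
      (dmap IX (IY.prod IF) e (param e y z) ξ) = ξ :=
    DFunLike.congr_fun (hasMFDerivAt_unique h1 h2) ξ
  rw [h0] at h3
  refine ⟨(dmap IX (IY.prod IF) e (param e y z) ξ).2, ?_⟩
  have h4 : dmap IX IY p (param e y z) ξ = (dmap IX (IY.prod IF) e (param e y z) ξ).1 :=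
    DFunLike.congr_fun (he.hasMFDerivAt_proj hs).mfderiv ξ
  rw [h4]
  exact h3.symm

theorem IsSmoothTrivializationNear.mfderiv_fiber
    (he : IsSmoothTrivializationNear IX IY IF F e y) (z : F) (f : EF) :
    dmap IF IX (fun z' : F => e.toOpenPartialHomeomorph.symm (y, z')) z f =
      dparam IX IY IF e y z (0, f) := by
  have h1 := mfderiv_comp_apply (I := IF) (I' := IY.prod IF) (I'' := IX) z
    (he.mdifferentiableAt_symm z) (f := fun z' : F => (y, z'))
    (mdifferentiableAt_const.prodMk mdifferentiableAt_id) f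
  have h2 := DFunLike.congr_fun (mfderiv_prod_right (I := IY) (I' := IF) (x₀ := y) (y₀ := z)) f
  exact h1.trans (congrArg (dparam IX IY IF e y z) h2)

theorem IsSmoothTrivializationNear.dmap_lift
    (he : IsSmoothTrivializationNear IX IY IF F e y) (z : F) (η : EY) :
    dmap IX IY p (param e y z) (lift IX IY p (param e y z) (y := y) η) = η := by
  have hex : ∃ ξ : TangentSpace IX (param e y z),
      tangentMap IX IY p ⟨param e y z, ξ⟩ = (⟨y, η⟩ : TangentBundle IY Y) := by
    refine ⟨dparam IX IY IF e y z (η, 0), ?_⟩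
    have h1 := he.dmap_dparam z (η, 0)
    have h2 := proj_param he.1 z
    have : ∀ (y' : Y) (η' : EY), y' = y → η' = η →
        (⟨y', η'⟩ : TangentBundle IY Y) = ⟨y, η⟩ := by
      rintro _ _ rfl rfl; rfl
    exact this _ _ h2 h1
  have h := Classical.epsilon_spec hex
  exact congrArg (fun v : TangentBundle IY Y => (v.2 : EY)) h

/-- The density that is integrated over the fiber, in a local trivialization. -/
def fiberDensity (e : Bundle.Trivialization F p) (h : l + finrank ℝ EF = m)
    (δ : DensityField IX X m) (y : Y) (η : Fin l → EY) : DensityField IF F (finrank ℝ EF) :=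
  fun z f => δ (param e y z) (Fin.append (fun i => dparam IX IY IF e y z (η i, 0))
    (fun j => dparam IX IY IF e y z (0, f j)) ∘ Fin.cast h.symm)

/-- Lifts may be changed by vertical vectors. -/
theorem fiberDensity_eq {h : l + finrank ℝ EF = m} {δ : DensityField IX X m}
    (hδ : ∀ x, IsDec (V := EX) (δ x)) (he : IsSmoothTrivializationNear IX IY IF F e y) {z : F}
    {x : X} (hx : param e y z = x) (η : Fin l → EY) {ξ : Fin l → EX}
    (hξ : ∀ i, dmap IX IY p x (ξ i) = η i) (f : Fin (finrank ℝ EF) → EF) :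
    δ x (Fin.append ξ (fun j => dparam IX IY IF e y z (0, f j)) ∘ Fin.cast h.symm) =
      fiberDensity (IX := IX) (IY := IY) (IF := IF) e h δ y η z f := by
  choose b hb using fun i => he.exists_vertical hx (ξ i)
  have h1 := (hδ x).append_add h rfl
    ((dparam IX IY IF e y z).comp (ContinuousLinearMap.inr ℝ EY EF))
    (fun i => dparam IX IY IF e y z (η i, 0)) b f
  have h2 : ξ = fun i => dparam IX IY IF e y z (η i, 0) +
      ((dparam IX IY IF e y z).comp (ContinuousLinearMap.inr ℝ EY EF)) (b i) := by
    funext i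
    conv_lhs => rw [hb i, hξ i]
    rw [ContinuousLinearMap.comp_apply, ContinuousLinearMap.inr_apply, ← map_add]
    simp
  rw [← h2] at h1
  subst hx
  exact h1

theorem isTopDensity_fiberDensity {h : l + finrank ℝ EF = m} {δ : DensityField IX X m}
    (hδ : ∀ x, IsDec (V := EX) (δ x)) (y : Y) (η : Fin l → EY) :
    IsTopDensity (fiberDensity (IX := IX) (IY := IY) (IF := IF) e h δ y η) := by
  intro z B f
  have h1 := (hδ (param e y z)).contract_left h (fun i => dparam IX IY IF e y z (η i, 0)) B
    (fun j => dparam IX IY IF e y z (0, f j))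
  refine Eq.trans (congrArg (δ (param e y z)) ?_) h1
  refine congrArg (fun g => Fin.append (fun i => dparam IX IY IF e y z (η i, 0)) g ∘
    Fin.cast h.symm) (funext fun j => ?_)
  have h2 : ∀ (A : EF →L[ℝ] EX) (f : Fin (finrank ℝ EF) → EF),
      A (∑ a, B a j • f a) = ∑ a, B a j • A (f a) := fun A f => by simp
  exact h2 ((dparam IX IY IF e y z).comp (ContinuousLinearMap.inr ℝ EY EF)) f

theorem isDec_fiberDensity {h : l + finrank ℝ EF = m} {δ : DensityField IX X m}
    (hδ : ∀ x, IsDec (V := EX) (δ x)) (y : Y) (z : F) (f : Fin (finrank ℝ EF) → EF) :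
    IsDec fun η : Fin l → EY =>
      fiberDensity (IX := IX) (IY := IY) (IF := IF) e h δ y η z f :=
  ((hδ (param e y z)).contract h (fun j => dparam IX IY IF e y z (0, f j))).comp
    ((dparam IX IY IF e y z).comp (ContinuousLinearMap.inl ℝ EY EF))

variable [IsManifold IX 1 X] [IsManifold IY 1 Y] [IsManifold IF 1 F]

theorem continuousOn_fiberDensity {h : l + finrank ℝ EF = m} {δ : DensityField IX X m}
    (hδ : ContinuousFieldOn δ univ) (he : IsSmoothTrivializationNear IX IY IF F e y)
    {T : Type*} [TopologicalSpace T] {S : Set T} {y : T → Y} {η : T → Fin l → EY} {z : T → F}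
    {f : T → Fin (finrank ℝ EF) → EF} (hy : ContinuousOn y S) (hyS : MapsTo y S e.baseSet)
    (hη : ∀ i, ContinuousVectorOn IY y (fun t => η t i) S) (hz : ContinuousOn z S)
    (hf : ∀ j, ContinuousVectorOn IF z (fun t => f t j) S) :
    ContinuousOn (fun t => fiberDensity (IX := IX) (IY := IY) (IF := IF) e h δ (y t) (η t) (z t)
      (f t)) S := by
  have hm : MapsTo (fun t => (y t, z t)) S e.target := fun t ht =>
    mem_target_of_mem_baseSet (hyS ht) _
  have hx : ContinuousOn (fun t => param e (y t) (z t)) S :=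
    e.toOpenPartialHomeomorph.continuousOn_symm.comp (hy.prodMk hz) hm
  refine hδ.comp hx (fun _ _ => mem_univ _) ?_
  subst h
  intro i
  refine Fin.addCases (fun i => ?_) (fun j => ?_) i
  · have h1 := ((hη i).prodMk (continuousVectorOn_zero (I := IF) hz)).mfderiv e.open_target
      he.contMDiffOn_symm hm
    refine h1.congr fun t ht => ?_
    exact congrArg (fun v : EX => (⟨param e (y t) (z t), v⟩ : TangentBundle IX X))
      (Fin.append_left _ _ i)
  · have h1 := ((continuousVectorOn_zero (I := IY) hy).prodMk (hf j)).mfderiv e.open_target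
      he.contMDiffOn_symm hm
    refine h1.congr fun t ht => ?_
    exact congrArg (fun v : EX => (⟨param e (y t) (z t), v⟩ : TangentBundle IX X))
      (Fin.append_right _ _ j)

theorem isContDensity_fiberDensity {h : l + finrank ℝ EF = m} {δ : DensityField IX X m}
    (hδ : ContinuousFieldOn δ univ) (he : IsSmoothTrivializationNear IX IY IF F e y)
    (η : Fin l → EY) :
    IsContDensity (fiberDensity (IX := IX) (IY := IY) (IF := IF) e h δ y η) := by
  intro Θ hΘ
  exact continuousOn_fiberDensity hδ he continuousOn_const (fun _ _ => he.1)
    (fun i => continuousOn_const) Θ.continuousOn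
    (fun j => continuousVectorOn_frame hΘ j continuousOn_id fun _ h => h)

/-- The change of trivializations, on a fiber. -/
def fiberChange (e e' : Bundle.Trivialization F p) (hy : y ∈ e.baseSet) (hy' : y ∈ e'.baseSet)
    (hc : Continuous fun z => (e' (param e y z)).2)
    (hc' : Continuous fun z => (e (param e' y z)).2) : F ≃ₜ F where
  toFun z := (e' (param e y z)).2
  invFun z := (e (param e' y z)).2
  left_inv z := by
    have h1 : param e' y (e' (param e y z)).2 = param e y z := by
      have := param_apply_snd (e := e') (x := param e y z) (by rwa [proj_param hy])
      rwa [proj_param hy] at this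
    simp only [h1, apply_param hy]
  right_inv z := by
    have h1 : param e y (e (param e' y z)).2 = param e' y z := by
      have := param_apply_snd (e := e) (x := param e' y z) (by rwa [proj_param hy'])
      rwa [proj_param hy'] at this
    simp only [h1, apply_param hy']
  continuous_toFun := hc
  continuous_invFun := hc'

theorem contMDiff_fiberChange (he : IsSmoothTrivializationNear IX IY IF F e y)
    (he' : IsSmoothTrivializationNear IX IY IF F e' y) :
    ContMDiff IF IF 1 fun z => (e' (param e y z)).2 := by
  have h0 : ContMDiff IF (IY.prod IF) 1 (fun z : F => (y, z)) :=
    contMDiff_const.prodMk contMDiff_id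
  have h1 : ContMDiffOn IF (IY.prod IF) 1 (fun z : F => (y, z)) univ := h0.contMDiffOn
  have h2 : ContMDiffOn IF IX 1 (param e y) univ :=
    he.contMDiffOn_symm.comp h1 fun z _ => mem_target_of_mem_baseSet he.1 z
  have h3 : ContMDiffOn IF (IY.prod IF) 1 (fun z => e' (param e y z)) univ :=
    he'.contMDiffOn.comp h2 fun z _ => e'.mem_source.2 (by rw [proj_param he.1]; exact he'.1)
  have h4 : ContMDiffOn IF IF 1 (fun z => (e' (param e y z)).2) univ :=
    (contMDiff_snd (M := Y) (N := F) (I := IY) (J := IF)).comp_contMDiffOn h3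
  exact contMDiffOn_univ.1 h4

variable [IF.Boundaryless] [T2Space F] [CompactSpace F]

/-- The integral over the fiber does not depend on the trivialization. -/
theorem densityIntegral_fiberDensity_eq {h : l + finrank ℝ EF = m} {δ : DensityField IX X m}
    (hδ : ∀ x, IsDec (V := EX) (δ x)) (hδc : ContinuousFieldOn δ univ)
    (he : IsSmoothTrivializationNear IX IY IF F e y)
    (he' : IsSmoothTrivializationNear IX IY IF F e' y) (η : Fin l → EY) :
    densityIntegral IF (fiberDensity (IX := IX) (IY := IY) (IF := IF) e h δ y η) =
      densityIntegral IF (fiberDensity (IX := IX) (IY := IY) (IF := IF) e' h δ y η) := by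
  have hg := contMDiff_fiberChange he he'
  have hg' := contMDiff_fiberChange he' he
  let g : F ≃ₜ F := fiberChange e e' he.1 he'.1 hg.continuous hg'.continuous
  rw [← densityIntegral_pullback (isTopDensity_fiberDensity hδ y η)
    (isContDensity_fiberDensity hδc he' η) (g := g) hg hg']
  congr 1
  funext z f
  have hpar : ∀ z, param e' y (g z) = param e y z := fun z => by
    have := param_apply_snd (e := e') (x := param e y z) (by rw [proj_param he.1]; exact he'.1)
    rwa [proj_param he.1] at this
  have hd : ∀ w : EF, dparam IX IY IF e y z (0, w) =
      dparam IX IY IF e' y (g z) (0, dmap IF IF g z w) := fun w => by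
    rw [← he.mfderiv_fiber, ← he'.mfderiv_fiber]
    have h1 : (fun z' : F => e.toOpenPartialHomeomorph.symm (y, z')) =
        (fun z' : F => e'.toOpenPartialHomeomorph.symm (y, z')) ∘ g :=
      funext fun z => (hpar z).symm
    rw [h1]
    refine mfderiv_comp_apply (I := IF) (I' := IF) (I'' := IX) z ?_
      (hg.mdifferentiable one_ne_zero z) w
    exact MDifferentiableAt.comp (I := IF) (I' := IY.prod IF) (I'' := IX) (g z)
      (he'.mdifferentiableAt_symm (g z)) (f := fun z' : F => (y, z'))
      (mdifferentiableAt_const.prodMk mdifferentiableAt_id)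
  refine Eq.trans ?_ (fiberDensity_eq hδ he' (hpar z) η (fun i => he.dmap_dparam z (η i, 0))
    (fun j => dmap IF IF g z (f j)))
  exact congrArg (fun g : Fin (finrank ℝ EF) → EX => δ (param e y z)
    (Fin.append (fun i => dparam IX IY IF e y z (η i, 0)) g ∘ Fin.cast h.symm))
    (funext fun j => hd (f j))

/-- The push-forward, computed in any local trivialization. -/
theorem pushforward_eq {h : l + finrank ℝ EF = m} {δ : DensityField IX X m}
    (hδ : ∀ x, IsDec (V := EX) (δ x)) (hδc : ContinuousFieldOn δ univ)
    (he : IsSmoothTrivializationNear IX IY IF F e y) (η : Fin l → EY) :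
    pushforward IX IY IF F p h δ y η =
      densityIntegral IF (fiberDensity (IX := IX) (IY := IY) (IF := IF) e h δ y η) := by
  have hex : ∃ e : Bundle.Trivialization F p, IsSmoothTrivializationNear IX IY IF F e y := ⟨e, he⟩
  refine Eq.trans (dif_pos hex) ?_
  rw [densityIntegral_fiberDensity_eq hδ hδc he hex.choose_spec]
  congr 1
  funext z f
  refine Eq.trans ?_ (fiberDensity_eq hδ hex.choose_spec rfl η
    (fun i => hex.choose_spec.dmap_lift z (η i)) f)
  exact congrArg (fun g : Fin (finrank ℝ EF) → EX => δ (param hex.choose y z)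
    (Fin.append (fun i => lift IX IY p (param hex.choose y z) (y := y) (η i)) g ∘
      Fin.cast h.symm)) (funext fun j => hex.choose_spec.mfderiv_fiber z (f j))

end Trivialization

section PushforwardNormal

variable {EX : Type*} [NormedAddCommGroup EX] [NormedSpace ℝ EX] [FiniteDimensional ℝ EX]
  {HX : Type*} [TopologicalSpace HX] {IX : ModelWithCorners ℝ EX HX}
  {X : Type*} [TopologicalSpace X] [ChartedSpace HX X]
  {EY : Type*} [NormedAddCommGroup EY] [NormedSpace ℝ EY] [FiniteDimensional ℝ EY]
  {HY : Type*} [TopologicalSpace HY] {IY : ModelWithCorners ℝ EY HY}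
  {Y : Type*} [TopologicalSpace Y] [ChartedSpace HY Y]
  {EF : Type*} [NormedAddCommGroup EF] [NormedSpace ℝ EF] [FiniteDimensional ℝ EF]
  {HF : Type*} [TopologicalSpace HF] {IF : ModelWithCorners ℝ EF HF}
  {F : Type*} [TopologicalSpace F] [ChartedSpace HF F]
  {p : X → Y} {e : Bundle.Trivialization F p} {y : Y} {l m : ℕ}
  {ι : Type*} [Fintype ι] [MeasurableSpace ι] [MeasurableSingletonClass ι]

variable (IX IY) in
/-- The integrand of the push-forward, in the coordinates of a partition. -/
def pushIntegrand (P : ParamPartition IF F (finrank ℝ EF) ι) (e : Bundle.Trivialization F p)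
    (h : l + finrank ℝ EF = m) (δ : DensityField IX X m) (y : Y)
    (z : ι × (Fin (finrank ℝ EF) → ℝ)) (η : Fin l → EY) : ℝ :=
  coordIntegrand (fiberDensity (IX := IX) (IY := IY) (IF := IF) e h δ y η) (P.h z.1) (P.Θ z.1) z.2

variable {P : ParamPartition IF F (finrank ℝ EF) ι} {h : l + finrank ℝ EF = m}
  {δ : DensityField IX X m}

theorem isDec_pushIntegrand (hδ : ∀ x, IsDec (V := EX) (δ x))
    (z : ι × (Fin (finrank ℝ EF) → ℝ)) : IsDec (pushIntegrand IX IY P e h δ y z) := by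
  have h1 := isDec_fiberDensity (IY := IY) (IF := IF) (e := e) (h := h) hδ y (P.Θ z.1 z.2)
    (frame IF (P.Θ z.1) z.2)
  by_cases hz : z.2 ∈ (P.Θ z.1).source
  · have := h1.const_mul (P.nonneg z.1 (P.Θ z.1 z.2))
    refine (congrArg IsDec (funext fun η => ?_)).mp this
    unfold pushIntegrand coordIntegrand
    rw [indicator_of_mem hz]
  · have := h1.const_mul (le_refl (0 : ℝ))
    refine (congrArg IsDec (funext fun η => ?_)).mp this
    refine (zero_mul _).trans ?_
    unfold pushIntegrand coordIntegrand
    rw [indicator_of_notMem hz]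

variable [IsManifold IX 1 X] [IsManifold IY 1 Y] [IsManifold IF 1 F] [T2Space F] [CompactSpace F]

theorem measurable_pushIntegrand (hδc : ContinuousFieldOn δ univ)
    (he : IsSmoothTrivializationNear IX IY IF F e y) (η : Fin l → EY) :
    Measurable fun z => pushIntegrand IX IY P e h δ y z η :=
  measurable_from_prod_countable_right fun i =>
    (continuous_coordIntegrand (P.continuous i) (P.subordinate i)
      (isContDensity_fiberDensity hδc he η _ (P.isParam i))).measurable

theorem integrable_pushIntegrand_apply (hδc : ContinuousFieldOn δ univ)
    (he : IsSmoothTrivializationNear IX IY IF F e y) (η : Fin l → EY) (i : ι) :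
    Integrable fun t => pushIntegrand IX IY P e h δ y (i, t) η :=
  integrable_coordIntegrand (P.continuous i) (P.subordinate i)
    (isContDensity_fiberDensity hδc he η _ (P.isParam i))

theorem integrable_pushIntegrand (hδc : ContinuousFieldOn δ univ)
    (he : IsSmoothTrivializationNear IX IY IF F e y) (η : Fin l → EY) :
    Integrable (fun z => pushIntegrand IX IY P e h δ y z η) (indexed ι volume) :=
  integrable_indexed (integrable_pushIntegrand_apply hδc he η)

variable [IF.Boundaryless]

theorem pushforward_eq_partition (P : ParamPartition IF F (finrank ℝ EF) ι)
    (hδ : ∀ x, IsDec (V := EX) (δ x)) (hδc : ContinuousFieldOn δ univ)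
    (he : IsSmoothTrivializationNear IX IY IF F e y) (η : Fin l → EY) :
    pushforward IX IY IF F p h δ y η =
      P.integral (fiberDensity (IX := IX) (IY := IY) (IF := IF) e h δ y η) := by
  rw [pushforward_eq hδ hδc he, densityIntegral_eq]
  exact ParamPartition.integral_eq (isTopDensity_fiberDensity hδ y η)
    (isContDensity_fiberDensity hδc he η) _ P

theorem pushforward_eq_integral (P : ParamPartition IF F (finrank ℝ EF) ι)
    (hδ : ∀ x, IsDec (V := EX) (δ x)) (hδc : ContinuousFieldOn δ univ)
    (he : IsSmoothTrivializationNear IX IY IF F e y) (η : Fin l → EY) :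
    pushforward IX IY IF F p h δ y η =
      ∫ z, pushIntegrand IX IY P e h δ y z η ∂indexed ι volume := by
  rw [pushforward_eq_partition P hδ hδc he,
    integral_indexed (integrable_pushIntegrand_apply hδc he η)]
  rfl

instance : MeasurableSpace (ChartIndex HF F) := ⊤

/-- The push-forward of a continuous pointwise decomposable density is normal. -/
theorem isNormal_pushforward (hp : IsSmoothFiberBundle IX IY IF F p)
    (hδ : ∀ x, IsDec (V := EX) (δ x)) (hδc : ContinuousFieldOn δ univ) :
    IsNormal (pushforward IX IY IF F p h δ) where
  normalAt y := by
    obtain ⟨e, he⟩ := hp y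
    have h1 := isNormalAt_integral (V := EY) (τ := indexed (ChartIndex HF F) volume)
      (D := pushIntegrand IX IY (chartParamPartition IF F) e h δ y)
      (isDec_pushIntegrand hδ) (measurable_pushIntegrand hδc he) (integrable_pushIntegrand hδc he)
    refine (congrArg (IsNormalAt (V := EY)) (funext fun η => ?_)).mp h1
    exact (pushforward_eq_integral (chartParamPartition IF F) hδ hδc he η).symm
  continuous y₀ := by
    rintro ⟨y, v⟩ ⟨⟨-, hy⟩, -⟩
    obtain ⟨e, he⟩ := hp y
    set b := (trivializationAt EY (TangentSpace IY : Y → Type _) y₀).baseSet with hb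
    set S : Set (Y × (Fin l → EY)) := (b ∩ e.baseSet) ×ˢ univ with hS
    let ζ : Y × (Fin l → EY) → Fin l → EY := fun w i =>
      (trivializationAt EY (TangentSpace IY : Y → Type _) y₀).symmL ℝ w.1 (w.2 i)
    have h1 : ContinuousOn (fun w : Y × (Fin l → EY) =>
        pushforward IX IY IF F p h δ w.1 (ζ w)) S := by
      have h2 : ContinuousOn (fun w : Y × (Fin l → EY) =>
          (chartParamPartition IF F).integral
            (fiberDensity (IX := IX) (IY := IY) (IF := IF) e h δ w.1 (ζ w))) S := by
        refine continuousOn_finsetSum _ fun c _ => ?_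
        refine continuousOn_integral_coordIntegrand ((chartParamPartition IF F).continuous c)
          ((chartParamPartition IF F).subordinate c) ?_
        refine continuousOn_fiberDensity hδc he
          (continuous_fst.comp continuous_fst).continuousOn (fun w hw => hw.1.1.2) (fun i => ?_)
          (((chartParamPartition IF F).Θ c).continuousOn.comp continuousOn_snd fun w hw => hw.2)
          (fun j => continuousVectorOn_frame ((chartParamPartition IF F).isParam c) j
            continuousOn_snd fun w hw => hw.2)
        refine ContinuousOn.comp (continuousVectorOn_symmL (I := IY) y₀)
          (f := fun w : (Y × (Fin l → EY)) × (Fin (finrank ℝ EF) → ℝ) => (w.1.1, w.1.2 i))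
          (by fun_prop) fun w hw => ⟨hw.1.1.1, mem_univ _⟩
      refine h2.congr fun w hw => ?_
      exact pushforward_eq_partition (chartParamPartition IF F) hδ hδc (he.of_mem hw.1.2) (ζ w)
    refine (h1 (y, v) ⟨⟨hy, he.1⟩, mem_univ _⟩).mono_of_mem_nhdsWithin ?_
    have h3 : e.baseSet ×ˢ (univ : Set (Fin l → EY)) ∈ 𝓝 (y, v) :=
      (e.open_baseSet.prod isOpen_univ).mem_nhds ⟨he.1, mem_univ _⟩
    refine Filter.mem_of_superset (Filter.inter_mem self_mem_nhdsWithin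
      (mem_nhdsWithin_of_mem_nhds h3)) ?_
    rintro w ⟨hw1, hw2⟩
    exact ⟨⟨hw1.1.2, hw2.1⟩, mem_univ _⟩

end PushforwardNormal

section LocallyDecomposable

variable {E : Type*} [NormedAddCommGroup E] [NormedSpace ℝ E]
  {H : Type*} [TopologicalSpace H] {I : ModelWithCorners ℝ E H}
  {X : Type*} [TopologicalSpace X] [ChartedSpace H X] [IsManifold I 1 X] {m : ℕ}

/-- Finitely many `1`-forms as one map to `ℝ^m`. -/
def joinForms (φ : Fin m → ∀ x : X, TangentSpace I x →L[ℝ] ℝ) (x : X) : E →L[ℝ] (Fin m → ℝ) :=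
  ContinuousLinearMap.pi fun i => φ i x

theorem vdet_joinForms (φ : Fin m → ∀ x : X, TangentSpace I x →L[ℝ] ℝ) (x : X) (ξ : Fin m → E) :
    vdet (joinForms φ x) ξ = Matrix.det (Matrix.of fun i j => φ i x (ξ j)) := by
  rw [vdet, ← Matrix.det_transpose]
  rfl

theorem IsLocallyDecomposable.isDec {δ : DensityField I X m} (h : IsLocallyDecomposable δ)
    (x : X) : IsDec (V := E) (δ x) := by
  obtain ⟨U, -, hx, a, φ, -, -, h⟩ := h x
  refine ⟨a x, joinForms φ x, fun ξ => ?_⟩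
  rw [vdet_joinForms]
  exact h x hx ξ

end LocallyDecomposable

section ProdMul

variable {E₁ : Type*} [NormedAddCommGroup E₁] [NormedSpace ℝ E₁] [FiniteDimensional ℝ E₁]
  {H₁ : Type*} [TopologicalSpace H₁] {I₁ : ModelWithCorners ℝ E₁ H₁}
  {X₁ : Type*} [TopologicalSpace X₁] [ChartedSpace H₁ X₁]
  {E₂ : Type*} [NormedAddCommGroup E₂] [NormedSpace ℝ E₂] [FiniteDimensional ℝ E₂]
  {H₂ : Type*} [TopologicalSpace H₂] {I₂ : ModelWithCorners ℝ E₂ H₂}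
  {X₂ : Type*} [TopologicalSpace X₂] [ChartedSpace H₂ X₂] {p q : ℕ}
  {δ₁ : DensityField I₁ X₁ p} {δ₂ : DensityField I₂ X₂ q}

theorem prodMul_apply (δ₁ : DensityField I₁ X₁ p) (δ₂ : DensityField I₂ X₂ q) (x : X₁ × X₂) :
    prodMul δ₁ δ₂ x = mulAt (V := E₁ × E₂) (fun ξ => δ₁ x.1 fun i => (ξ i).1)
      (fun ξ => δ₂ x.2 fun i => (ξ i).2) := by
  have h1 : (pullback (Prod.fst : X₁ × X₂ → X₁) δ₁ : DensityField (I₁.prod I₂) (X₁ × X₂) p) x =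
      fun ξ : Fin p → E₁ × E₂ => δ₁ x.1 fun i => (ξ i).1 :=
    funext fun ξ => congrArg (δ₁ x.1) (funext fun i =>
      DFunLike.congr_fun (mfderiv_fst (I := I₁) (I' := I₂) (x := x)) (ξ i))
  have h2 : (pullback (Prod.snd : X₁ × X₂ → X₂) δ₂ : DensityField (I₁.prod I₂) (X₁ × X₂) q) x =
      fun ξ : Fin q → E₁ × E₂ => δ₂ x.2 fun i => (ξ i).2 :=
    funext fun ξ => congrArg (δ₂ x.2) (funext fun i =>
      DFunLike.congr_fun (mfderiv_snd (I := I₁) (I' := I₂) (x := x)) (ξ i))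
  exact congrArg₂ (mulAt (V := E₁ × E₂)) h1 h2

theorem isDec_prodMul (h₁ : ∀ x, IsDec (V := E₁) (δ₁ x)) (h₂ : ∀ x, IsDec (V := E₂) (δ₂ x))
    (x : X₁ × X₂) : IsDec (V := E₁ × E₂) (prodMul δ₁ δ₂ x) := by
  rw [prodMul_apply]
  exact ((h₁ x.1).comp (ContinuousLinearMap.fst ℝ E₁ E₂)).mulAt
    ((h₂ x.2).comp (ContinuousLinearMap.snd ℝ E₁ E₂))

theorem mulAt_const_mul {V : Type*} [NormedAddCommGroup V] [NormedSpace ℝ V]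
    [FiniteDimensional ℝ V] {δ : (Fin p → V) → ℝ} {δ' : (Fin q → V) → ℝ}
    (h : IsDec δ) (h' : IsDec δ') {c c' : ℝ} (hc : 0 ≤ c) (hc' : 0 ≤ c') (ξ : Fin (p + q) → V) :
    mulAt (fun ξ => c * δ ξ) (fun ξ => c' * δ' ξ) ξ = c * c' * mulAt δ δ' ξ := by
  obtain ⟨a, φ, h⟩ := h
  obtain ⟨a', φ', h'⟩ := h'
  have e1 : (fun ξ => c * δ ξ) = fun ξ => |c * a * vdet φ ξ| := funext fun ξ => by
    rw [h, mul_assoc, abs_mul c, abs_of_nonneg hc]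
  have e2 : (fun ξ => c' * δ' ξ) = fun ξ => |c' * a' * vdet φ' ξ| := funext fun ξ => by
    rw [h', mul_assoc, abs_mul c', abs_of_nonneg hc']
  rw [e1, e2, funext h, funext h', mulAt_dec, mulAt_dec]
  dsimp only
  rw [← abs_of_nonneg (mul_nonneg hc hc'), ← abs_mul]
  congr 1
  ring

variable [IsManifold I₁ 1 X₁] [IsManifold I₂ 1 X₂]

theorem ContinuousVectorOn.fst {T : Type*} [TopologicalSpace T] {S : Set T} {x : T → X₁ × X₂}
    {v : T → E₁ × E₂} (h : ContinuousVectorOn (I₁.prod I₂) x v S) :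
    ContinuousVectorOn I₁ (fun t => (x t).1) (fun t => (v t).1) S :=
  (continuous_fst.comp (contMDiff_equivTangentBundleProd (n := 0) (I := I₁) (M := X₁) (I' := I₂)
    (M' := X₂)).continuous).comp_continuousOn h

theorem ContinuousVectorOn.snd {T : Type*} [TopologicalSpace T] {S : Set T} {x : T → X₁ × X₂}
    {v : T → E₁ × E₂} (h : ContinuousVectorOn (I₁.prod I₂) x v S) :
    ContinuousVectorOn I₂ (fun t => (x t).2) (fun t => (v t).2) S :=
  (continuous_snd.comp (contMDiff_equivTangentBundleProd (n := 0) (I := I₁) (M := X₁) (I' := I₂)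
    (M' := X₂)).continuous).comp_continuousOn h

theorem continuousFieldOn_prodMul (h₁ : IsLocallyDecomposable δ₁)
    (h₂ : IsLocallyDecomposable δ₂) : ContinuousFieldOn (prodMul δ₁ δ₂) univ := by
  rintro x₀ ⟨x, v⟩ ⟨⟨-, hx⟩, -⟩
  obtain ⟨U₁, hU₁, hx₁, a₁, φ₁, ha₁, hφ₁, hd₁⟩ := h₁ x.1
  obtain ⟨U₂, hU₂, hx₂, a₂, φ₂, ha₂, hφ₂, hd₂⟩ := h₂ x.2
  set b := (trivializationAt (E₁ × E₂) (TangentSpace (I₁.prod I₂) : X₁ × X₂ → Type _) x₀).baseSet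
  set S : Set ((X₁ × X₂) × (Fin (p + q) → E₁ × E₂)) := (b ∩ U₁ ×ˢ U₂) ×ˢ univ with hS
  let ζ : (X₁ × X₂) × (Fin (p + q) → E₁ × E₂) → Fin (p + q) → E₁ × E₂ := fun w i =>
    (trivializationAt (E₁ × E₂) (TangentSpace (I₁.prod I₂) : X₁ × X₂ → Type _) x₀).symmL ℝ
      w.1 (w.2 i)
  have hloc : ∀ w ∈ S, prodMul δ₁ δ₂ w.1 (ζ w) = |a₁ w.1.1 * a₂ w.1.2 *
      Matrix.det (Matrix.of fun j => (Fin.append (fun i => φ₁ i w.1.1 (ζ w j).1)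
        (fun i => φ₂ i w.1.2 (ζ w j).2) : Fin (p + q) → ℝ))| := by
    intro w hw
    have e1 : (fun ξ : Fin p → E₁ × E₂ => δ₁ w.1.1 fun i => (ξ i).1) = fun ξ =>
        |a₁ w.1.1 * vdet ((joinForms φ₁ w.1.1).comp (ContinuousLinearMap.fst ℝ E₁ E₂)) ξ| := by
      funext ξ
      refine (hd₁ w.1.1 hw.1.2.1 _).trans ?_
      exact congrArg (fun r => |a₁ w.1.1 * r|) (vdet_joinForms φ₁ w.1.1 fun i => (ξ i).1).symm
    have e2 : (fun ξ : Fin q → E₁ × E₂ => δ₂ w.1.2 fun i => (ξ i).2) = fun ξ =>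
        |a₂ w.1.2 * vdet ((joinForms φ₂ w.1.2).comp (ContinuousLinearMap.snd ℝ E₁ E₂)) ξ| := by
      funext ξ
      refine (hd₂ w.1.2 hw.1.2.2 _).trans ?_
      exact congrArg (fun r => |a₂ w.1.2 * r|) (vdet_joinForms φ₂ w.1.2 fun i => (ξ i).2).symm
    rw [prodMul_apply, e1, e2, mulAt_dec]
    dsimp only
    refine congrArg (fun r => |a₁ w.1.1 * a₂ w.1.2 * r|) (congrArg Matrix.det ?_)
    ext j i
    rw [Matrix.of_apply, Matrix.of_apply, joint_apply]
    rfl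
  have hζ : ∀ j, ContinuousVectorOn (I₁.prod I₂)
      (fun w : (X₁ × X₂) × (Fin (p + q) → E₁ × E₂) => w.1) (fun w => ζ w j) S := fun j =>
    ContinuousOn.comp (continuousVectorOn_symmL (I := I₁.prod I₂) x₀)
      (f := fun w : (X₁ × X₂) × (Fin (p + q) → E₁ × E₂) => (w.1, w.2 j))
      (by fun_prop) fun w hw => ⟨hw.1.1, mem_univ _⟩
  have h1 : ContinuousOn (fun w => prodMul δ₁ δ₂ w.1 (ζ w)) S := by
    refine ContinuousOn.congr ?_ hloc
    refine ContinuousOn.abs (ContinuousOn.mul (ContinuousOn.mul ?_ ?_) ?_)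
    · exact ha₁.comp (by fun_prop) fun w hw => hw.1.2.1
    · exact ha₂.comp (by fun_prop) fun w hw => hw.1.2.2
    · refine (Continuous.matrix_det continuous_id).comp_continuousOn
        (continuousOn_pi.2 fun j => continuousOn_pi.2 fun i => ?_)
      refine Fin.addCases (fun i => ?_) (fun i => ?_) i
      · simp only [Matrix.of_apply, Fin.append_left]
        exact (hφ₁ i).comp (by fun_prop) (fun w hw => hw.1.2.1)
          (ξ := fun w _ => (ζ w j).1) fun _ => (hζ j).fst
      · simp only [Matrix.of_apply, Fin.append_right]
        exact (hφ₂ i).comp (by fun_prop) (fun w hw => hw.1.2.2)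
          (ξ := fun w _ => (ζ w j).2) fun _ => (hζ j).snd
  refine (h1 (x, v) ⟨⟨hx, hx₁, hx₂⟩, mem_univ _⟩).mono_of_mem_nhdsWithin ?_
  have h3 : (U₁ ×ˢ U₂) ×ˢ (univ : Set (Fin (p + q) → E₁ × E₂)) ∈ 𝓝 (x, v) :=
    ((hU₁.prod hU₂).prod isOpen_univ).mem_nhds ⟨⟨hx₁, hx₂⟩, mem_univ _⟩
  refine Filter.mem_of_superset (Filter.inter_mem self_mem_nhdsWithin
    (mem_nhdsWithin_of_mem_nhds h3)) ?_
  rintro w ⟨hw1, hw2⟩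
  exact ⟨⟨hw1.1.2, hw2.1⟩, mem_univ _⟩

theorem isNormal_prodMul (h₁ : IsLocallyDecomposable δ₁) (h₂ : IsLocallyDecomposable δ₂) :
    IsNormal (prodMul δ₁ δ₂) where
  normalAt x := (isDec_prodMul h₁.isDec h₂.isDec x).isNormalAt
  continuous := continuousFieldOn_prodMul h₁ h₂

end ProdMul

section ProdTrivialization

variable {EX₁ : Type*} [NormedAddCommGroup EX₁] [NormedSpace ℝ EX₁] [FiniteDimensional ℝ EX₁]
  {HX₁ : Type*} [TopologicalSpace HX₁] {IX₁ : ModelWithCorners ℝ EX₁ HX₁}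
  {X₁ : Type*} [TopologicalSpace X₁] [ChartedSpace HX₁ X₁]
  {EY₁ : Type*} [NormedAddCommGroup EY₁] [NormedSpace ℝ EY₁] [FiniteDimensional ℝ EY₁]
  {HY₁ : Type*} [TopologicalSpace HY₁] {IY₁ : ModelWithCorners ℝ EY₁ HY₁}
  {Y₁ : Type*} [TopologicalSpace Y₁] [ChartedSpace HY₁ Y₁]
  {EF₁ : Type*} [NormedAddCommGroup EF₁] [NormedSpace ℝ EF₁] [FiniteDimensional ℝ EF₁]
  {HF₁ : Type*} [TopologicalSpace HF₁] {IF₁ : ModelWithCorners ℝ EF₁ HF₁}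
  {F₁ : Type*} [TopologicalSpace F₁] [ChartedSpace HF₁ F₁]
  {EX₂ : Type*} [NormedAddCommGroup EX₂] [NormedSpace ℝ EX₂] [FiniteDimensional ℝ EX₂]
  {HX₂ : Type*} [TopologicalSpace HX₂] {IX₂ : ModelWithCorners ℝ EX₂ HX₂}
  {X₂ : Type*} [TopologicalSpace X₂] [ChartedSpace HX₂ X₂]
  {EY₂ : Type*} [NormedAddCommGroup EY₂] [NormedSpace ℝ EY₂] [FiniteDimensional ℝ EY₂]
  {HY₂ : Type*} [TopologicalSpace HY₂] {IY₂ : ModelWithCorners ℝ EY₂ HY₂}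
  {Y₂ : Type*} [TopologicalSpace Y₂] [ChartedSpace HY₂ Y₂]
  {EF₂ : Type*} [NormedAddCommGroup EF₂] [NormedSpace ℝ EF₂] [FiniteDimensional ℝ EF₂]
  {HF₂ : Type*} [TopologicalSpace HF₂] {IF₂ : ModelWithCorners ℝ EF₂ HF₂}
  {F₂ : Type*} [TopologicalSpace F₂] [ChartedSpace HF₂ F₂]
  {p₁ : X₁ → Y₁} {p₂ : X₂ → Y₂} {e₁ : Bundle.Trivialization F₁ p₁}
  {e₂ : Bundle.Trivialization F₂ p₂} {y : Y₁ × Y₂}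

/-- The product of local trivializations. -/
def prodTrivialization (e₁ : Bundle.Trivialization F₁ p₁) (e₂ : Bundle.Trivialization F₂ p₂) :
    Bundle.Trivialization (F₁ × F₂) (Prod.map p₁ p₂) where
  toOpenPartialHomeomorph :=
    (e₁.toOpenPartialHomeomorph.prod e₂.toOpenPartialHomeomorph).transHomeomorph
      (Homeomorph.prodProdProdComm Y₁ F₁ Y₂ F₂)
  baseSet := e₁.baseSet ×ˢ e₂.baseSet
  open_baseSet := e₁.open_baseSet.prod e₂.open_baseSet
  source_eq := by
    change e₁.source ×ˢ e₂.source = _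
    rw [e₁.source_eq, e₂.source_eq]
    rfl
  target_eq := by
    change (Homeomorph.prodProdProdComm Y₁ F₁ Y₂ F₂).symm ⁻¹' (e₁.target ×ˢ e₂.target) = _
    rw [e₁.target_eq, e₂.target_eq]
    ext w
    simp [Homeomorph.prodProdProdComm]
  proj_toFun x hx := Prod.ext (e₁.proj_toFun x.1 hx.1) (e₂.proj_toFun x.2 hx.2)

theorem isSmoothTrivializationNear_prod (he₁ : IsSmoothTrivializationNear IX₁ IY₁ IF₁ F₁ e₁ y.1)
    (he₂ : IsSmoothTrivializationNear IX₂ IY₂ IF₂ F₂ e₂ y.2) :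
    IsSmoothTrivializationNear (IX₁.prod IX₂) (IY₁.prod IY₂) (IF₁.prod IF₂) (F₁ × F₂)
      (prodTrivialization e₁ e₂) y := by
  refine ⟨⟨he₁.1, he₂.1⟩, ?_, ?_⟩
  · have h1 : ContMDiffOn (IX₁.prod IX₂) (IY₁.prod IF₁) ∞ (fun x : X₁ × X₂ => e₁ x.1)
        (e₁.source ×ˢ e₂.source) := he₁.2.1.comp contMDiffOn_fst fun x hx => hx.1
    have h2 : ContMDiffOn (IX₁.prod IX₂) (IY₂.prod IF₂) ∞ (fun x : X₁ × X₂ => e₂ x.2)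
        (e₁.source ×ˢ e₂.source) := he₂.2.1.comp contMDiffOn_snd fun x hx => hx.2
    exact ((contMDiff_fst.comp_contMDiffOn h1).prodMk (contMDiff_fst.comp_contMDiffOn h2)).prodMk
      ((contMDiff_snd.comp_contMDiffOn h1).prodMk (contMDiff_snd.comp_contMDiffOn h2))
  · have h1 : ContMDiff ((IY₁.prod IY₂).prod (IF₁.prod IF₂)) (IY₁.prod IF₁) ∞
        (fun w : (Y₁ × Y₂) × (F₁ × F₂) => (w.1.1, w.2.1)) :=
      contMDiff_fst.fst.prodMk contMDiff_snd.fst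
    have h2 : ContMDiff ((IY₁.prod IY₂).prod (IF₁.prod IF₂)) (IY₂.prod IF₂) ∞
        (fun w : (Y₁ × Y₂) × (F₁ × F₂) => (w.1.2, w.2.2)) :=
      contMDiff_fst.snd.prodMk contMDiff_snd.snd
    exact (he₁.2.2.comp h1.contMDiffOn fun w hw => hw.1).prodMk
      (he₂.2.2.comp h2.contMDiffOn fun w hw => hw.2)

theorem isSmoothFiberBundle_prod (hp₁ : IsSmoothFiberBundle IX₁ IY₁ IF₁ F₁ p₁)
    (hp₂ : IsSmoothFiberBundle IX₂ IY₂ IF₂ F₂ p₂) :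
    IsSmoothFiberBundle (IX₁.prod IX₂) (IY₁.prod IY₂) (IF₁.prod IF₂) (F₁ × F₂)
      (Prod.map p₁ p₂) := fun y => by
  obtain ⟨e₁, he₁⟩ := hp₁ y.1
  obtain ⟨e₂, he₂⟩ := hp₂ y.2
  exact ⟨_, isSmoothTrivializationNear_prod he₁ he₂⟩

theorem dparam_prod (he₁ : IsSmoothTrivializationNear IX₁ IY₁ IF₁ F₁ e₁ y.1)
    (he₂ : IsSmoothTrivializationNear IX₂ IY₂ IF₂ F₂ e₂ y.2) (z : F₁ × F₂)
    (v : (EY₁ × EY₂) × (EF₁ × EF₂)) :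
    dparam (IX₁.prod IX₂) (IY₁.prod IY₂) (IF₁.prod IF₂) (prodTrivialization e₁ e₂) y z v =
      (dparam IX₁ IY₁ IF₁ e₁ y.1 z.1 (v.1.1, v.2.1),
        dparam IX₂ IY₂ IF₂ e₂ y.2 z.2 (v.1.2, v.2.2)) := by
  have a1 := hasMFDerivAt_fst (I := IY₁.prod IY₂) (I' := IF₁.prod IF₂) (x := (y, z))
  have a2 := hasMFDerivAt_snd (I := IY₁.prod IY₂) (I' := IF₁.prod IF₂) (x := (y, z))
  have b1 := (HasMFDerivAt.comp (y, z) (hasMFDerivAt_fst (I := IY₁) (I' := IY₂) (x := y)) a1).prodMk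
    (HasMFDerivAt.comp (y, z) (hasMFDerivAt_fst (I := IF₁) (I' := IF₂) (x := z)) a2)
  have b2 := (HasMFDerivAt.comp (y, z) (hasMFDerivAt_snd (I := IY₁) (I' := IY₂) (x := y)) a1).prodMk
    (HasMFDerivAt.comp (y, z) (hasMFDerivAt_snd (I := IF₁) (I' := IF₂) (x := z)) a2)
  have c1 := HasMFDerivAt.comp (y, z) (he₁.mdifferentiableAt_symm z.1).hasMFDerivAt b1
  have c2 := HasMFDerivAt.comp (y, z) (he₂.mdifferentiableAt_symm z.2).hasMFDerivAt b2
  exact DFunLike.congr_fun (c1.prodMk c2).mfderiv v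

end ProdTrivialization

section ProductFormula

variable {EX₁ : Type*} [NormedAddCommGroup EX₁] [NormedSpace ℝ EX₁] [FiniteDimensional ℝ EX₁]
  {HX₁ : Type*} [TopologicalSpace HX₁] {IX₁ : ModelWithCorners ℝ EX₁ HX₁}
  {X₁ : Type*} [TopologicalSpace X₁] [ChartedSpace HX₁ X₁]
  {EY₁ : Type*} [NormedAddCommGroup EY₁] [NormedSpace ℝ EY₁] [FiniteDimensional ℝ EY₁]
  {HY₁ : Type*} [TopologicalSpace HY₁] {IY₁ : ModelWithCorners ℝ EY₁ HY₁}
  {Y₁ : Type*} [TopologicalSpace Y₁] [ChartedSpace HY₁ Y₁]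
  {EF₁ : Type*} [NormedAddCommGroup EF₁] [NormedSpace ℝ EF₁] [FiniteDimensional ℝ EF₁]
  {HF₁ : Type*} [TopologicalSpace HF₁] {IF₁ : ModelWithCorners ℝ EF₁ HF₁}
  {F₁ : Type*} [TopologicalSpace F₁] [ChartedSpace HF₁ F₁]
  {EX₂ : Type*} [NormedAddCommGroup EX₂] [NormedSpace ℝ EX₂] [FiniteDimensional ℝ EX₂]
  {HX₂ : Type*} [TopologicalSpace HX₂] {IX₂ : ModelWithCorners ℝ EX₂ HX₂}
  {X₂ : Type*} [TopologicalSpace X₂] [ChartedSpace HX₂ X₂]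
  {EY₂ : Type*} [NormedAddCommGroup EY₂] [NormedSpace ℝ EY₂] [FiniteDimensional ℝ EY₂]
  {HY₂ : Type*} [TopologicalSpace HY₂] {IY₂ : ModelWithCorners ℝ EY₂ HY₂}
  {Y₂ : Type*} [TopologicalSpace Y₂] [ChartedSpace HY₂ Y₂]
  {EF₂ : Type*} [NormedAddCommGroup EF₂] [NormedSpace ℝ EF₂] [FiniteDimensional ℝ EF₂]
  {HF₂ : Type*} [TopologicalSpace HF₂] {IF₂ : ModelWithCorners ℝ EF₂ HF₂}
  {F₂ : Type*} [TopologicalSpace F₂] [ChartedSpace HF₂ F₂]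
  {p₁ : X₁ → Y₁} {p₂ : X₂ → Y₂} {e₁ : Bundle.Trivialization F₁ p₁}
  {e₂ : Bundle.Trivialization F₂ p₂} {y : Y₁ × Y₂} {l₁ l₂ m₁ m₂ : ℕ}
  {δ₁ : DensityField IX₁ X₁ m₁} {δ₂ : DensityField IX₂ X₂ m₂}
  {h₁ : l₁ + finrank ℝ EF₁ = m₁} {h₂ : l₂ + finrank ℝ EF₂ = m₂}

theorem coordIntegrand_eq_mul {E : Type*} [NormedAddCommGroup E] [NormedSpace ℝ E]
    {H : Type*} [TopologicalSpace H] {I : ModelWithCorners ℝ E H}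
    {F : Type*} [TopologicalSpace F] [ChartedSpace H F] {k : ℕ} (β : DensityField I F k)
    (h : F → ℝ) (Θ : OpenPartialHomeomorph (Fin k → ℝ) F) (t : Fin k → ℝ) :
    coordIntegrand β h Θ t =
      Θ.source.indicator (fun t => h (Θ t)) t * β (Θ t) (frame I Θ t) := by
  unfold coordIntegrand
  by_cases ht : t ∈ Θ.source
  · rw [indicator_of_mem ht, indicator_of_mem ht]
  · rw [indicator_of_notMem ht, indicator_of_notMem ht, zero_mul]

/-- The integrand of the push-forward of a product on the product of two fibers. -/
theorem fiberDensity_prodMul (hδ₁ : ∀ x, IsDec (V := EX₁) (δ₁ x))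
    (hδ₂ : ∀ x, IsDec (V := EX₂) (δ₂ x))
    (he₁ : IsSmoothTrivializationNear IX₁ IY₁ IF₁ F₁ e₁ y.1)
    (he₂ : IsSmoothTrivializationNear IX₂ IY₂ IF₂ F₂ e₂ y.2)
    (h : l₁ + l₂ + finrank ℝ (EF₁ × EF₂) = m₁ + m₂)
    (σ : Fin (finrank ℝ EF₁) ⊕ Fin (finrank ℝ EF₂) ≃ Fin (finrank ℝ (EF₁ × EF₂)))
    (η : Fin (l₁ + l₂) → EY₁ × EY₂) (z : F₁ × F₂) (f₁ : Fin (finrank ℝ EF₁) → EF₁)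
    (f₂ : Fin (finrank ℝ EF₂) → EF₂) (f : Fin (finrank ℝ (EF₁ × EF₂)) → EF₁ × EF₂)
    (hf₁ : ∀ i, f (σ (Sum.inl i)) = (f₁ i, 0)) (hf₂ : ∀ j, f (σ (Sum.inr j)) = (0, f₂ j)) :
    fiberDensity (IX := IX₁.prod IX₂) (IY := IY₁.prod IY₂) (IF := IF₁.prod IF₂)
      (prodTrivialization e₁ e₂) h (prodMul δ₁ δ₂) y η z f =
    mulAt (V := EY₁ × EY₂)
      (fun ξ => fiberDensity (IX := IX₁) (IY := IY₁) (IF := IF₁) e₁ h₁ δ₁ y.1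
        (fun i => (ξ i).1) z.1 f₁)
      (fun ξ => fiberDensity (IX := IX₂) (IY := IY₂) (IF := IF₂) e₂ h₂ δ₂ y.2
        (fun i => (ξ i).2) z.2 f₂) η := by
  let e : Fin (m₁ + m₂) ≃ Fin (l₁ + l₂) ⊕ (Fin (finrank ℝ EF₁) ⊕ Fin (finrank ℝ EF₂)) :=
    ((finCongr h.symm).trans finSumFinEquiv.symm).trans (Equiv.sumCongr (Equiv.refl _) σ.symm)
  have key := mulAt_contract h₁ h₂ (hδ₁ (param e₁ y.1 z.1)) (hδ₂ (param e₂ y.2 z.2))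
    ((dparam IX₁ IY₁ IF₁ e₁ y.1 z.1).comp (ContinuousLinearMap.inl ℝ EY₁ EF₁))
    ((dparam IX₂ IY₂ IF₂ e₂ y.2 z.2).comp (ContinuousLinearMap.inl ℝ EY₂ EF₂))
    (fun j => dparam IX₁ IY₁ IF₁ e₁ y.1 z.1 (0, f₁ j))
    (fun j => dparam IX₂ IY₂ IF₂ e₂ y.2 z.2 (0, f₂ j)) e η
  refine Eq.trans ?_ key
  unfold fiberDensity
  refine (congrFun (prodMul_apply δ₁ δ₂ _) _).trans ?_
  refine congrArg (mulAt (V := EX₁ × EX₂) (fun ξ => δ₁ (param e₁ y.1 z.1) fun i => (ξ i).1)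
    (fun ξ => δ₂ (param e₂ y.2 z.2) fun i => (ξ i).2)) (funext fun i => ?_)
  obtain ⟨i, rfl⟩ := (finCongr h).surjective i
  have he : e (finCongr h i) = Sum.map id σ.symm (finSumFinEquiv.symm i) := by
    simp [e]
  rw [he]
  change Fin.append (fun i => dparam (IX₁.prod IX₂) (IY₁.prod IY₂) (IF₁.prod IF₂)
    (prodTrivialization e₁ e₂) y z (η i, 0)) (fun j => dparam (IX₁.prod IX₂) (IY₁.prod IY₂)
      (IF₁.prod IF₂) (prodTrivialization e₁ e₂) y z (0, f j)) i = _
  refine Fin.addCases (fun i => ?_) (fun j => ?_) i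
  · rw [Fin.append_left, finSumFinEquiv_symm_apply_castAdd]
    exact dparam_prod he₁ he₂ z (η i, 0)
  · rw [Fin.append_right, finSumFinEquiv_symm_apply_natAdd]
    refine (dparam_prod he₁ he₂ z (0, f j)).trans ?_
    obtain ⟨c, rfl⟩ := σ.surjective j
    rcases c with c | c
    · rw [hf₁]
      simp only [Sum.map_inr, Equiv.symm_apply_apply, Sum.elim_inr, Sum.elim_inl]
      exact Prod.ext rfl (map_zero (dparam IX₂ IY₂ IF₂ e₂ y.2 z.2))
    · rw [hf₂]
      simp only [Sum.map_inr, Equiv.symm_apply_apply, Sum.elim_inr]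
      exact Prod.ext (map_zero (dparam IX₁ IY₁ IF₁ e₁ y.1 z.1)) rfl

variable {ι₁ ι₂ : Type*} [Fintype ι₁] [Fintype ι₂]
  {P₁ : ParamPartition IF₁ F₁ (finrank ℝ EF₁) ι₁} {P₂ : ParamPartition IF₂ F₂ (finrank ℝ EF₂) ι₂}

theorem coordIntegrand_prodMul (hδ₁ : ∀ x, IsDec (V := EX₁) (δ₁ x))
    (hδ₂ : ∀ x, IsDec (V := EX₂) (δ₂ x))
    (he₁ : IsSmoothTrivializationNear IX₁ IY₁ IF₁ F₁ e₁ y.1)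
    (he₂ : IsSmoothTrivializationNear IX₂ IY₂ IF₂ F₂ e₂ y.2)
    (h : l₁ + l₂ + finrank ℝ (EF₁ × EF₂) = m₁ + m₂)
    (σ : Fin (finrank ℝ EF₁) ⊕ Fin (finrank ℝ EF₂) ≃ Fin (finrank ℝ (EF₁ × EF₂)))
    (η : Fin (l₁ + l₂) → EY₁ × EY₂) (i : ι₁ × ι₂)
    (t : (Fin (finrank ℝ EF₁) → ℝ) × (Fin (finrank ℝ EF₂) → ℝ)) :
    coordIntegrand (fiberDensity (IX := IX₁.prod IX₂) (IY := IY₁.prod IY₂) (IF := IF₁.prod IF₂)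
      (prodTrivialization e₁ e₂) h (prodMul δ₁ δ₂) y η) ((P₁.prod σ P₂).h i) ((P₁.prod σ P₂).Θ i)
      ((splitCoord σ).symm t) =
    mulAt (V := EY₁ × EY₂)
      (fun ξ => pushIntegrand IX₁ IY₁ P₁ e₁ h₁ δ₁ y.1 (i.1, t.1) fun i => (ξ i).1)
      (fun ξ => pushIntegrand IX₂ IY₂ P₂ e₂ h₂ δ₂ y.2 (i.2, t.2) fun i => (ξ i).2) η := by
  have hd₁ : IsDec (V := EY₁ × EY₂) fun ξ => fiberDensity (IX := IX₁) (IY := IY₁) (IF := IF₁)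
      e₁ h₁ δ₁ y.1 (fun i => (ξ i).1) (P₁.Θ i.1 t.1) (frame IF₁ (P₁.Θ i.1) t.1) :=
    (isDec_fiberDensity hδ₁ y.1 _ _).comp (ContinuousLinearMap.fst ℝ EY₁ EY₂)
  have hd₂ : IsDec (V := EY₁ × EY₂) fun ξ => fiberDensity (IX := IX₂) (IY := IY₂) (IF := IF₂)
      e₂ h₂ δ₂ y.2 (fun i => (ξ i).2) (P₂.Θ i.2 t.2) (frame IF₂ (P₂.Θ i.2) t.2) :=
    (isDec_fiberDensity hδ₂ y.2 _ _).comp (ContinuousLinearMap.snd ℝ EY₁ EY₂)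
  have hc₁ : 0 ≤ (P₁.Θ i.1).source.indicator (fun t => P₁.h i.1 (P₁.Θ i.1 t)) t.1 :=
    indicator_nonneg (fun _ _ => P₁.nonneg _ _) _
  have hc₂ : 0 ≤ (P₂.Θ i.2).source.indicator (fun t => P₂.h i.2 (P₂.Θ i.2 t)) t.2 :=
    indicator_nonneg (fun _ _ => P₂.nonneg _ _) _
  have hR := mulAt_const_mul hd₁ hd₂ hc₁ hc₂ η
  unfold pushIntegrand
  simp only [coordIntegrand_eq_mul _ (P₁.h i.1), coordIntegrand_eq_mul _ (P₂.h i.2)]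
  refine Eq.trans ?_ hR.symm
  have hsp : splitCoord σ ((splitCoord σ).symm t) = t := (splitCoord σ).apply_symm_apply t
  by_cases ht : (splitCoord σ).symm t ∈ ((P₁.prod σ P₂).Θ i).source
  · have ht' := (mem_prodParam_source σ).1 ht
    rw [hsp] at ht'
    rw [indicator_of_mem ht'.1, indicator_of_mem ht'.2, coordIntegrand, indicator_of_mem ht]
    have hval : (P₁.prod σ P₂).Θ i ((splitCoord σ).symm t) = (P₁.Θ i.1 t.1, P₂.Θ i.2 t.2) := by
      refine (prodParam_apply σ _).trans ?_
      rw [hsp]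
    have hf₁ := frame_prodParam_inl σ (P₁.isParam i.1) (P₂.isParam i.2) ht
    have hf₂ := frame_prodParam_inr σ (P₁.isParam i.1) (P₂.isParam i.2) ht
    rw [hsp] at hf₁ hf₂
    have h3 := fiberDensity_prodMul (h₁ := h₁) (h₂ := h₂) hδ₁ hδ₂ he₁ he₂ h σ η
      (P₁.Θ i.1 t.1, P₂.Θ i.2 t.2) (frame IF₁ (P₁.Θ i.1) t.1) (frame IF₂ (P₂.Θ i.2) t.2)
      (frame (IF₁.prod IF₂) ((P₁.prod σ P₂).Θ i) ((splitCoord σ).symm t)) hf₁ hf₂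
    refine congrArg₂ (· * ·) ?_ ?_
    · rw [hval]; rfl
    · exact (densityField_congr (E := EF₁ × EF₂) _ hval _).trans h3
  · have h0 : coordIntegrand (fiberDensity (IX := IX₁.prod IX₂) (IY := IY₁.prod IY₂)
        (IF := IF₁.prod IF₂) (prodTrivialization e₁ e₂) h (prodMul δ₁ δ₂) y η)
        ((P₁.prod σ P₂).h i) ((P₁.prod σ P₂).Θ i) ((splitCoord σ).symm t) = 0 := by
      rw [coordIntegrand, indicator_of_notMem ht]
    rw [h0]
    have ht' : ¬ (t.1 ∈ (P₁.Θ i.1).source ∧ t.2 ∈ (P₂.Θ i.2).source) := by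
      intro h
      refine ht ((mem_prodParam_source σ).2 ?_)
      rwa [hsp]
    rcases not_and_or.1 ht' with h | h
    · rw [indicator_of_notMem h]; simp
    · rw [indicator_of_notMem h]; simp

variable [IsManifold IX₁ 1 X₁] [IsManifold IY₁ 1 Y₁] [IsManifold IF₁ 1 F₁]
  [IsManifold IX₂ 1 X₂] [IsManifold IY₂ 1 Y₂] [IsManifold IF₂ 1 F₂]
  [IF₁.Boundaryless] [IF₂.Boundaryless] [T2Space F₁] [CompactSpace F₁] [T2Space F₂]
  [CompactSpace F₂]

/-- The push-forward of a product is the product of the push-forwards. -/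
theorem pushforward_prodMul (hp₁ : IsSmoothFiberBundle IX₁ IY₁ IF₁ F₁ p₁)
    (hp₂ : IsSmoothFiberBundle IX₂ IY₂ IF₂ F₂ p₂) (hδ₁ : IsNormal δ₁) (hδ₂ : IsNormal δ₂)
    (hd₁ : IsLocallyDecomposable δ₁) (hd₂ : IsLocallyDecomposable δ₂)
    (h₁ : l₁ + finrank ℝ EF₁ = m₁) (h₂ : l₂ + finrank ℝ EF₂ = m₂)
    (h : l₁ + l₂ + finrank ℝ (EF₁ × EF₂) = m₁ + m₂) :
    pushforward (IX₁.prod IX₂) (IY₁.prod IY₂) (IF₁.prod IF₂) (F₁ × F₂) (Prod.map p₁ p₂) h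
      (prodMul δ₁ δ₂) =
    prodMul (pushforward IX₁ IY₁ IF₁ F₁ p₁ h₁ δ₁) (pushforward IX₂ IY₂ IF₂ F₂ p₂ h₂ δ₂) := by
  funext y η
  obtain ⟨e₁, he₁⟩ := hp₁ y.1
  obtain ⟨e₂, he₂⟩ := hp₂ y.2
  let σ : Fin (finrank ℝ EF₁) ⊕ Fin (finrank ℝ EF₂) ≃ Fin (finrank ℝ (EF₁ × EF₂)) :=
    finSumFinEquiv.trans (finCongr (finrank_prod (R := ℝ) (M := EF₁) (M' := EF₂)).symm)
  let P₁ := chartParamPartition IF₁ F₁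
  let P₂ := chartParamPartition IF₂ F₂
  have hd := isDec_prodMul hd₁.isDec hd₂.isDec
  have hc := continuousFieldOn_prodMul hd₁ hd₂
  have he := isSmoothTrivializationNear_prod he₁ he₂
  have hmp := measurePreserving_splitCoord_symm σ
  have hme : MeasurableEmbedding (splitCoord σ).symm :=
    (splitCoord σ).symm.toHomeomorph.measurableEmbedding
  have hpt := fun i t => coordIntegrand_prodMul (P₁ := P₁) (P₂ := P₂) (h₁ := h₁) (h₂ := h₂)
    hd₁.isDec hd₂.isDec he₁ he₂ h σ η i t
  have hL := pushforward_eq_partition (h := h) (P₁.prod σ P₂) hd hc he η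
  refine hL.trans ?_
  have hR₁ : (fun ξ : Fin l₁ → EY₁ × EY₂ => pushforward IX₁ IY₁ IF₁ F₁ p₁ h₁ δ₁ y.1
      fun i => (ξ i).1) = fun ξ => ∫ z, pushIntegrand IX₁ IY₁ P₁ e₁ h₁ δ₁ y.1 z
        (fun i => (ξ i).1) ∂indexed (ChartIndex HF₁ F₁) volume := funext fun ξ =>
    pushforward_eq_integral P₁ hd₁.isDec hδ₁.continuous he₁ _
  have hR₂ : (fun ξ : Fin l₂ → EY₁ × EY₂ => pushforward IX₂ IY₂ IF₂ F₂ p₂ h₂ δ₂ y.2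
      fun i => (ξ i).2) = fun ξ => ∫ z, pushIntegrand IX₂ IY₂ P₂ e₂ h₂ δ₂ y.2 z
        (fun i => (ξ i).2) ∂indexed (ChartIndex HF₂ F₂) volume := funext fun ξ =>
    pushforward_eq_integral P₂ hd₂.isDec hδ₂.continuous he₂ _
  refine Eq.trans ?_ (congrFun (prodMul_apply _ _ y) η).symm
  refine Eq.trans ?_ (congrFun (congrArg₂ (mulAt (V := EY₁ × EY₂)) hR₁ hR₂) η).symm
  have hM := mulAt_integral (V := EY₁ × EY₂)
    (D := fun z ξ => pushIntegrand IX₁ IY₁ P₁ e₁ h₁ δ₁ y.1 z fun i => (ξ i).1)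
    (D' := fun z ξ => pushIntegrand IX₂ IY₂ P₂ e₂ h₂ δ₂ y.2 z fun i => (ξ i).2)
    (fun z => (isDec_pushIntegrand hd₁.isDec z).comp (ContinuousLinearMap.fst ℝ EY₁ EY₂))
    (fun ξ => measurable_pushIntegrand hδ₁.continuous he₁ _)
    (fun ξ => integrable_pushIntegrand hδ₁.continuous he₁ _)
    (fun z => (isDec_pushIntegrand hd₂.isDec z).comp (ContinuousLinearMap.snd ℝ EY₁ EY₂))
    (fun ξ => measurable_pushIntegrand hδ₂.continuous he₂ _)
    (fun ξ => integrable_pushIntegrand hδ₂.continuous he₂ _) η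
  refine Eq.trans ?_ hM.symm
  have hI := integral_indexed_prod (μ := (volume : Measure (Fin (finrank ℝ EF₁) → ℝ)))
    (μ' := (volume : Measure (Fin (finrank ℝ EF₂) → ℝ)))
    (f := fun z : (ChartIndex HF₁ F₁ × (Fin (finrank ℝ EF₁) → ℝ)) ×
      (ChartIndex HF₂ F₂ × (Fin (finrank ℝ EF₂) → ℝ)) => mulAt (V := EY₁ × EY₂)
        (fun ξ => pushIntegrand IX₁ IY₁ P₁ e₁ h₁ δ₁ y.1 z.1 fun i => (ξ i).1)
        (fun ξ => pushIntegrand IX₂ IY₂ P₂ e₂ h₂ δ₂ y.2 z.2 fun i => (ξ i).2) η) fun i j => by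
    have h1 := (hmp.integrable_comp_emb hme).2 (integrable_coordIntegrand
      ((P₁.prod σ P₂).continuous (i, j)) ((P₁.prod σ P₂).subordinate (i, j))
      (isContDensity_fiberDensity (h := h) hc he η _ ((P₁.prod σ P₂).isParam (i, j))))
    exact h1.congr (Filter.Eventually.of_forall fun t => hpt (i, j) t)
  refine Eq.trans ?_ hI.symm
  refine Finset.sum_congr rfl fun i _ => ?_
  rw [← hmp.integral_comp hme]
  exact integral_congr_ae (Filter.Eventually.of_forall fun t => hpt i t)

end ProductFormula

end NormalDensity

end

theorem mainTheorem2
    {EX₁ EX₂ EY₁ EY₂ EF₁ EF₂ : Type*}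
    [NormedAddCommGroup EX₁] [NormedSpace ℝ EX₁] [FiniteDimensional ℝ EX₁]
    [NormedAddCommGroup EX₂] [NormedSpace ℝ EX₂] [FiniteDimensional ℝ EX₂]
    [NormedAddCommGroup EY₁] [NormedSpace ℝ EY₁] [FiniteDimensional ℝ EY₁]
    [NormedAddCommGroup EY₂] [NormedSpace ℝ EY₂] [FiniteDimensional ℝ EY₂]
    [NormedAddCommGroup EF₁] [NormedSpace ℝ EF₁] [FiniteDimensional ℝ EF₁]
    [NormedAddCommGroup EF₂] [NormedSpace ℝ EF₂] [FiniteDimensional ℝ EF₂]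
    -- the manifolds `X₁`, `X₂`, `Y₁`, `Y₂` and the fibers `F₁`, `F₂`
    {X₁ X₂ Y₁ Y₂ F₁ F₂ : Type*}
    [TopologicalSpace X₁] [ChartedSpace EX₁ X₁] [IsManifold 𝓘(ℝ, EX₁) ∞ X₁]
    [TopologicalSpace X₂] [ChartedSpace EX₂ X₂] [IsManifold 𝓘(ℝ, EX₂) ∞ X₂]
    [TopologicalSpace Y₁] [ChartedSpace EY₁ Y₁] [IsManifold 𝓘(ℝ, EY₁) ∞ Y₁]
    [TopologicalSpace Y₂] [ChartedSpace EY₂ Y₂] [IsManifold 𝓘(ℝ, EY₂) ∞ Y₂]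
    [TopologicalSpace F₁] [ChartedSpace EF₁ F₁] [IsManifold 𝓘(ℝ, EF₁) ∞ F₁]
    [TopologicalSpace F₂] [ChartedSpace EF₂ F₂] [IsManifold 𝓘(ℝ, EF₂) ∞ F₂]
    [T2Space X₁] [SecondCountableTopology X₁] [T2Space X₂] [SecondCountableTopology X₂]
    [T2Space Y₁] [SecondCountableTopology Y₁] [T2Space Y₂] [SecondCountableTopology Y₂]
    [T2Space F₁] [CompactSpace F₁] [T2Space F₂] [CompactSpace F₂]
    -- the fiber bundles
    (p₁ : X₁ → Y₁) (p₂ : X₂ → Y₂)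
    (hp₁ : NormalDensity.IsSmoothFiberBundle 𝓘(ℝ, EX₁) 𝓘(ℝ, EY₁) 𝓘(ℝ, EF₁) F₁ p₁)
    (hp₂ : NormalDensity.IsSmoothFiberBundle 𝓘(ℝ, EX₂) 𝓘(ℝ, EY₂) 𝓘(ℝ, EF₂) F₂ p₂)
    -- the degrees: `lᵢ = mᵢ - dim Fᵢ`
    {m₁ m₂ l₁ l₂ : ℕ}
    (h₁ : l₁ + finrank ℝ EF₁ = m₁) (h₂ : l₂ + finrank ℝ EF₂ = m₂)
    -- the densities
    (δ₁ : NormalDensity.DensityField 𝓘(ℝ, EX₁) X₁ m₁) (δ₂ : NormalDensity.DensityField 𝓘(ℝ, EX₂) X₂ m₂)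
    (hδ₁ : NormalDensity.IsNormal δ₁) (hδ₂ : NormalDensity.IsNormal δ₂)
    (hd₁ : NormalDensity.IsLocallyDecomposable δ₁)
    (hd₂ : NormalDensity.IsLocallyDecomposable δ₂) :
    -- all densities that occur are normal
    NormalDensity.IsNormal (NormalDensity.prodMul δ₁ δ₂) ∧
    NormalDensity.IsNormal
      (NormalDensity.pushforward 𝓘(ℝ, EX₁) 𝓘(ℝ, EY₁) 𝓘(ℝ, EF₁) F₁ p₁ h₁ δ₁) ∧
    NormalDensity.IsNormal
      (NormalDensity.pushforward 𝓘(ℝ, EX₂) 𝓘(ℝ, EY₂) 𝓘(ℝ, EF₂) F₂ p₂ h₂ δ₂) ∧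
    NormalDensity.IsNormal
      (NormalDensity.pushforward (𝓘(ℝ, EX₁).prod 𝓘(ℝ, EX₂)) (𝓘(ℝ, EY₁).prod 𝓘(ℝ, EY₂))
        (𝓘(ℝ, EF₁).prod 𝓘(ℝ, EF₂)) (F₁ × F₂) (Prod.map p₁ p₂)
        (show l₁ + l₂ + finrank ℝ (EF₁ × EF₂) = m₁ + m₂ by rw [finrank_prod]; omega)
        (NormalDensity.prodMul δ₁ δ₂)) ∧
    -- the product formula
    NormalDensity.pushforward (𝓘(ℝ, EX₁).prod 𝓘(ℝ, EX₂)) (𝓘(ℝ, EY₁).prod 𝓘(ℝ, EY₂))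
        (𝓘(ℝ, EF₁).prod 𝓘(ℝ, EF₂)) (F₁ × F₂) (Prod.map p₁ p₂)
        (show l₁ + l₂ + finrank ℝ (EF₁ × EF₂) = m₁ + m₂ by rw [finrank_prod]; omega)
        (NormalDensity.prodMul δ₁ δ₂) =
      NormalDensity.prodMul
        (NormalDensity.pushforward 𝓘(ℝ, EX₁) 𝓘(ℝ, EY₁) 𝓘(ℝ, EF₁) F₁ p₁ h₁ δ₁)
        (NormalDensity.pushforward 𝓘(ℝ, EX₂) 𝓘(ℝ, EY₂) 𝓘(ℝ, EF₂) F₂ p₂ h₂ δ₂) := by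
  have hd := NormalDensity.isDec_prodMul hd₁.isDec hd₂.isDec
  have hc := NormalDensity.continuousFieldOn_prodMul hd₁ hd₂
  exact ⟨NormalDensity.isNormal_prodMul hd₁ hd₂,
    NormalDensity.isNormal_pushforward hp₁ hd₁.isDec hδ₁.continuous,
    NormalDensity.isNormal_pushforward hp₂ hd₂.isDec hδ₂.continuous,
    NormalDensity.isNormal_pushforward (NormalDensity.isSmoothFiberBundle_prod hp₁ hp₂) hd hc,
    NormalDensity.pushforward_prodMul hp₁ hp₂ hδ₁ hδ₂ hd₁ hd₂ h₁ h₂ _⟩
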